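/- **Setting.** Let $d\ge 2$, and let $n\ge 1$ sensors with pairwise distinct states $x_1,\dots,x_n\in\mathbb R^{d}$ communicate over a connected undirected graph $G$; $\mathsf N_i$ denotes the set of neighbors of $i$. Put $x^*_i:=x_i-x_1$ (states in the frame of sensor 1) and $m^*:=\frac1n\sum_i x^*_i$. Let $h(\cdot,y)$ be the signal field (in the frame of sensor 1) of a source with fixed state $y$, differentiable at $m^*$, and $g(\cdot,y):=\nabla_x h(\cdot,y)$. For $\delta>0$ and a configuration $x\in(\mathbb R^{d})^n$ with centroid $m=\frac1n\sum_i x_i$, define the finite-difference weights $W(x):=R(x)^T\Phi(x)^{-T}\in\mathbb R^{d\times n}$, where $\Phi_{ij}(x)=e^{-\delta^2\|x_j-x_i\|^2}$ and the $i$-th row of $R(x)$ is $2\delta^2e^{-\delta^2\|x_i-m\|^2}(x_i-m)^T$ (with $W(x):=0$ if $\Phi(x)$ is singular). Let $b:=W(x^*)\,(h(x_1^*,y),\dots,h(x_n^*,y))^T-g(m^*,y)$ be the finite-difference approximation error. **Measurements.** At times $k=0,1,\dots$ sensor $i$ receives, for every $j\in\mathsf N_i$, $s_{ij}(k)=x_j-x_i+\epsilon_{ij}(k)$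 with $\epsilon_{ij}(k)\sim\mathcal N(0,E_{ij})$, $E_{ij}\succ0$, independent over all times and all ordered pairs of neighbors, and $z_i(k)=h(x_i^*,y)+v_i(k)$, where $v_i(k)$ has zero mean and finite second moment, and each $v_i(k)$ is independent of the family of all relative-measurement noises. **Algorithm.** Write the stacked relative measurements of sensor $i$ as $s_i(k)=H_i\theta^*+\epsilon_i(k)$, where $\theta^*=(x_2^*,\dots,x_n^*)\in\mathbb R^{(n-1)d}$ and $\epsilon_i(k)$ has the block-diagonal covariance $E_i$ with blocks $E_{ij}$, $j\in\mathsf N_i$. With weights $a_{ij}>0$ for $j\in\mathsf N_i\cup\{i\}$, $\sum_{j\in\mathsf N_i\cup\{i\}}a_{ij}=1$, any deterministic initial vectors $\omega_{i,0}$ and matrices $\Omega_{i,0}\succ0$, sensor $i$ computes $$\omega_{i,k+1}=\sum_{j\in\mathsf N_i\cup\{i\}}a_{ij}\omega_{j,k}+H_i^TE_i^{-1}s_i(k),\qquad \Omega_{i,k+1}=\sum_{j\in\mathsf N_i\cup\{i\}}a_{ij}\Omega_{j,k}+H_i^TE_i^{-1}H_i,$$ and its estimate $\hat x^i(k):=(0,\Omega_{i,k}^{-1}\omega_{i,k})$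 of $x^*$. It forms the local gradient estimate $\hat g_i(k):=\mathbf{col}_i\bigl(W(\hat x^i(k))\bigr)\frac1{k+1}\sum_{\tau=0}^k z_i(\tau)$ and runs the high-pass dynamic consensus filter with input $\mu_{i,k}:=\hat g_i(k)$: $$q_{i,k+1}=q_{i,k}+\beta\sum_{j\in\mathsf N_i}(q_{j,k}-q_{i,k})+\beta\sum_{j\in\mathsf N_i}(\mu_{j,k}-\mu_{i,k}),\qquad r_{i,k}=q_{i,k}+\mu_{i,k},$$ where the initial states $q_{i,0}$ are deterministic with $\sum_iq_{i,0}=0$ (e.g. all zero) and the step-size $\beta>0$ satisfies $\beta\lambda<2$ for every eigenvalue $\lambda$ of the Laplacian of $G$. Assume finally that in the start-up phase $k<n$, before information from all sensors is guaranteed to have reached sensor $i$, the weights $\mathbf{col}_i(W(\hat x^i(k)))$ have a finite expectation for every $i$. **Theorem.** Then $\mathbb E[r_{i,k}]$ exists for all $i$ and $k$, the limit $\lim_{k\to\infty}\mathbb E[r_{i,k}]$ exists, and $$n\Bigl(\lim_{k\to\infty}\mathbb E[r_{i,k}]\Bigr)=g(m^*,y)+b\qquad\text{for all } i\in\{1,\dots,n\}.$$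 -/

import Mathlib

open MeasureTheory ProbabilityTheory Filter Topology

noncomputable section

namespace SourceSeeking

/-! ### Gaussian-RBF finite-difference weights -/

/-- The center of mass of the formation `x`. -/
def centroid {n d : ℕ} (x : Fin n → EuclideanSpace ℝ (Fin d)) : EuclideanSpace ℝ (Fin d) :=
  (n : ℝ)⁻¹ • ∑ i, x i

/-- The matrix `Φ(x)` with entries `exp (-δ² ‖x_j - x_i‖²)`. -/
def rbfMatrix {n d : ℕ} (δ : ℝ) (x : Fin n → EuclideanSpace ℝ (Fin d)) :
    Matrix (Fin n) (Fin n) ℝ :=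
  Matrix.of fun i j => Real.exp (-(δ ^ 2 * ‖x j - x i‖ ^ 2))

/-- The matrix `R(x)`: its `i`-th row is the row of partial derivatives at the centroid of the
Gaussian radial basis function centered at `x i`. -/
def rbfRhs {n d : ℕ} (δ : ℝ) (x : Fin n → EuclideanSpace ℝ (Fin d)) :
    Matrix (Fin n) (Fin d) ℝ :=
  Matrix.of fun i a =>
    2 * δ ^ 2 * Real.exp (-(δ ^ 2 * ‖x i - centroid x‖ ^ 2)) * (x i - centroid x) a

/-- The finite-difference weights `W(x) = R(x)ᵀ Φ(x)⁻ᵀ`, a `d × n` matrix. (The inverse is `0` when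
`Φ(x)` is singular, which happens exactly when two of the points of `x` coincide.) -/
def fdWeights {n d : ℕ} (δ : ℝ) (x : Fin n → EuclideanSpace ℝ (Fin d)) :
    Matrix (Fin d) (Fin n) ℝ :=
  (rbfRhs δ x).transpose * ((rbfMatrix δ x).transpose)⁻¹

/-- The `i`-th column of the matrix of finite-difference weights, as a vector. -/
def fdColumn {n d : ℕ} (δ : ℝ) (x : Fin n → EuclideanSpace ℝ (Fin d)) (i : Fin n) :
    EuclideanSpace ℝ (Fin d) :=
  WithLp.toLp 2 fun a => fdWeights δ x a i

/-- The error `b` of the finite-difference approximation of the gradient of the field `f` at the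
centroid of `x`, defined by `∇f(m) = W(x) (f(x_1), …, f(x_n)) - b`. -/
def fdError {n d : ℕ} (δ : ℝ) (f : EuclideanSpace ℝ (Fin d) → ℝ)
    (x : Fin n → EuclideanSpace ℝ (Fin d)) : EuclideanSpace ℝ (Fin d) :=
  WithLp.toLp 2 (Matrix.mulVec (fdWeights δ x) fun i => f (x i)) - gradient f (centroid x)

/-! ### The distributed linear Gaussian estimator -/

section Estimator

variable {n : ℕ} (G : SimpleGraph (Fin n)) [DecidableRel G.Adj] (a : Fin n → Fin n → ℝ)
  {ρ : Fin n → Type} [∀ i, Fintype (ρ i)] [∀ i, DecidableEq (ρ i)] {π : Type} [Fintype π]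

/-- The information matrices
`Ω_{i,k+1} = ∑_{j ∈ N_i ∪ {i}} a_ij Ω_{j,k} + H_iᵀ E_i⁻¹ H_i`. -/
def infoMatrix (H : ∀ i, Matrix (ρ i) π ℝ) (E : ∀ i, Matrix (ρ i) (ρ i) ℝ)
    (Ω₀ : Fin n → Matrix π π ℝ) : ℕ → Fin n → Matrix π π ℝ
  | 0 => Ω₀
  | k + 1 => fun i =>
      (∑ j ∈ insert i (G.neighborFinset i), a i j • infoMatrix H E Ω₀ k j)
        + (H i).transpose * (E i)⁻¹ * H i

/-- The information vectors
`ω_{i,k+1} = ∑_{j ∈ N_i ∪ {i}} a_ij ω_{j,k} + H_iᵀ E_i⁻¹ s_i(k)`. -/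
def infoVector (H : ∀ i, Matrix (ρ i) π ℝ) (E : ∀ i, Matrix (ρ i) (ρ i) ℝ)
    (s : ℕ → ∀ i, ρ i → ℝ) (ω₀ : Fin n → π → ℝ) : ℕ → Fin n → π → ℝ
  | 0 => ω₀
  | k + 1 => fun i =>
      (∑ j ∈ insert i (G.neighborFinset i), a i j • infoVector H E s ω₀ k j)
        + ((H i).transpose * (E i)⁻¹).mulVec (s k i)

/-- The estimate `Ω_{i,k}⁻¹ ω_{i,k}` of the parameter that agent `i` has at time `k`. -/
def gaussEstimate [DecidableEq π] (H : ∀ i, Matrix (ρ i) π ℝ) (E : ∀ i, Matrix (ρ i) (ρ i) ℝ)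
    (Ω₀ : Fin n → Matrix π π ℝ) (ω₀ : Fin n → π → ℝ) (s : ℕ → ∀ i, ρ i → ℝ)
    (k : ℕ) (i : Fin n) : π → ℝ :=
  ((infoMatrix G a H E Ω₀ k i)⁻¹).mulVec (infoVector G a H E s ω₀ k i)

end Estimator

/-! ### Estimation of the formation from relative measurements -/

/-- Index set of the unknown parameter: the coordinates of the states of all sensors other than
sensor `0`, which is the origin of the frame. -/
abbrev ParamIdx (n d : ℕ) [NeZero n] : Type := Fin d × {j : Fin n // j ≠ 0}

/-- Index set of the measurement vector of sensor `i`: the coordinates of its relative measurements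
of all its neighbors. -/
abbrev MeasIdx {n : ℕ} (G : SimpleGraph (Fin n)) (d : ℕ) (i : Fin n) : Type :=
  Fin d × G.neighborSet i

section Formation

variable {n d : ℕ} [NeZero n] (G : SimpleGraph (Fin n))

/-- The true sensor states in the frame of sensor `0`. -/
def localFrame (x : Fin n → EuclideanSpace ℝ (Fin d)) : Fin n → EuclideanSpace ℝ (Fin d) :=
  fun i => x i - x 0

/-- The observation matrix of sensor `i`: the block of rows indexed by the neighbor `j` maps a
formation `x` with `x 0 = 0` to `x j - x i`. -/
def obsMatrix (d : ℕ) (i : Fin n) : Matrix (MeasIdx G d i) (ParamIdx n d) ℝ :=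
  Matrix.of fun p q =>
    if p.1 = q.1 then
      (if (p.2 : Fin n) = (q.2 : Fin n) then 1 else 0) - (if i = (q.2 : Fin n) then 1 else 0)
    else 0

/-- The covariance of the measurement noise of sensor `i`: block diagonal, with one block `E_ij` for
every neighbor `j`. -/
def noiseCov (E : Fin n → Fin n → Matrix (Fin d) (Fin d) ℝ) (i : Fin n) :
    Matrix (MeasIdx G d i) (MeasIdx G d i) ℝ :=
  Matrix.blockDiagonal fun j : G.neighborSet i => E i j

/-- The stacked measurements `s_ij(k) = x_j - x_i + ε_ij(k)`, `j ∈ N_i`, of sensor `i`. -/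
def relMeas (x : Fin n → EuclideanSpace ℝ (Fin d))
    (ε : Fin n → Fin n → ℕ → EuclideanSpace ℝ (Fin d)) (k : ℕ) (i : Fin n) :
    MeasIdx G d i → ℝ :=
  fun p => (x p.2 - x i + ε i p.2 k) p.1

/-- A full formation from a parameter vector: sensor `0` is placed at the origin. -/
def formation (θ : ParamIdx n d → ℝ) : Fin n → EuclideanSpace ℝ (Fin d) :=
  fun j => if h : j = 0 then 0 else WithLp.toLp 2 fun c => θ (c, ⟨j, h⟩)

variable [DecidableRel G.Adj] (a : Fin n → Fin n → ℝ)

/-- The estimate `x̂^i(k)` that sensor `i` has of the formation (in the frame of sensor `0`) at time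
`k`, computed by the distributed Gaussian estimator from the relative measurements. -/
def stateEstimate (E : Fin n → Fin n → Matrix (Fin d) (Fin d) ℝ)
    (Ω₀ : Fin n → Matrix (ParamIdx n d) (ParamIdx n d) ℝ) (ω₀ : Fin n → ParamIdx n d → ℝ)
    (x : Fin n → EuclideanSpace ℝ (Fin d)) (ε : Fin n → Fin n → ℕ → EuclideanSpace ℝ (Fin d))
    (i : Fin n) (k : ℕ) : Fin n → EuclideanSpace ℝ (Fin d) :=
  formation (gaussEstimate G a (obsMatrix G d) (noiseCov G E) Ω₀ ω₀ (relMeas G x ε) k i)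

end Formation

/-! ### Local gradient estimates and the high-pass dynamic consensus filter -/

/-- The local gradient estimate of sensor `i` at time `k`: the `i`-th column of the weights computed
from its estimate `xhat` of the formation, times the average of its signal measurements
`z 0, …, z k`. -/
def localGradient {n d : ℕ} (δ : ℝ) (xhat : Fin n → EuclideanSpace ℝ (Fin d)) (i : Fin n)
    (z : ℕ → ℝ) (k : ℕ) : EuclideanSpace ℝ (Fin d) :=
  (((k : ℝ) + 1)⁻¹ * ∑ τ ∈ Finset.range (k + 1), z τ) • fdColumn δ xhat i

section Filter

variable {n d : ℕ} (G : SimpleGraph (Fin n)) [DecidableRel G.Adj] (β : ℝ)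

/-- The state of the filter:
`q_{i,k+1} = q_{i,k} + β ∑_{j ∈ N_i} (q_{j,k} - q_{i,k}) + β ∑_{j ∈ N_i} (μ_{j,k} - μ_{i,k})`. -/
def filterState (q₀ : Fin n → EuclideanSpace ℝ (Fin d))
    (μ : Fin n → ℕ → EuclideanSpace ℝ (Fin d)) : ℕ → Fin n → EuclideanSpace ℝ (Fin d)
  | 0 => q₀
  | k + 1 => fun i =>
      filterState q₀ μ k i
        + β • (∑ j ∈ G.neighborFinset i, (filterState q₀ μ k j - filterState q₀ μ k i))
        + β • (∑ j ∈ G.neighborFinset i, (μ j k - μ i k))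

/-- The output of the filter: `r_{i,k} = q_{i,k} + μ_{i,k}`. -/
def filterOutput (q₀ : Fin n → EuclideanSpace ℝ (Fin d))
    (μ : Fin n → ℕ → EuclideanSpace ℝ (Fin d)) (i : Fin n) (k : ℕ) : EuclideanSpace ℝ (Fin d) :=
  filterState G β q₀ μ k i + μ i k

end Filter

/-- The output `r_{i,k}` of the whole distributed algorithm, for one realization of the relative
measurement noise `ε` and of the signal measurements `z`: the consensus filter is run with inputs
`μ_{i,k}` the local gradient estimates. -/
def gradientOutput {n d : ℕ} [NeZero n] (G : SimpleGraph (Fin n)) [DecidableRel G.Adj]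
    (a : Fin n → Fin n → ℝ) (E : Fin n → Fin n → Matrix (Fin d) (Fin d) ℝ)
    (Ω₀ : Fin n → Matrix (ParamIdx n d) (ParamIdx n d) ℝ) (ω₀ : Fin n → ParamIdx n d → ℝ)
    (δ β : ℝ) (q₀ : Fin n → EuclideanSpace ℝ (Fin d))
    (x : Fin n → EuclideanSpace ℝ (Fin d)) (ε : Fin n → Fin n → ℕ → EuclideanSpace ℝ (Fin d))
    (z : Fin n → ℕ → ℝ) (i : Fin n) (k : ℕ) : EuclideanSpace ℝ (Fin d) :=
  filterOutput G β q₀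
    (fun j l => localGradient δ (stateEstimate G a E Ω₀ ω₀ x ε j l) j (z j) l) i k

end SourceSeeking

end

/-!
The relative measurements enter the gradient estimates only through the weights, and the signal
noise is unbiased and independent of the weights. So the expectation of a local gradient estimate is
`z i • 𝔼[Y i k]`, where `z i` is the true signal and `Y i k` is the `i`-th column of the weights at
the `i`-th state estimate (`integrable_and_integral_localGradient`). The consensus filter is linear
and commutes with expectations (`integral_filterState`), and it turns converging inputs into the
average of their limits (`tendsto_filterOutput`), because the step-size makes it contract on the
vectors of zero sum. Since `∑ i, z i • W_i = W z` for the columns `W_i` of the weights `W` of the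
true formation, and `W z` is the gradient plus the approximation error by definition of the latter,
the theorem comes down to `𝔼[Y i k] → W_i` (`integrable_and_tendsto_fdColumn`).

The state estimate is an affine function of the Gaussian noises, hence Gaussian
(`map_gaussEstimate`). Connectedness makes the information of each sensor grow linearly in time, so
that its mean tends to the true formation and its covariance decays like `1 / k`, while the
covariance is bounded below by a multiple of `1 / k ^ 2`.

The weights are unbounded: they blow up where two points of the configuration coincide, so that the
concentration of the estimate alone is not enough. The bound used is
`W_i² ≤ C * ∏ l ≠ i, (1 + C / ‖x l - x i‖²)` (`sq_fdWeights_le`). The matrix `Φ` dominates, in the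
order of positive semidefinite matrices, the rank-one matrix of each function in the unit ball of
the Hilbert space with the Gaussian kernel. For the partial derivatives of the kernel at the
centroid this reduces the claim to the diagonal entry `(Φ⁻¹)_ii`. For a product, over `l ≠ i`, of
functions that vanish at `x l` (`Φ` is a Hadamard power of Gaussian kernels of larger width, and
Schur's product theorem applies) it bounds that entry. Only differences with the one point `x i`
occur, and these are independent linear functions of the configuration. As `d ≥ 2`, each factor is
at most a constant times the product of `1 + |s|⁻¹` over two coordinates `s` of the difference, and
a Gaussian variable has negative moments of each order less than `1`. So `‖Y i k‖` has a moment of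
order `3 / 2`, which grows at most polynomially in `k` (`exists_lintegral_singularFactor_le`); the
probability that the estimate lies outside a fixed neighborhood of the truth is exponentially
small in `√k`, and this yields the convergence of the expectations
(`tendsto_integral_multivariateGaussian`).
-/

namespace SourceSeeking

open Matrix
open scoped RealInnerProductSpace

/-! ### Positive semidefinite kernels and the finite-difference weights -/

theorem posSemidef_of_sum_nonneg {ι : Type*} [Fintype ι] {M : Matrix ι ι ℝ}
    (hM : ∀ i j, M j i = M i j) (h : ∀ c : ι → ℝ, 0 ≤ ∑ i, ∑ j, c i * c j * M i j) :
    M.PosSemidef := by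
  refine PosSemidef.of_dotProduct_mulVec_nonneg ?_ fun c => ?_
  · ext i j
    simpa using hM i j
  · refine (h c).trans_eq (Finset.sum_congr rfl fun i _ => ?_)
    rw [mulVec, dotProduct, Finset.mul_sum]
    exact Finset.sum_congr rfl fun j _ => by rw [Pi.star_apply, star_trivial]; ring

theorem sum_nonneg_of_posSemidef {ι : Type*} [Fintype ι] {M : Matrix ι ι ℝ}
    (hM : M.PosSemidef) (c : ι → ℝ) : 0 ≤ ∑ i, ∑ j, c i * c j * M i j := by
  refine (hM.dotProduct_mulVec_nonneg c).trans_eq (Finset.sum_congr rfl fun i _ => ?_)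
  rw [mulVec, dotProduct, Finset.mul_sum]
  exact Finset.sum_congr rfl fun j _ => by rw [Pi.star_apply, star_trivial]; ring

theorem posSemidef_of_mul {ι : Type*} [Fintype ι] (f : ι → ℝ) :
    (Matrix.of fun i j => f i * f j : Matrix ι ι ℝ).PosSemidef := by
  exact posSemidef_vecMulVec_self_star f

theorem posSemidef_of_eq_hadamard {ι : Type*} [Fintype ι] {A B C : Matrix ι ι ℝ}
    (hA : A.PosSemidef) (hB : B.PosSemidef) (h : ∀ i j, C i j = A i j * B i j) :
    C.PosSemidef := by
  have e : C = A ⊙ B := by ext i j; exact h i j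
  rw [e]
  exact hA.hadamard hB

theorem posSemidef_of_pow {ι : Type*} [Fintype ι] {K : Matrix ι ι ℝ} (hK : K.PosSemidef)
    (m : ℕ) : (Matrix.of fun i j => K i j ^ m : Matrix ι ι ℝ).PosSemidef := by
  induction m with
  | zero => simpa using posSemidef_of_mul (fun _ : ι => (1 : ℝ))
  | succ m ih =>
    exact posSemidef_of_eq_hadamard ih hK fun i j => pow_succ _ _

/-- Schur: the entrywise exponential of a positive semidefinite matrix dominates the first two terms
of its entrywise power series. -/
theorem posSemidef_exp_sub {ι : Type*} [Fintype ι] {K : Matrix ι ι ℝ} (hK : K.PosSemidef) :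
    (Matrix.of fun i j => Real.exp (K i j) - (1 + K i j) : Matrix ι ι ℝ).PosSemidef := by
  have hsymm : ∀ i j, K j i = K i j := fun i j => by
    have := congrFun (congrFun hK.isHermitian i) j
    simpa using this
  refine posSemidef_of_sum_nonneg (fun i j => by simp [hsymm i j]) fun c => ?_
  have hs : ∀ x : ℝ, HasSum (fun m : ℕ => x ^ (m + 2) / ((m + 2).factorial : ℝ))
      (Real.exp x - (1 + x)) := by
    intro x
    have h := NormedSpace.expSeries_div_hasSum_exp (𝔸 := ℝ) x
    rw [← Real.exp_eq_exp_ℝ] at h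
    have := (hasSum_nat_add_iff' 2).2 h
    simpa [Finset.sum_range_succ] using this
  have hsum : HasSum
      (fun m : ℕ => ∑ i, ∑ j, c i * c j * (K i j ^ (m + 2) / ((m + 2).factorial : ℝ)))
      (∑ i, ∑ j, c i * c j * (Real.exp (K i j) - (1 + K i j))) :=
    hasSum_sum fun i _ => hasSum_sum fun j _ => (hs (K i j)).mul_left _
  refine hsum.nonneg fun m => ?_
  have h0 := sum_nonneg_of_posSemidef (posSemidef_of_pow hK (m + 2)) c
  have : ∑ i, ∑ j, c i * c j * (K i j ^ (m + 2) / ((m + 2).factorial : ℝ))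
      = (∑ i, ∑ j, c i * c j * K i j ^ (m + 2)) / ((m + 2).factorial : ℝ) := by
    simp only [Finset.sum_div]
    exact Finset.sum_congr rfl fun i _ => Finset.sum_congr rfl fun j _ => by ring
  rw [this]
  simp only [of_apply] at h0
  positivity

section Kernel

variable {ι V : Type*} [Fintype ι] [NormedAddCommGroup V] [InnerProductSpace ℝ V]

/-- The squared affine function `(α + β ⟪e, ·⟫)²` is dominated, as a kernel, by the exponential
kernel as soon as it is so at first order. -/
theorem posSemidef_exp_inner_sub (u : ι → V) {η α β : ℝ} (hη : 0 < η) (e : V) (he : ‖e‖ ≤ 1)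
    (hαβ : α ^ 2 + β ^ 2 / (2 * η) ≤ 1) :
    (Matrix.of fun i j => Real.exp (2 * η * ⟪u i, u j⟫)
      - (α + β * ⟪e, u i⟫) * (α + β * ⟪e, u j⟫) : Matrix ι ι ℝ).PosSemidef := by
  have hK : (Matrix.of fun i j => 2 * η * ⟪u i, u j⟫ : Matrix ι ι ℝ).PosSemidef := by
    exact (posSemidef_gram (𝕜 := ℝ) (v := u)).smul (show (0:ℝ) ≤ 2 * η by positivity)
  have h2 : (Matrix.of fun i j => 1 + 2 * η * ⟪u i, u j⟫
      - (α + β * ⟪e, u i⟫) * (α + β * ⟪e, u j⟫) : Matrix ι ι ℝ).PosSemidef := by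
    refine posSemidef_of_sum_nonneg (fun i j => ?_) fun c => ?_
    · simp only [of_apply, real_inner_comm (u i) (u j)]; ring
    · set S := ∑ i, c i with hS
      set U := ∑ i, c i • u i with hU
      have e1 : ∑ i, ∑ j, c i * c j * (Matrix.of fun i j => 1 + 2 * η * ⟪u i, u j⟫
          - (α + β * ⟪e, u i⟫) * (α + β * ⟪e, u j⟫) : Matrix ι ι ℝ) i j
          = S ^ 2 + 2 * η * ⟪U, U⟫ - (α * S + β * ⟪e, U⟫) ^ 2 := by
        have hUU : ⟪U, U⟫ = ∑ i, ∑ j, c i * c j * ⟪u i, u j⟫ := by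
          rw [hU, sum_inner]
          refine Finset.sum_congr rfl fun i _ => ?_
          rw [inner_sum]
          refine Finset.sum_congr rfl fun j _ => ?_
          rw [real_inner_smul_left, real_inner_smul_right]; ring
        have hl : α * S + β * ⟪e, U⟫ = ∑ i, c i * (α + β * ⟪e, u i⟫) := by
          rw [hS, hU, inner_sum, Finset.mul_sum, Finset.mul_sum, ← Finset.sum_add_distrib]
          refine Finset.sum_congr rfl fun i _ => ?_
          rw [real_inner_smul_right]; ring
        rw [hUU, hl, hS, sq, sq, Finset.sum_mul_sum, Finset.sum_mul_sum, Finset.mul_sum]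
        simp_rw [Finset.mul_sum]
        rw [← Finset.sum_add_distrib, ← Finset.sum_sub_distrib]
        refine Finset.sum_congr rfl fun i _ => ?_
        rw [← Finset.sum_add_distrib, ← Finset.sum_sub_distrib]
        refine Finset.sum_congr rfl fun j _ => ?_
        simp only [of_apply]; ring
      rw [e1, real_inner_self_eq_norm_sq]
      set t := ⟪e, U⟫ with ht
      have htU : t ^ 2 ≤ ‖U‖ ^ 2 := by
        have h1 : |t| ≤ ‖U‖ := (abs_real_inner_le_norm e U).trans
          (mul_le_of_le_one_left (norm_nonneg _) he)
        rw [← sq_abs t]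
        gcongr
      -- Cauchy-Schwarz in the plane, with weights `1` and `2 * η`
      have hcs : (α * S + β * t) ^ 2 ≤ (α ^ 2 + β ^ 2 / (2 * η)) * (S ^ 2 + 2 * η * t ^ 2) := by
        have : (α ^ 2 + β ^ 2 / (2 * η)) * (S ^ 2 + 2 * η * t ^ 2) - (α * S + β * t) ^ 2
            = (2 * η * α * t - β * S) ^ 2 / (2 * η) := by
          field_simp; ring
        have h3 : 0 ≤ (2 * η * α * t - β * S) ^ 2 / (2 * η) := by positivity
        linarith
      have h4 : (α ^ 2 + β ^ 2 / (2 * η)) * (S ^ 2 + 2 * η * t ^ 2) ≤ S ^ 2 + 2 * η * t ^ 2 :=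
        mul_le_of_le_one_left (by positivity) hαβ
      nlinarith [mul_le_mul_of_nonneg_left htU (show (0:ℝ) ≤ 2 * η by positivity)]
  convert (posSemidef_exp_sub hK).add h2 using 1
  ext i j
  simp

/-- The Gaussian kernel is the exponential kernel of the vectors `x i - p`, multiplied by
`exp (-η ‖x i - p‖²)` in each variable. -/
theorem posSemidef_gaussian_sub (x : ι → V) (p : V) {η α β : ℝ} (hη : 0 < η) (e : V)
    (he : ‖e‖ ≤ 1) (hαβ : α ^ 2 + β ^ 2 / (2 * η) ≤ 1) :
    (Matrix.of fun i j => Real.exp (-(η * ‖x j - x i‖ ^ 2))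
      - (Real.exp (-(η * ‖x i - p‖ ^ 2)) * (α + β * ⟪e, x i - p⟫)) *
        (Real.exp (-(η * ‖x j - p‖ ^ 2)) * (α + β * ⟪e, x j - p⟫)) : Matrix ι ι ℝ).PosSemidef := by
  have h1 := posSemidef_exp_inner_sub (fun i => x i - p) hη e he hαβ
  have h2 := posSemidef_of_mul (fun i => Real.exp (-(η * ‖x i - p‖ ^ 2)))
  refine posSemidef_of_eq_hadamard h1 h2 fun i j => ?_
  have : Real.exp (-(η * ‖x j - x i‖ ^ 2)) = Real.exp (2 * η * ⟪x i - p, x j - p⟫) *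
      (Real.exp (-(η * ‖x i - p‖ ^ 2)) * Real.exp (-(η * ‖x j - p‖ ^ 2))) := by
    rw [← Real.exp_add, ← Real.exp_add]
    congr 1
    have : x j - x i = (x j - p) - (x i - p) := by abel
    rw [this, norm_sub_sq_real, real_inner_comm]
    ring
  simp only [of_apply, this]
  ring

end Kernel

/-- Schur: domination of rank-one kernels is preserved by entrywise products. -/
theorem posSemidef_prod_sub {ι κ : Type*} [Fintype ι] (s : Finset κ)
    (K : κ → Matrix ι ι ℝ) (ψ : κ → ι → ℝ)
    (h : ∀ l ∈ s, (Matrix.of fun i j => K l i j - ψ l i * ψ l j : Matrix ι ι ℝ).PosSemidef) :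
    (Matrix.of fun i j => (∏ l ∈ s, K l i j) - (∏ l ∈ s, ψ l i) * (∏ l ∈ s, ψ l j) :
      Matrix ι ι ℝ).PosSemidef := by
  classical
  induction s using Finset.induction_on with
  | empty =>
    simp only [Finset.prod_empty, mul_one, sub_self]
    exact PosSemidef.zero
  | insert l s hl ih =>
    have ih' := ih fun m hm => h m (Finset.mem_insert_of_mem hm)
    have h1 := h l (Finset.mem_insert_self l s)
    -- the product is monotone: `A ∘ C - B ∘ D = (A - B) ∘ C + B ∘ (C - D)`
    have h2 := posSemidef_of_eq_hadamard (h1.add (posSemidef_of_mul (ψ l))) ih' fun _ _ => rfl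
    have h3 := posSemidef_of_eq_hadamard h1 (posSemidef_of_mul fun i => ∏ m ∈ s, ψ m i)
      fun _ _ => rfl
    convert h2.add h3 using 1
    ext i j
    change _ = (_ * _ : ℝ) + (_ * _ : ℝ)
    simp only [of_apply, Finset.prod_insert hl, Matrix.add_apply]
    ring

section Weights

variable {n d : ℕ}

theorem rbfMatrix_transpose (δ : ℝ) (x : Fin n → EuclideanSpace ℝ (Fin d)) :
    (rbfMatrix δ x).transpose = rbfMatrix δ x := by
  ext i j
  simp [rbfMatrix, norm_sub_rev]

/-- Lower bound for the Gaussian kernel matrix in the direction of one basis vector. The dominated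
rank-one kernel is a product of functions, one for each point `x l ≠ x j`, that vanish at `x l`. -/
theorem posSemidef_rbfMatrix_sub_single {δ : ℝ} (hδ : 0 < δ)
    (x : Fin n → EuclideanSpace ℝ (Fin d)) (j : Fin n) (hx : ∀ l, l ≠ j → x l ≠ x j) :
    (Matrix.of fun i i' => rbfMatrix δ x i i'
      - (if i = j then ∏ l ∈ Finset.univ.erase j,
          (Real.sqrt (1 + n / (2 * δ ^ 2) / ‖x l - x j‖ ^ 2))⁻¹ else 0) *
        (if i' = j then ∏ l ∈ Finset.univ.erase j,
          (Real.sqrt (1 + n / (2 * δ ^ 2) / ‖x l - x j‖ ^ 2))⁻¹ else 0) :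
        Matrix (Fin n) (Fin n) ℝ).PosSemidef := by
  have hn : 0 < n := Fin.pos j
  have hn' : (0 : ℝ) < n := by exact_mod_cast hn
  -- `Φ` is the entrywise product of `n` Gaussian kernels of parameter `η`; the one with index `l`
  -- dominates the kernel of `ψ l`, which vanishes at `x l` and takes the value `α l` at `x j`
  set η : ℝ := δ ^ 2 / n with hη
  have hη0 : 0 < η := by positivity
  let r : Fin n → ℝ := fun l => ‖x l - x j‖
  let α : Fin n → ℝ := fun l => if l = j then 1 else
    (Real.sqrt (1 + n / (2 * δ ^ 2) / r l ^ 2))⁻¹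
  let β : Fin n → ℝ := fun l => if l = j then 0 else -(α l / r l)
  let e : Fin n → EuclideanSpace ℝ (Fin d) := fun l => (r l)⁻¹ • (x l - x j)
  let ψ : Fin n → Fin n → ℝ := fun l i =>
    Real.exp (-(η * ‖x i - x j‖ ^ 2)) * (α l + β l * ⟪e l, x i - x j⟫)
  have hr : ∀ l, l ≠ j → 0 < r l := fun l hl => norm_pos_iff.2 (sub_ne_zero.2 (hx l hl))
  have key := posSemidef_prod_sub Finset.univ
    (fun _ => Matrix.of fun i i' => Real.exp (-(η * ‖x i' - x i‖ ^ 2))) ψ (by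
      intro l _
      refine posSemidef_gaussian_sub x (x j) hη0 (e l) ?_ ?_
      · by_cases hl : l = j
        · simp [e, hl]
        · simp only [e, norm_smul, norm_inv, Real.norm_eq_abs, abs_of_pos (hr l hl)]
          exact (inv_mul_cancel₀ (hr l hl).ne').le
      · by_cases hl : l = j
        · simp [α, β, hl]
        · have h0 := hr l hl
          have hα : α l ^ 2 = (1 + n / (2 * δ ^ 2) / r l ^ 2)⁻¹ := by
            simp only [α, if_neg hl]
            rw [inv_pow, Real.sq_sqrt (by positivity)]
          have : α l ^ 2 + β l ^ 2 / (2 * η) = α l ^ 2 * (1 + n / (2 * δ ^ 2) / r l ^ 2) := by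
            simp only [β, if_neg hl, hη]
            field_simp
          rw [this, hα, inv_mul_cancel₀ (by positivity)])
  convert key using 1
  ext i i'
  have hprod : ∀ i, ∏ l, ψ l i = if i = j then ∏ l ∈ Finset.univ.erase j,
          (Real.sqrt (1 + n / (2 * δ ^ 2) / ‖x l - x j‖ ^ 2))⁻¹ else 0 := by
    intro i
    split_ifs with hi
    · rw [← Finset.mul_prod_erase _ _ (Finset.mem_univ j)]
      have : ψ j i = 1 := by simp [ψ, α, β, hi]
      rw [this, one_mul]
      refine Finset.prod_congr rfl fun l hl => ?_
      have hl' := Finset.ne_of_mem_erase hl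
      simp [ψ, α, hi, hl', r]
    · refine Finset.prod_eq_zero (Finset.mem_univ i) ?_
      have h0 := hr i hi
      have : ⟪e i, x i - x j⟫ = r i := by
        simp only [e, real_inner_smul_left, real_inner_self_eq_norm_sq]
        change (r i)⁻¹ * r i ^ 2 = r i
        field_simp
      simp only [ψ, this, β, if_neg hi]
      field_simp
      simp
  simp only [of_apply, hprod]
  congr 1
  rw [Finset.prod_const, ← Real.exp_nat_mul]
  simp only [rbfMatrix, of_apply, hη, Finset.card_univ, Fintype.card_fin]
  congr 1
  field_simp

/-- The columns of `R(x)`, divided by `√(2 δ²)`, give rank-one kernels dominated by the Gaussian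
kernel: the partial derivatives of the kernel are in its Hilbert space. -/
theorem posSemidef_rbfMatrix_sub_rbfRhs {δ : ℝ} (hδ : 0 < δ)
    (x : Fin n → EuclideanSpace ℝ (Fin d)) (a : Fin d) :
    (Matrix.of fun i i' => rbfMatrix δ x i i'
      - (Real.sqrt (2 * δ ^ 2))⁻¹ * rbfRhs δ x i a * ((Real.sqrt (2 * δ ^ 2))⁻¹ * rbfRhs δ x i' a) :
        Matrix (Fin n) (Fin n) ℝ).PosSemidef := by
  have hs : Real.sqrt (2 * δ ^ 2) ^ 2 = 2 * δ ^ 2 := Real.sq_sqrt (by positivity)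
  have hs0 : 0 < Real.sqrt (2 * δ ^ 2) := by positivity
  have key := posSemidef_gaussian_sub x (centroid x) (η := δ ^ 2) (α := 0)
    (β := Real.sqrt (2 * δ ^ 2)) (by positivity) (EuclideanSpace.single a (1 : ℝ)) (by simp)
    (by rw [hs]; field_simp; norm_num)
  convert key using 1
  ext i i'
  have : ∀ i, (Real.sqrt (2 * δ ^ 2))⁻¹ * rbfRhs δ x i a =
      Real.exp (-(δ ^ 2 * ‖x i - centroid x‖ ^ 2)) * (0 +
        Real.sqrt (2 * δ ^ 2) * ⟪EuclideanSpace.single a (1 : ℝ), x i - centroid x⟫) := by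
    intro i
    rw [EuclideanSpace.inner_single_left]
    simp only [rbfRhs, of_apply]
    simp only [map_one, zero_add, PiLp.sub_apply]
    set s := Real.sqrt (2 * δ ^ 2)
    rw [← hs]
    field_simp
  simp only [of_apply, this, rbfMatrix]

theorem isUnit_det_rbfMatrix {δ : ℝ} (hδ : 0 < δ) {x : Fin n → EuclideanSpace ℝ (Fin d)}
    (hx : Function.Injective x) : IsUnit (rbfMatrix δ x).det := by
  rw [isUnit_iff_ne_zero]
  intro h0
  obtain ⟨c, hc, hc0⟩ := exists_mulVec_eq_zero_iff.2 h0
  apply hc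
  funext j
  have h1 := sum_nonneg_of_posSemidef (posSemidef_rbfMatrix_sub_single hδ x j
    fun l hl => hx.ne hl) c
  set κ : ℝ := ∏ l ∈ Finset.univ.erase j, (Real.sqrt (1 + n / (2 * δ ^ 2) / ‖x l - x j‖ ^ 2))⁻¹
  have hκ : 0 < κ := Finset.prod_pos fun l _ => by positivity
  have h2 : ∑ i, ∑ i', c i * c i' * rbfMatrix δ x i i' = 0 := by
    refine Finset.sum_eq_zero fun i _ => ?_
    have := congrFun hc0 i
    simp only [mulVec, dotProduct, Pi.zero_apply] at this
    simp_rw [mul_assoc]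
    rw [← Finset.mul_sum]
    simp_rw [mul_comm (c _)]
    rw [this, zero_mul]
  simp only [of_apply, mul_sub, Finset.sum_sub_distrib, h2] at h1
  simp only [ite_mul, mul_ite, mul_zero, zero_mul, Finset.sum_ite_eq', Finset.mem_univ,
    if_true] at h1
  have h3 : c j * c j * (κ * κ) ≤ 0 := by simpa using h1
  have h4 : 0 < κ * κ := by positivity
  have h5 : c j * c j ≤ 0 := by
    by_contra hcon
    push Not at hcon
    exact absurd h3 (not_le.2 (mul_pos hcon h4))
  exact mul_self_eq_zero.1 (le_antisymm h5 (mul_self_nonneg _))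

/-- With `w = Φ⁻¹ e_j` one has `wᵀ Φ w = w_j`. Domination of `R` by `Φ` gives `W_aj² ≤ 2 δ² w_j`,
and domination of the kernel that is carried by the point `x j` gives `w_j² κ² ≤ w_j`. -/
theorem sq_fdWeights_le {δ : ℝ} (hδ : 0 < δ) (x : Fin n → EuclideanSpace ℝ (Fin d))
    (hΦ : IsUnit (rbfMatrix δ x).det) (a : Fin d) (j : Fin n) (hx : ∀ l, l ≠ j → x l ≠ x j) :
    fdWeights δ x a j ^ 2 ≤
      2 * δ ^ 2 * ∏ l ∈ Finset.univ.erase j, (1 + n / (2 * δ ^ 2) / ‖x l - x j‖ ^ 2) := by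
  set w : Fin n → ℝ := fun i => (rbfMatrix δ x)⁻¹ i j with hw
  have hΦw : ∀ i, ∑ i', rbfMatrix δ x i i' * w i' = if i = j then 1 else 0 := by
    intro i
    have := congrFun (congrFun (mul_nonsing_inv _ hΦ) i) j
    simpa [Matrix.mul_apply, Matrix.one_apply] using this
  have hquad : ∑ i, ∑ i', w i * w i' * rbfMatrix δ x i i' = w j := by
    have : ∀ i, ∑ i', w i * w i' * rbfMatrix δ x i i' = w i * if i = j then 1 else 0 := by
      intro i
      rw [← hΦw i, Finset.mul_sum]
      exact Finset.sum_congr rfl fun i' _ => by ring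
    simp [this]
  have hW : fdWeights δ x a j = ∑ i, rbfRhs δ x i a * w i := by
    simp [fdWeights, rbfMatrix_transpose, Matrix.mul_apply, hw]
  have h1 : fdWeights δ x a j ^ 2 ≤ 2 * δ ^ 2 * w j := by
    have h := sum_nonneg_of_posSemidef (posSemidef_rbfMatrix_sub_rbfRhs hδ x a) w
    simp only [of_apply, mul_sub, Finset.sum_sub_distrib, hquad] at h
    have e : ∑ i, ∑ i', w i * w i' * ((Real.sqrt (2 * δ ^ 2))⁻¹ * rbfRhs δ x i a *
        ((Real.sqrt (2 * δ ^ 2))⁻¹ * rbfRhs δ x i' a)) = (2 * δ ^ 2)⁻¹ * fdWeights δ x a j ^ 2 := by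
      rw [hW, sq (∑ i, _), Finset.sum_mul_sum, Finset.mul_sum]
      refine Finset.sum_congr rfl fun i _ => ?_
      rw [Finset.mul_sum]
      refine Finset.sum_congr rfl fun i' _ => ?_
      rw [← Real.sq_sqrt (show (0:ℝ) ≤ 2 * δ ^ 2 by positivity)]
      simp only [Real.sqrt_sq (Real.sqrt_nonneg _)]
      ring
    rw [e] at h
    have h2 : (2 * δ ^ 2)⁻¹ * fdWeights δ x a j ^ 2 ≤ w j := by linarith
    rwa [inv_mul_le_iff₀ (by positivity)] at h2
  refine h1.trans (mul_le_mul_of_nonneg_left ?_ (by positivity))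
  have h := sum_nonneg_of_posSemidef (posSemidef_rbfMatrix_sub_single hδ x j hx) w
  set κ : ℝ := ∏ l ∈ Finset.univ.erase j, (Real.sqrt (1 + n / (2 * δ ^ 2) / ‖x l - x j‖ ^ 2))⁻¹
    with hκd
  have hκ : κ * κ * ∏ l ∈ Finset.univ.erase j, (1 + n / (2 * δ ^ 2) / ‖x l - x j‖ ^ 2) = 1 := by
    rw [hκd, ← Finset.prod_mul_distrib, ← Finset.prod_mul_distrib]
    refine Finset.prod_eq_one fun l _ => ?_
    rw [← mul_inv, Real.mul_self_sqrt (by positivity), inv_mul_cancel₀ (by positivity)]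
  have hκ0 : 0 < κ := Finset.prod_pos fun l _ => by positivity
  simp only [of_apply, mul_sub, Finset.sum_sub_distrib, hquad] at h
  simp only [ite_mul, mul_ite, mul_zero, zero_mul, Finset.sum_ite_eq', Finset.mem_univ,
    if_true] at h
  have h3 : w j * w j * (κ * κ) ≤ w j := by simpa using h
  have h4 : w j * (κ * κ) ≤ 1 := by
    rcases le_or_gt (w j) 0 with h0 | h0
    · exact (mul_nonpos_of_nonpos_of_nonneg h0 (by positivity)).trans zero_le_one
    · have : w j * (w j * (κ * κ)) ≤ w j * 1 := by linarith
      exact le_of_mul_le_mul_left this h0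
  calc w j = w j * (κ * κ) * ∏ l ∈ Finset.univ.erase j,
        (1 + n / (2 * δ ^ 2) / ‖x l - x j‖ ^ 2) := by rw [mul_assoc, hκ, mul_one]
    _ ≤ 1 * _ := by
        refine mul_le_mul_of_nonneg_right h4 (Finset.prod_nonneg fun l _ => by positivity)
    _ = _ := one_mul _

/-- The singularity of the weights near coinciding points, coordinatewise: the factor attached to
the coordinate `c` of a difference of two points. Only the first two coordinates carry a
singularity; their factor is infinite at `0`. -/
noncomputable def singularFactor {d : ℕ} (c : Fin d) (s : ℝ) : ENNReal :=
  if (c : ℕ) < 2 then 1 + ‖s‖ₑ⁻¹ else 1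

theorem measurable_singularFactor (c : Fin d) : Measurable (singularFactor c) := by
  unfold singularFactor
  split_ifs <;> fun_prop

/-- The singularity `‖u‖⁻²`, which is not integrable in the plane, is dominated by
`|u 0|⁻¹ * |u 1|⁻¹`; a power of order less than `1` of the latter is integrable. -/
theorem ofReal_one_add_div_sq_le (hd : 2 ≤ d) {C : ℝ} (hC : 0 ≤ C) (u : EuclideanSpace ℝ (Fin d)) :
    ENNReal.ofReal (1 + C / ‖u‖ ^ 2) ≤ ENNReal.ofReal (1 + C) * ∏ c, singularFactor c (u c) := by
  let c0 : Fin d := ⟨0, by omega⟩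
  let c1 : Fin d := ⟨1, by omega⟩
  have h01 : c0 ≠ c1 := by simp [c0, c1]
  have hprod : ∏ c, singularFactor c (u c) = (1 + ‖u c0‖ₑ⁻¹) * (1 + ‖u c1‖ₑ⁻¹) := by
    have : ∏ c ∈ ({c0, c1} : Finset (Fin d)), singularFactor c (u c)
        = ∏ c, singularFactor c (u c) := by
      refine Finset.prod_subset (Finset.subset_univ _) fun c _ hc => ?_
      have : ¬ (c : ℕ) < 2 := by
        intro h
        apply hc
        simp only [Finset.mem_insert, Finset.mem_singleton, c0, c1, Fin.ext_iff]
        omega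
      simp [singularFactor, this]
    rw [← this, Finset.prod_pair h01]
    simp [singularFactor, c0, c1]
  rw [hprod]
  have hpos : ENNReal.ofReal (1 + C) ≠ 0 := by
    simpa using by linarith
  rcases eq_or_ne (u c0) 0 with h0 | h0
  · simp [h0, ENNReal.mul_top, hpos]
  rcases eq_or_ne (u c1) 0 with h1 | h1
  · simp [h1, ENNReal.mul_top, hpos]
  have e : ∀ s : ℝ, s ≠ 0 → (1 : ENNReal) + ‖s‖ₑ⁻¹ = ENNReal.ofReal (1 + |s|⁻¹) := by
    intro s hs
    rw [ENNReal.ofReal_add zero_le_one (by positivity), ENNReal.ofReal_inv_of_pos (abs_pos.2 hs),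
      ENNReal.ofReal_one, Real.enorm_eq_ofReal_abs]
  rw [e _ h0, e _ h1, ← ENNReal.ofReal_mul (by positivity), ← ENNReal.ofReal_mul (by positivity)]
  apply ENNReal.ofReal_le_ofReal
  have hnorm : |u c0| * |u c1| ≤ ‖u‖ ^ 2 := by
    rw [sq]
    exact mul_le_mul (PiLp.norm_apply_le u c0) (PiLp.norm_apply_le u c1) (abs_nonneg _)
      (norm_nonneg _)
  have hp0 := abs_pos.2 h0
  have hp1 := abs_pos.2 h1
  have h2 : C / ‖u‖ ^ 2 ≤ C * (|u c0|⁻¹ * |u c1|⁻¹) := by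
    rw [← mul_inv, ← div_eq_mul_inv]
    exact div_le_div_of_nonneg_left hC (by positivity) hnorm
  have h3 : 0 < |u c0|⁻¹ := by positivity
  have h4 : 0 < |u c1|⁻¹ := by positivity
  nlinarith [mul_pos h3 h4, mul_nonneg hC h3.le, mul_nonneg hC h4.le]

/-- The `j`-th column of the weights is controlled by the differences `x l - x j` only: this star
shape, rather than a product over all pairs of points, is what makes it integrable. The exponent
`3 / 2` is more than `1`, so that moments control the tails, and less than `2`, so that the exponent
`3 / 4` of the singular factors is less than `1`. -/
theorem enorm_fdColumn_rpow_le (hd : 2 ≤ d) {δ : ℝ} (hδ : 0 < δ) (j : Fin n) :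
    ∃ K : ENNReal, K ≠ ⊤ ∧ ∀ x : Fin n → EuclideanSpace ℝ (Fin d),
      ‖fdColumn δ x j‖ₑ ^ (3 / 2 : ℝ) ≤
        K * ∏ p : Fin d × {l : Fin n // l ≠ j},
          singularFactor p.1 (x p.2 p.1 - x j p.1) ^ (3 / 4 : ℝ) := by
  set C : ℝ := n / (2 * δ ^ 2) with hC
  have hC0 : 0 ≤ C := by positivity
  refine ⟨(ENNReal.ofReal (d * (2 * δ ^ 2)) *
    ENNReal.ofReal (1 + C) ^ (Finset.univ.erase j).card) ^ (3 / 4 : ℝ),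
    ENNReal.rpow_ne_top_of_nonneg (by norm_num)
      (ENNReal.mul_ne_top ENNReal.ofReal_ne_top (ENNReal.pow_ne_top ENNReal.ofReal_ne_top)),
    fun x => ?_⟩
  by_cases hΦ : IsUnit (rbfMatrix δ x).det
  swap
  · have : fdColumn δ x j = 0 := by
      ext a
      simp [fdColumn, fdWeights, rbfMatrix_transpose, nonsing_inv_apply_not_isUnit _ hΦ]
    rw [this]
    simp
  have hx : ∀ l, l ≠ j → x l ≠ x j := by
    intro l hl h
    apply hΦ.ne_zero
    exact det_zero_of_row_eq hl (by ext i; simp [rbfMatrix, h])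
  have h1 : ‖fdColumn δ x j‖ ^ 2 ≤
      d * (2 * δ ^ 2) * ∏ l ∈ Finset.univ.erase j, (1 + C / ‖x l - x j‖ ^ 2) := by
    rw [EuclideanSpace.real_norm_sq_eq]
    calc ∑ a, fdColumn δ x j a ^ 2 ≤ ∑ _a : Fin d, 2 * δ ^ 2 *
          ∏ l ∈ Finset.univ.erase j, (1 + C / ‖x l - x j‖ ^ 2) :=
          Finset.sum_le_sum fun a _ => sq_fdWeights_le hδ x hΦ a j hx
      _ = _ := by simp; ring
  have h2 : ‖fdColumn δ x j‖ₑ ^ (2 : ℝ) ≤ ENNReal.ofReal (d * (2 * δ ^ 2)) *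
      ENNReal.ofReal (1 + C) ^ (Finset.univ.erase j).card *
      ∏ p : Fin d × {l : Fin n // l ≠ j}, singularFactor p.1 (x p.2 p.1 - x j p.1) := by
    rw [← ofReal_norm, ENNReal.ofReal_rpow_of_nonneg (norm_nonneg _) (by norm_num),
      Real.rpow_two]
    refine (ENNReal.ofReal_le_ofReal h1).trans ?_
    rw [ENNReal.ofReal_mul (by positivity), mul_assoc]
    refine mul_le_mul_right ?_ _
    rw [ENNReal.ofReal_prod_of_nonneg fun l _ => by positivity]
    rw [Fintype.prod_prod_type_right]
    rw [Finset.prod_subtype (Finset.univ.erase j) (p := fun l => l ≠ j) (by simp),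
      ← Finset.prod_const,
      Finset.prod_subtype (Finset.univ.erase j) (p := fun l => l ≠ j) (by simp),
      ← Finset.prod_mul_distrib]
    exact Finset.prod_le_prod' fun l _ => ofReal_one_add_div_sq_le hd hC0 (x l - x j)
  calc ‖fdColumn δ x j‖ₑ ^ (3 / 2 : ℝ) = (‖fdColumn δ x j‖ₑ ^ (2 : ℝ)) ^ (3 / 4 : ℝ) := by
        rw [← ENNReal.rpow_mul]; norm_num
    _ ≤ _ := ENNReal.rpow_le_rpow h2 (by norm_num)
    _ = _ := by
        rw [ENNReal.mul_rpow_of_nonneg _ _ (by norm_num),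
          ENNReal.prod_rpow_of_nonneg (by norm_num)]

theorem fdColumn_eq_det_inv_smul (δ : ℝ) (x : Fin n → EuclideanSpace ℝ (Fin d)) (j : Fin n) :
    fdColumn δ x j = (rbfMatrix δ x).det⁻¹ •
      WithLp.toLp 2 (fun a => ((rbfRhs δ x).transpose * (rbfMatrix δ x).adjugate) a j) := by
  ext a
  simp [fdColumn, fdWeights, rbfMatrix_transpose, inv_def]

theorem continuous_rbfMatrix (δ : ℝ) :
    Continuous fun x : Fin n → EuclideanSpace ℝ (Fin d) => rbfMatrix δ x := by
  refine continuous_matrix fun i j => ?_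
  simp only [rbfMatrix, of_apply]
  fun_prop

theorem continuous_rbfRhs (δ : ℝ) :
    Continuous fun x : Fin n → EuclideanSpace ℝ (Fin d) => rbfRhs δ x := by
  refine continuous_matrix fun i j => ?_
  simp only [rbfRhs, of_apply, centroid]
  fun_prop

theorem continuous_fdColumn_numerator (δ : ℝ) (j : Fin n) :
    Continuous fun x : Fin n → EuclideanSpace ℝ (Fin d) => (WithLp.toLp 2
      (fun a => ((rbfRhs δ x).transpose * (rbfMatrix δ x).adjugate) a j) :
        EuclideanSpace ℝ (Fin d)) := by
  refine (PiLp.continuous_toLp 2 _).comp (continuous_pi fun a => ?_)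
  exact ((continuous_rbfRhs δ).matrix_transpose.matrix_mul
    (continuous_rbfMatrix δ).matrix_adjugate).matrix_elem a j

theorem measurable_fdColumn (δ : ℝ) (j : Fin n) :
    Measurable fun x : Fin n → EuclideanSpace ℝ (Fin d) => fdColumn δ x j := by
  simp_rw [fdColumn_eq_det_inv_smul]
  exact (continuous_rbfMatrix δ).matrix_det.measurable.inv.smul
    (continuous_fdColumn_numerator δ j).measurable

theorem continuousAt_fdColumn {δ : ℝ} (hδ : 0 < δ) (j : Fin n)
    {x : Fin n → EuclideanSpace ℝ (Fin d)} (hx : Function.Injective x) :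
    ContinuousAt (fun x : Fin n → EuclideanSpace ℝ (Fin d) => fdColumn δ x j) x := by
  simp_rw [fdColumn_eq_det_inv_smul]
  exact ((continuous_rbfMatrix δ).matrix_det.continuousAt.inv₀
    (isUnit_det_rbfMatrix hδ hx).ne_zero).smul
    (continuous_fdColumn_numerator δ j).continuousAt

end Weights

/-! ### Expectations under Gaussian measures -/

theorem gaussianPDF_le (m : ℝ) (v : NNReal) (x : ℝ) :
    gaussianPDF m v x ≤ ENNReal.ofReal (Real.sqrt v)⁻¹ := by
  refine ENNReal.ofReal_le_ofReal ?_
  have h1 : (Real.sqrt (2 * Real.pi * v))⁻¹ ≤ (Real.sqrt v)⁻¹ := by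
    rcases eq_or_ne v 0 with rfl | hv
    · simp
    have hv' : (0 : ℝ) < v := by positivity
    refine inv_anti₀ (Real.sqrt_pos.2 hv') (Real.sqrt_le_sqrt ?_)
    have := Real.pi_gt_three
    nlinarith
  have h2 : Real.exp (-(x - m) ^ 2 / (2 * v)) ≤ 1 := by
    rw [Real.exp_le_one_iff]
    exact div_nonpos_of_nonpos_of_nonneg (by nlinarith [sq_nonneg (x - m)]) (by positivity)
  rw [gaussianPDFReal]
  calc _ ≤ (Real.sqrt (2 * Real.pi * v))⁻¹ * 1 := mul_le_mul_of_nonneg_left h2 (by positivity)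
    _ ≤ _ := by simpa using h1

theorem lintegral_enorm_inv_rpow_ne_top :
    ∫⁻ s in Set.Icc (-1 : ℝ) 1, (‖s‖ₑ⁻¹) ^ (3 / 4 : ℝ) ≠ ⊤ := by
  have hpos : ∫⁻ s in Set.Icc (0 : ℝ) 1, (‖s‖ₑ⁻¹) ^ (3 / 4 : ℝ) ≠ ⊤ := by
    have h := (intervalIntegral.integrableOn_Ioo_rpow_iff (s := -(3 / 4)) (t := 1)
      one_pos).2 (by norm_num)
    have h' : ∫⁻ s in Set.Ioo (0 : ℝ) 1, ‖s ^ (-(3 / 4) : ℝ)‖ₑ ≠ ⊤ := h.2.ne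
    rw [← setLIntegral_congr Ioo_ae_eq_Icc]
    convert h' using 1
    refine setLIntegral_congr_fun measurableSet_Ioo fun s hs => ?_
    have hs0 := hs.1
    change (‖s‖ₑ⁻¹) ^ (3 / 4 : ℝ) = ‖s ^ (-(3 / 4) : ℝ)‖ₑ
    rw [Real.enorm_eq_ofReal hs0.le, Real.enorm_eq_ofReal (Real.rpow_nonneg hs0.le _),
      ← ENNReal.ofReal_inv_of_pos hs0, ENNReal.ofReal_rpow_of_pos (inv_pos.2 hs0),
      Real.inv_rpow hs0.le, Real.rpow_neg hs0.le]
  have hneg : ∫⁻ s in Set.Icc (-1 : ℝ) 0, (‖s‖ₑ⁻¹) ^ (3 / 4 : ℝ) ≠ ⊤ := by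
    have h := (Measure.measurePreserving_neg (volume : Measure ℝ)).setLIntegral_comp_preimage
      (measurableSet_Icc (a := (0 : ℝ)) (b := 1))
      (f := fun s => (‖s‖ₑ⁻¹) ^ (3 / 4 : ℝ)) (by fun_prop)
    rw [← h] at hpos
    simpa using hpos
  rw [← Set.Icc_union_Icc_eq_Icc (b := (0 : ℝ)) (by norm_num) (by norm_num)]
  exact ne_top_of_le_ne_top (ENNReal.add_ne_top.2 ⟨hneg, hpos⟩) (lintegral_union_le _ _ _)

/-- Negative moments of order `3 / 4` of a Gaussian variable, uniformly in its mean. -/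
theorem exists_lintegral_gaussianReal_le :
    ∃ C : ENNReal, C ≠ ⊤ ∧ ∀ (v : NNReal) (_ : v ≠ 0) (y : ℝ),
      ∫⁻ z, (1 + ‖y + z‖ₑ⁻¹) ^ (3 / 4 : ℝ) ∂(gaussianReal 0 v) ≤
        C * (1 + ENNReal.ofReal (Real.sqrt v)⁻¹) := by
  set I := ∫⁻ s in Set.Icc (-1 : ℝ) 1, (‖s‖ₑ⁻¹) ^ (3 / 4 : ℝ) with hI
  refine ⟨2 + I, by simp [hI, lintegral_enorm_inv_rpow_ne_top], fun v hv y => ?_⟩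
  have hmeas : Measurable fun s : ℝ => (‖s‖ₑ⁻¹) ^ (3 / 4 : ℝ) := by fun_prop
  have hpt : ∀ s : ℝ, (1 + ‖s‖ₑ⁻¹) ^ (3 / 4 : ℝ) ≤
      2 + (Set.Icc (-1 : ℝ) 1).indicator (fun s => (‖s‖ₑ⁻¹) ^ (3 / 4 : ℝ)) s := by
    intro s
    have h0 := ENNReal.rpow_add_le_add_rpow 1 (‖s‖ₑ⁻¹) (p := 3 / 4) (by norm_num) (by norm_num)
    rw [ENNReal.one_rpow] at h0
    refine h0.trans ?_
    by_cases hs : s ∈ Set.Icc (-1 : ℝ) 1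
    · rw [Set.indicator_of_mem hs]
      gcongr
      norm_num
    · rw [Set.indicator_of_notMem hs, add_zero]
      refine (add_le_add (le_refl (1 : ENNReal)) ?_).trans_eq one_add_one_eq_two
      refine ENNReal.rpow_le_one ?_ (by norm_num)
      rw [ENNReal.inv_le_one, Real.enorm_eq_ofReal_abs]
      rw [Set.mem_Icc, ← abs_le, not_le] at hs
      simpa using hs.le
  have h2 : ∫⁻ z, (Set.Icc (-1 : ℝ) 1).indicator (fun s => (‖s‖ₑ⁻¹) ^ (3 / 4 : ℝ)) (y + z)
      ∂(gaussianReal 0 v) ≤ ENNReal.ofReal (Real.sqrt v)⁻¹ * I := by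
    have hm' : Measurable ((Set.Icc (-1 : ℝ) 1).indicator (fun s => (‖s‖ₑ⁻¹) ^ (3 / 4 : ℝ))) :=
      hmeas.indicator measurableSet_Icc
    rw [gaussianReal_of_var_ne_zero _ hv,
      lintegral_withDensity_eq_lintegral_mul (g := fun z => (Set.Icc (-1 : ℝ) 1).indicator
        (fun s => (‖s‖ₑ⁻¹) ^ (3 / 4 : ℝ)) (y + z)) _ (measurable_gaussianPDF 0 v)
        (hm'.comp (measurable_const_add y))]
    calc _ ≤ ∫⁻ z, ENNReal.ofReal (Real.sqrt v)⁻¹ *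
          (Set.Icc (-1 : ℝ) 1).indicator (fun s => (‖s‖ₑ⁻¹) ^ (3 / 4 : ℝ)) (y + z) :=
          lintegral_mono fun z => mul_le_mul_left (gaussianPDF_le 0 v z) _
      _ = _ := by
        rw [lintegral_const_mul (f := fun z => (Set.Icc (-1 : ℝ) 1).indicator
            (fun s => (‖s‖ₑ⁻¹) ^ (3 / 4 : ℝ)) (y + z)) _ (hm'.comp (measurable_const_add y)),
          lintegral_add_left_eq_self (μ := volume)
            ((Set.Icc (-1 : ℝ) 1).indicator (fun s => (‖s‖ₑ⁻¹) ^ (3 / 4 : ℝ))) y,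
          lintegral_indicator measurableSet_Icc]
  calc _ ≤ ∫⁻ z, (2 + (Set.Icc (-1 : ℝ) 1).indicator (fun s => (‖s‖ₑ⁻¹) ^ (3 / 4 : ℝ)) (y + z))
        ∂(gaussianReal 0 v) := lintegral_mono fun z => hpt (y + z)
    _ ≤ 2 + ENNReal.ofReal (Real.sqrt v)⁻¹ * I := by
        rw [lintegral_add_left measurable_const]
        gcongr
        simp
    _ ≤ _ := by
        rw [mul_add, mul_one, add_mul, mul_comm I]
        refine add_le_add le_self_add le_add_self

section Multivariate

variable {ι : Type*} [Fintype ι] [DecidableEq ι]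

theorem multivariateGaussian_zero_smul_one (v : NNReal) :
    multivariateGaussian (0 : EuclideanSpace ℝ ι) ((v : ℝ) • (1 : Matrix ι ι ℝ)) =
      (Measure.pi fun _ : ι => gaussianReal 0 v).map (WithLp.toLp 2) := by
  apply Measure.ext_of_charFun
  ext t
  rw [charFun_multivariateGaussian (PosSemidef.one.smul v.coe_nonneg), charFun_pi]
  simp_rw [charFun_gaussianReal, ← Complex.exp_sum]
  congr 1
  simp only [dotProduct, smul_mulVec, one_mulVec, inner_zero_right]
  simp only [Pi.smul_apply, smul_eq_mul, Complex.ofReal_zero, zero_mul, zero_sub, mul_zero,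
    Complex.ofReal_sum, Complex.ofReal_mul, neg_inj, Finset.sum_div,
    Finset.sum_neg_distrib]
  exact Finset.sum_congr rfl fun i _ => by ring

/-- A Gaussian measure splits off each Gaussian measure of smaller covariance. -/
theorem multivariateGaussian_eq_conv (m : EuclideanSpace ℝ ι) {S T : Matrix ι ι ℝ}
    (hT : T.PosSemidef) (hST : (S - T).PosSemidef) :
    multivariateGaussian m S = multivariateGaussian m (S - T) ∗ multivariateGaussian 0 T := by
  have hS : S.PosSemidef := by simpa using hST.add hT
  apply Measure.ext_of_charFun
  ext t
  rw [charFun_conv, charFun_multivariateGaussian hS, charFun_multivariateGaussian hT,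
    charFun_multivariateGaussian hST, ← Complex.exp_add]
  congr 1
  simp only [sub_mulVec, dotProduct_sub, inner_zero_right]
  push_cast
  ring

/-- A nondegenerate Gaussian measure integrates a product of functions of the coordinates at most as
well as a centered isotropic one does, in the worst case over translations. -/
theorem lintegral_prod_multivariateGaussian_le (m : EuclideanSpace ℝ ι) {S : Matrix ι ι ℝ}
    (v : NNReal) (hS : (S - (v : ℝ) • (1 : Matrix ι ι ℝ)).PosSemidef)
    (g : ι → ℝ → ENNReal) (hg : ∀ p, Measurable (g p)) (B : ENNReal)
    (hB : ∀ p y, ∫⁻ z, g p (y + z) ∂(gaussianReal 0 v) ≤ B) :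
    ∫⁻ u, ∏ p, g p (u p) ∂(multivariateGaussian m S) ≤ B ^ Fintype.card ι := by
  have hmeas : Measurable fun u : EuclideanSpace ℝ ι => ∏ p, g p (u p) :=
    Finset.measurable_prod _ fun p _ => (hg p).comp (by fun_prop)
  rw [multivariateGaussian_eq_conv m (PosSemidef.one.smul v.coe_nonneg) hS,
    Measure.lintegral_conv hmeas]
  calc _ ≤ ∫⁻ _, B ^ Fintype.card ι ∂(multivariateGaussian m (S - (v : ℝ) • 1)) := by
        refine lintegral_mono fun y => ?_
        rw [multivariateGaussian_zero_smul_one, lintegral_map (by fun_prop) (by fun_prop)]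
        have := lintegral_prod_eq_prod_lintegral_of_indepFun
          (μ := Measure.pi fun _ : ι => gaussianReal 0 v) Finset.univ
          (fun p z => g p (y p + z p))
          (iIndepFun_pi (X := fun p z => g p (y p + z))
            fun p => ((hg p).comp (measurable_const_add _)).aemeasurable)
          (fun p => (hg p).comp (by fun_prop))
        simp only [PiLp.add_apply]
        rw [this, ← Finset.card_univ]
        refine Finset.prod_le_pow_card _ _ _ fun p _ => ?_
        refine le_of_eq_of_le ?_ (hB p (y p))
        exact (measurePreserving_eval (fun _ : ι => gaussianReal 0 v) p).lintegral_comp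
          (f := fun z => g p (y p + z)) ((hg p).comp (measurable_const_add _))
    _ = _ := by simp

/-- Chernoff bound, with its parameter `t` left free. -/
theorem measure_abs_sub_ge_gaussianReal_le (m : ℝ) (v : NNReal) {t : ℝ} (ht : 0 ≤ t) (s : ℝ) :
    gaussianReal m v {x | s ≤ |x - m|} ≤ ENNReal.ofReal (2 * Real.exp (v * t ^ 2 / 2 - t * s)) := by
  have hint : ∀ m' t', Integrable (fun x => Real.exp (t' * x)) (gaussianReal m' v) :=
    fun m' t' => integrable_exp_mul_gaussianReal t'
  have hup : ∀ m', (gaussianReal m' v).real {x | s + m' ≤ x} ≤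
      Real.exp (v * t ^ 2 / 2 - t * s) := by
    intro m'
    refine (measure_ge_le_exp_mul_mgf (X := id) (s + m') ht (hint m' t)).trans_eq ?_
    rw [mgf_gaussianReal (by rw [Measure.map_id]), ← Real.exp_add]
    congr 1
    ring
  have h1 : (gaussianReal m v).real {x | s ≤ |x - m|} ≤ 2 * Real.exp (v * t ^ 2 / 2 - t * s) := by
    have hsub : {x | s ≤ |x - m|} ⊆ {x | s + m ≤ x} ∪ {x | s + -m ≤ -x} := by
      intro x hx
      rcases le_abs.1 (show s ≤ |x - m| from hx) with h | h
      · left; change s + m ≤ x; linarith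
      · right; change s + -m ≤ -x; linarith
    refine (measureReal_mono hsub).trans ((measureReal_union_le _ _).trans ?_)
    have h2 : (gaussianReal m v).real {x | s + -m ≤ -x} = (gaussianReal (-m) v).real
        {x | s + -m ≤ x} := by
      rw [← gaussianReal_map_neg]
      exact (map_measureReal_apply measurable_neg measurableSet_Ici).symm
    rw [h2, two_mul]
    exact add_le_add (hup m) (hup (-m))
  rw [← ENNReal.ofReal_toReal (measure_ne_top (gaussianReal m v) {x | s ≤ |x - m|})]
  exact ENNReal.ofReal_le_ofReal h1

end Multivariate

/-- Young inequality with a weight, which holds also for weights and arguments equal to `0` or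
`∞`. -/
theorem le_mul_rpow_add (a η : ENNReal) :
    a ≤ η * a ^ (3 / 2 : ℝ) + η⁻¹ ^ 2 := by
  rcases le_total 1 (η * a ^ (1 / 2 : ℝ)) with h | h
  · calc a = 1 * a := (one_mul a).symm
      _ ≤ η * a ^ (1 / 2 : ℝ) * a := mul_le_mul_left h a
      _ = η * a ^ (3 / 2 : ℝ) := by
        rw [mul_assoc]
        congr 1
        nth_rewrite 2 [← ENNReal.rpow_one a]
        rw [← ENNReal.rpow_add_of_nonneg _ _ (by norm_num) (by norm_num)]
        norm_num
      _ ≤ _ := le_self_add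
  · have h1 : a ^ (1 / 2 : ℝ) ≤ η⁻¹ := by
      rwa [ENNReal.le_inv_iff_mul_le, mul_comm]
    calc a = (a ^ (1 / 2 : ℝ)) ^ 2 := by
          rw [← ENNReal.rpow_two, ← ENNReal.rpow_mul]; norm_num
      _ ≤ η⁻¹ ^ 2 := by gcongr
      _ ≤ _ := le_add_self

theorem integrable_of_enorm_rpow_le {E F : Type*} [MeasurableSpace E] [NormedAddCommGroup F]
    {μ : Measure E} [IsFiniteMeasure μ] {f : E → F} (hf : AEStronglyMeasurable f μ)
    {g : E → ENNReal} (hfg : ∀ x, ‖f x‖ₑ ^ (3 / 2 : ℝ) ≤ g x) (hg : ∫⁻ x, g x ∂μ ≠ ⊤) :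
    Integrable f μ := by
  refine ⟨hf, ?_⟩
  calc ∫⁻ x, ‖f x‖ₑ ∂μ ≤ ∫⁻ x, (g x + 1) ∂μ := by
        refine lintegral_mono fun x => (le_mul_rpow_add _ 1).trans ?_
        simpa using hfg x
    _ < ⊤ := by
        rw [lintegral_add_right _ measurable_const]
        simpa [lt_top_iff_ne_top] using hg

/-- Convergence of the expectation of an unbounded function under concentrating Gaussian measures:
the mass outside a neighborhood of the limit decays faster than any polynomial, which beats a
polynomially growing moment of order `3 / 2`. -/
theorem tendsto_integral_multivariateGaussian {ι F : Type*} [Fintype ι] [DecidableEq ι]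
    [NormedAddCommGroup F] [NormedSpace ℝ F] [CompleteSpace F]
    {f : EuclideanSpace ℝ ι → F} (hf : StronglyMeasurable f)
    {g : EuclideanSpace ℝ ι → ENNReal}
    (hfg : ∀ x, ‖f x‖ₑ ^ (3 / 2 : ℝ) ≤ g x)
    {θ : EuclideanSpace ℝ ι} (hcont : ContinuousAt f θ)
    {m : ℕ → EuclideanSpace ℝ ι} (hm : Tendsto m atTop (𝓝 θ))
    {S : ℕ → Matrix ι ι ℝ} (hS : ∀ k, (S k).PosSemidef)
    {C : ℝ} (hSC : ∀ᶠ k in atTop, ∀ c, S k c c * (k + 1) ≤ C)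
    {K : ENNReal} (hK : K ≠ ⊤) (M : ℕ)
    (hg : ∀ᶠ k in atTop, ∫⁻ x, g x ∂(multivariateGaussian (m k) (S k)) ≤ K * (k + 1) ^ M) :
    Tendsto (fun k => ∫ x, f x ∂(multivariateGaussian (m k) (S k))) atTop (𝓝 (f θ)) := by
  set γ : ℕ → Measure (EuclideanSpace ℝ ι) := fun k => multivariateGaussian (m k) (S k) with hγ
  rw [tendsto_iff_edist_tendsto_0, ENNReal.tendsto_nhds_zero]
  intro ε hε
  -- a box around `θ` on which `f` is close to `f θ`
  obtain ⟨r, hr, hbox⟩ : ∃ r > 0, ∀ x : EuclideanSpace ℝ ι, (∀ c, |x c - θ c| < r) →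
      ‖f x - f θ‖ₑ ≤ ε / 2 := by
    have hε2 : 0 < ε / 2 := ENNReal.half_pos hε.ne'
    have h1 : ∀ᶠ x in 𝓝 θ, ‖f x - f θ‖ₑ ≤ ε / 2 := by
      have := (hcont.sub (continuousAt_const (y := f θ))).enorm
      have h2 := this.eventually_lt_const (u := ε / 2) (by simpa using hε2)
      exact h2.mono fun x hx => hx.le
    have h3 : ∀ᶠ x in 𝓝 (WithLp.ofLp θ), ‖f (WithLp.toLp 2 x) - f θ‖ₑ ≤ ε / 2 :=
      (PiLp.continuous_toLp 2 _).continuousAt.eventually (by simpa using h1)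
    obtain ⟨r, hr, h4⟩ := Metric.eventually_nhds_iff.1 h3
    refine ⟨r, hr, fun x hx => ?_⟩
    have := @h4 (WithLp.ofLp x) ((dist_pi_lt_iff hr).2 fun c => by simpa [Real.dist_eq] using hx c)
    simpa using this
  set U : Set (EuclideanSpace ℝ ι) := {x | ∀ c, |x c - θ c| < r} with hU
  have hUm : MeasurableSet U := by
    have : U = ⋂ c, {x | |x c - θ c| < r} := by ext; simp [hU]
    rw [this]
    exact MeasurableSet.iInter fun c => measurableSet_lt (by fun_prop) measurable_const
  -- Chernoff bound with the parameter `√(k + 1)`, for which the variance of order `1 / k`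
  -- contributes a bounded factor
  have htail : ∀ᶠ k : ℕ in atTop, γ k Uᶜ ≤ ENNReal.ofReal
      (Fintype.card ι * (2 * Real.exp (C / 2 - Real.sqrt (k + 1) * (r / 2)))) := by
    have hmc : ∀ᶠ k in atTop, ∀ c, |m k c - θ c| < r / 2 := by
      rw [eventually_all]
      intro c
      have h1 : Tendsto (fun k => |m k c - θ c|) atTop (𝓝 |θ c - θ c|) :=
        ((((EuclideanSpace.proj c : EuclideanSpace ℝ ι →L[ℝ] ℝ).continuous.tendsto θ).comp
          hm).sub_const _).abs
      rw [sub_self, abs_zero] at h1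
      exact h1.eventually_lt_const (by positivity)
    filter_upwards [hmc, hSC] with k hk hSk
    have hsub : Uᶜ ⊆ ⋃ c ∈ (Finset.univ : Finset ι),
        {x : EuclideanSpace ℝ ι | r / 2 ≤ |x c - m k c|} := by
      intro x hx
      simp only [hU, Set.mem_compl_iff, Set.mem_ofPred_eq, not_forall, not_lt] at hx
      obtain ⟨c, hc⟩ := hx
      simp only [Finset.mem_univ, Set.iUnion_true, Set.mem_iUnion, Set.mem_ofPred_eq]
      refine ⟨c, ?_⟩
      have h1 := abs_sub_le (x c) (m k c) (θ c)
      linarith [hk c]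
    refine (measure_mono hsub).trans ((measure_biUnion_finset_le _ _).trans ?_)
    have hb : ∀ c, γ k {x : EuclideanSpace ℝ ι | r / 2 ≤ |x c - m k c|} ≤
        ENNReal.ofReal (2 * Real.exp (C / 2 - Real.sqrt (k + 1) * (r / 2))) := by
      intro c
      have hmp := measurePreserving_eval_multivariateGaussian (μ := m k) (hS k) (i := c)
      have h1 := measure_abs_sub_ge_gaussianReal_le (m k c) (S k c c).toNNReal
        (Real.sqrt_nonneg (k + 1)) (r / 2)
      rw [← hmp.measure_preimage
        (measurableSet_le measurable_const (by fun_prop)).nullMeasurableSet] at h1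
      refine h1.trans (ENNReal.ofReal_le_ofReal ?_)
      have h2 : ((S k c c).toNNReal : ℝ) * Real.sqrt (k + 1) ^ 2 / 2 ≤ C / 2 := by
        rw [Real.coe_toNNReal _ (hS k).diag_nonneg, Real.sq_sqrt (by positivity)]
        linarith [hSk c]
      gcongr
    calc _ ≤ ∑ _c : ι, ENNReal.ofReal (2 * Real.exp (C / 2 - Real.sqrt (k + 1) * (r / 2))) :=
          Finset.sum_le_sum fun c _ => hb c
      _ = _ := by
        rw [Finset.sum_const, ENNReal.ofReal_mul (by positivity)]
        simp
  -- `f` is integrable, and off the box its integral is estimated by weighting the moment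
  have hmain : ∀ᶠ k : ℕ in atTop, edist (∫ x, f x ∂(γ k)) (f θ) ≤ ε / 2 + (K * ((k : ENNReal) + 1)⁻¹
      + ((k + 1) ^ (2 * (M + 1)) + ‖f θ‖ₑ) * γ k Uᶜ) := by
    filter_upwards [hg] with k hk
    have hfin : ∫⁻ x, g x ∂(γ k) ≠ ⊤ := ne_top_of_le_ne_top
      (ENNReal.mul_ne_top hK (by simp)) hk
    have hint : Integrable f (γ k) := integrable_of_enorm_rpow_le hf.aestronglyMeasurable hfg hfin
    have e1 : edist (∫ x, f x ∂(γ k)) (f θ) = ‖∫ x, (f x - f θ) ∂(γ k)‖ₑ := by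
      rw [integral_sub hint (integrable_const _), edist_eq_enorm_sub]
      simp
    rw [e1]
    refine (enorm_integral_le_lintegral_enorm _).trans ?_
    -- this weight makes the moment negligible, and its inverse is still polynomial in `k`
    set η : ENNReal := ((k : ENNReal) + 1)⁻¹ ^ (M + 1) with hη
    have hηt : η ≠ ⊤ := by simp [hη]
    have hpt : ∀ x, ‖f x - f θ‖ₑ ≤ ε / 2 + (η * g x + Uᶜ.indicator
        (fun _ => η⁻¹ ^ 2 + ‖f θ‖ₑ) x) := by
      intro x
      by_cases hx : x ∈ U
      · exact (hbox x hx).trans le_self_add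
      · rw [Set.indicator_of_mem hx]
        calc ‖f x - f θ‖ₑ ≤ ‖f x‖ₑ + ‖f θ‖ₑ := enorm_sub_le
          _ ≤ (η * g x + η⁻¹ ^ 2) + ‖f θ‖ₑ := by
              gcongr
              refine (le_mul_rpow_add _ η).trans ?_
              gcongr
              exact hfg x
          _ ≤ _ := by rw [add_assoc]; exact le_add_self
    refine (lintegral_mono hpt).trans ?_
    rw [lintegral_add_left measurable_const, lintegral_add_right _
      (measurable_const.indicator hUm.compl), lintegral_const_mul' _ _ hηt,
      lintegral_indicator_const hUm.compl]
    have e2 : η⁻¹ ^ 2 = ((k : ENNReal) + 1) ^ (2 * (M + 1)) := by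
      rw [hη, ENNReal.inv_pow, inv_inv, ← pow_mul, mul_comm]
    rw [e2]
    refine add_le_add (by simp) (add_le_add ?_ le_rfl)
    · calc η * ∫⁻ x, g x ∂(γ k) ≤ η * (K * (k + 1) ^ M) := by gcongr
        _ = K * ((k : ENNReal) + 1)⁻¹ * (((k : ENNReal) + 1)⁻¹ ^ M * ((k : ENNReal) + 1) ^ M) := by
            rw [hη, pow_succ]; ring
        _ = _ := by
            rw [← mul_pow, ENNReal.inv_mul_cancel (by simp) (by simp), one_pow, mul_one]
  have hlim1 : Tendsto (fun k : ℕ => K * ((k : ENNReal) + 1)⁻¹) atTop (𝓝 0) := by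
    have : Tendsto (fun k : ℕ => ((k : ENNReal) + 1)⁻¹) atTop (𝓝 0) := by
      have := (tendsto_add_atTop_iff_nat 1).2 ENNReal.tendsto_inv_nat_nhds_zero
      simpa using this
    simpa using ENNReal.Tendsto.const_mul this (Or.inr hK)
  have hlim2 : Tendsto (fun k : ℕ => (((k : ENNReal) + 1) ^ (2 * (M + 1)) + ‖f θ‖ₑ) * γ k Uᶜ) atTop
      (𝓝 0) := by
    have hreal : Tendsto (fun k : ℕ => (((k : ℝ) + 1) ^ (2 * (M + 1)) + ‖f θ‖) *
        (Fintype.card ι * (2 * Real.exp (C / 2 - Real.sqrt (k + 1) * (r / 2))))) atTop (𝓝 0) := by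
      have hs : Tendsto (fun k : ℕ => Real.sqrt ((k : ℝ) + 1)) atTop atTop :=
        Real.tendsto_sqrt_atTop.comp
          (tendsto_atTop_add_const_right _ _ tendsto_natCast_atTop_atTop)
      have hp : ∀ p : ℕ, Tendsto (fun x : ℝ => x ^ p * Real.exp (-(r / 2) * x)) atTop (𝓝 0) := by
        intro p
        have := tendsto_rpow_mul_exp_neg_mul_atTop_nhds_zero (p : ℝ) (r / 2) (by positivity)
        simpa using this
      have h1 := ((hp (2 * (2 * (M + 1)))).add ((hp 0).const_mul ‖f θ‖)).const_mul
        (Fintype.card ι * (2 * Real.exp (C / 2)))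
      simp only [add_zero, mul_zero] at h1
      refine (h1.comp hs).congr fun k => ?_
      simp only [Function.comp]
      rw [pow_mul, Real.sq_sqrt (by positivity), sub_eq_add_neg, Real.exp_add,
        show -(r / 2) * Real.sqrt ((k : ℝ) + 1) = -(Real.sqrt ((k : ℝ) + 1) * (r / 2)) by ring]
      ring
    have h2 := ENNReal.tendsto_ofReal hreal
    rw [ENNReal.ofReal_zero] at h2
    refine tendsto_of_tendsto_of_tendsto_of_le_of_le' tendsto_const_nhds h2
      (Eventually.of_forall fun k => zero_le) ?_
    filter_upwards [htail] with k hk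
    rw [ENNReal.ofReal_mul (by positivity), ENNReal.ofReal_add (by positivity) (norm_nonneg _),
      ENNReal.ofReal_pow (by positivity), ENNReal.ofReal_add (by positivity) zero_le_one,
      ofReal_norm, ENNReal.ofReal_natCast, ENNReal.ofReal_one]
    gcongr
  have hlim := hlim1.add hlim2
  rw [add_zero] at hlim
  have hε2 : 0 < ε / 2 := ENNReal.half_pos hε.ne'
  filter_upwards [hmain, hlim.eventually_lt_const hε2] with k h1 h2
  calc _ ≤ _ := h1
    _ ≤ ε / 2 + ε / 2 := by gcongr
    _ = ε := ENNReal.add_halves ε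

/-! ### Averaging and observability -/

section QuadraticForms

variable {ι κ : Type*} [Fintype ι] [Fintype κ]

open scoped MatrixOrder Matrix.Norms.L2Operator in
theorem exists_pos_mul_dotProduct_le [DecidableEq ι] {M : Matrix ι ι ℝ} (hM : M.PosDef) :
    ∃ c > 0, ∀ w : ι → ℝ, c * (w ⬝ᵥ w) ≤ w ⬝ᵥ M *ᵥ w := by
  rcases isEmpty_or_nonempty ι with hι | hι
  · exact ⟨1, one_pos, fun w => by simp [dotProduct]⟩
  obtain ⟨c, hc, h⟩ := (CFC.exists_pos_algebraMap_le_iff hM.isHermitian.isSelfAdjoint).2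
    fun x hx => hM.isStrictlyPositive.spectrum_pos hx
  refine ⟨c, hc, fun w => ?_⟩
  have h1 := (Matrix.le_iff.1 h).dotProduct_mulVec_nonneg w
  rw [Algebra.algebraMap_eq_smul_one, sub_mulVec, smul_mulVec, one_mulVec, dotProduct_sub,
    dotProduct_smul, smul_eq_mul, star_trivial] at h1
  linarith

theorem posSemidef_iff_real {M : Matrix ι ι ℝ} :
    M.PosSemidef ↔ M.transpose = M ∧ ∀ w : ι → ℝ, 0 ≤ w ⬝ᵥ M *ᵥ w := by
  refine ⟨fun h => ⟨?_, fun w => ?_⟩,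
    fun h => PosSemidef.of_dotProduct_mulVec_nonneg ?_ fun w => ?_⟩
  · simpa using h.isHermitian.eq
  · simpa using h.dotProduct_mulVec_nonneg w
  · simpa [IsHermitian] using h.1
  · simpa using h.2 w

theorem dotProduct_self_mulVec_le {M : Matrix κ ι ℝ} {K : ℝ} (hM : ∀ p q, |M p q| ≤ K)
    (w : ι → ℝ) :
    (M *ᵥ w) ⬝ᵥ (M *ᵥ w) ≤ Fintype.card κ * (Fintype.card ι * K ^ 2) * (w ⬝ᵥ w) := by
  have h : ∀ p, (M *ᵥ w) p * (M *ᵥ w) p ≤ Fintype.card ι * K ^ 2 * (w ⬝ᵥ w) := by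
    intro p
    have h1 : (∑ q, M p q * w q) ^ 2 ≤ (∑ q, M p q ^ 2) * ∑ q, w q ^ 2 :=
      Finset.sum_mul_sq_le_sq_mul_sq _ _ _
    have h2 : ∑ q, M p q ^ 2 ≤ Fintype.card ι * K ^ 2 := by
      calc ∑ q, M p q ^ 2 ≤ ∑ _q : ι, K ^ 2 := Finset.sum_le_sum fun q _ => by
            rw [← sq_abs]; exact pow_le_pow_left₀ (abs_nonneg _) (hM p q) 2
        _ = _ := by simp
    have h3 : w ⬝ᵥ w = ∑ q, w q ^ 2 := Finset.sum_congr rfl fun q _ => (sq _).symm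
    rw [← sq, h3]
    exact h1.trans (mul_le_mul_of_nonneg_right h2 (Finset.sum_nonneg fun q _ => sq_nonneg _))
  calc _ ≤ ∑ _p : κ, Fintype.card ι * K ^ 2 * (w ⬝ᵥ w) := Finset.sum_le_sum fun p _ => h p
    _ = _ := by simp; ring

theorem dotProduct_self_nonneg_real (w : ι → ℝ) : 0 ≤ w ⬝ᵥ w :=
  Finset.sum_nonneg fun _ _ => mul_self_nonneg _

/-- The inverse of a matrix whose quadratic form is bounded below by `c` has norm at most `c⁻¹`. -/
theorem sq_mul_dotProduct_self_inv_le [DecidableEq ι] {M : Matrix ι ι ℝ} {c : ℝ} (hc : 0 < c)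
    (hM : ∀ w : ι → ℝ, c * (w ⬝ᵥ w) ≤ w ⬝ᵥ M *ᵥ w) (hu : IsUnit M.det) (w : ι → ℝ) :
    c ^ 2 * ((M⁻¹ *ᵥ w) ⬝ᵥ (M⁻¹ *ᵥ w)) ≤ w ⬝ᵥ w := by
  set z := M⁻¹ *ᵥ w with hz
  have hMz : M *ᵥ z = w := by rw [hz, mulVec_mulVec, mul_nonsing_inv _ hu, one_mulVec]
  have h1 := hM z
  rw [hMz] at h1
  have h2 : 0 ≤ (w - c • z) ⬝ᵥ (w - c • z) := dotProduct_self_nonneg_real _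
  simp only [sub_dotProduct, dotProduct_sub, smul_dotProduct, dotProduct_smul, smul_eq_mul,
    dotProduct_comm w z] at h2 h1
  nlinarith

end QuadraticForms

section Averaging

variable {n : ℕ} (G : SimpleGraph (Fin n)) [DecidableRel G.Adj] (a : Fin n → Fin n → ℝ)

/-- The averaging weights as a matrix, with zeros outside the closed neighborhoods. -/
def avgMatrix : Matrix (Fin n) (Fin n) ℝ :=
  Matrix.of fun i j => if j ∈ insert i (G.neighborFinset i) then a i j else 0

theorem sum_avgMatrix_smul {V : Type*} [AddCommMonoid V] [Module ℝ V] (u : Fin n → V) (i : Fin n) :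
    ∑ j, avgMatrix G a i j • u j = ∑ j ∈ insert i (G.neighborFinset i), a i j • u j := by
  simp only [avgMatrix, of_apply, ite_smul, zero_smul]
  rw [Finset.sum_ite_mem, Finset.univ_inter]

/-- Solution of an averaging recursion with inputs. -/
theorem averaging_recursion {V : Type*} [AddCommGroup V] [Module ℝ V]
    (A : Matrix (Fin n) (Fin n) ℝ) (u w : ℕ → Fin n → V)
    (h : ∀ k i, u (k + 1) i = ∑ j, A i j • u k j + w k i) (k : ℕ) (i : Fin n) :
    u k i = ∑ j, (A ^ k) i j • u 0 j
      + ∑ τ ∈ Finset.range k, ∑ j, (A ^ (k - 1 - τ)) i j • w τ j := by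
  induction k generalizing i with
  | zero => simp [Matrix.one_apply, ite_smul]
  | succ k ih =>
    rw [h]
    have hA : ∀ m (f : Fin n → V), ∑ j, A i j • ∑ l, (A ^ m) j l • f l
        = ∑ l, (A ^ (m + 1)) i l • f l := by
      intro m f
      simp only [pow_succ', Matrix.mul_apply, Finset.sum_smul, Finset.smul_sum, smul_smul]
      rw [Finset.sum_comm]
    rw [Finset.sum_range_succ]
    simp_rw [ih, smul_add, Finset.sum_add_distrib]
    rw [hA k, add_assoc]
    congr 1
    congr 1
    · simp_rw [Finset.smul_sum]
      rw [Finset.sum_comm]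
      refine Finset.sum_congr rfl fun τ hτ => ?_
      simp_rw [← Finset.smul_sum]
      rw [hA]
      have : k - 1 - τ + 1 = k + 1 - 1 - τ := by
        have := Finset.mem_range.1 hτ
        omega
      rw [this]
    · simp [Matrix.one_apply, ite_smul]

variable {G a}

theorem avgMatrix_nonneg (ha_pos : ∀ i j, (j = i ∨ G.Adj i j) → 0 < a i j) (i j : Fin n) :
    0 ≤ avgMatrix G a i j := by
  simp only [avgMatrix, of_apply]
  split_ifs with h
  · exact (ha_pos i j (by simpa using h)).le
  · exact le_rfl

theorem avgMatrix_pos (ha_pos : ∀ i j, (j = i ∨ G.Adj i j) → 0 < a i j) {i j : Fin n}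
    (h : j = i ∨ G.Adj i j) : 0 < avgMatrix G a i j := by
  have : j ∈ insert i (G.neighborFinset i) := by simpa using h
  simp only [avgMatrix, of_apply, if_pos this]
  exact ha_pos i j h

theorem avgMatrix_pow_nonneg (ha_pos : ∀ i j, (j = i ∨ G.Adj i j) → 0 < a i j) (m : ℕ)
    (i j : Fin n) : 0 ≤ (avgMatrix G a ^ m) i j := by
  induction m generalizing i j with
  | zero => simp only [pow_zero, Matrix.one_apply]; split_ifs <;> norm_num
  | succ m ih =>
    rw [pow_succ', Matrix.mul_apply]
    exact Finset.sum_nonneg fun l _ => mul_nonneg (avgMatrix_nonneg ha_pos i l) (ih l j)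

theorem sum_avgMatrix (ha_sum : ∀ i, ∑ j ∈ insert i (G.neighborFinset i), a i j = 1) (i : Fin n) :
    ∑ j, avgMatrix G a i j = 1 := by
  have := sum_avgMatrix_smul G a (fun _ => (1 : ℝ)) i
  simp only [smul_eq_mul, mul_one] at this
  rw [this, ha_sum]

theorem sum_avgMatrix_pow (ha_sum : ∀ i, ∑ j ∈ insert i (G.neighborFinset i), a i j = 1) (m : ℕ)
    (i : Fin n) : ∑ j, (avgMatrix G a ^ m) i j = 1 := by
  induction m generalizing i with
  | zero => simp [Matrix.one_apply]
  | succ m ih =>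
    simp only [pow_succ', Matrix.mul_apply]
    rw [Finset.sum_comm]
    simp_rw [← Finset.mul_sum, ih, mul_one]
    exact sum_avgMatrix ha_sum i

theorem avgMatrix_pow_le_one (ha_pos : ∀ i j, (j = i ∨ G.Adj i j) → 0 < a i j)
    (ha_sum : ∀ i, ∑ j ∈ insert i (G.neighborFinset i), a i j = 1) (m : ℕ)
    (i j : Fin n) : (avgMatrix G a ^ m) i j ≤ 1 := by
  rw [← sum_avgMatrix_pow ha_sum m i]
  exact Finset.single_le_sum (fun l _ => avgMatrix_pow_nonneg ha_pos m i l) (Finset.mem_univ j)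

/-- Since the weights of the sensors themselves are positive, walks may be prolonged by waiting. -/
theorem avgMatrix_pow_pos_of_walk (ha_pos : ∀ i j, (j = i ∨ G.Adj i j) → 0 < a i j) {i j : Fin n}
    (p : G.Walk i j) (m : ℕ) (hm : p.length ≤ m) : 0 < (avgMatrix G a ^ m) i j := by
  have hself : ∀ m i, 0 < (avgMatrix G a ^ m) i i := by
    intro m i
    induction m with
    | zero => simp
    | succ m ih =>
      rw [pow_succ', Matrix.mul_apply]
      exact Finset.sum_pos' (fun l _ => mul_nonneg (avgMatrix_nonneg ha_pos i l)
        (avgMatrix_pow_nonneg ha_pos m l i))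
        ⟨i, Finset.mem_univ i, mul_pos (avgMatrix_pos ha_pos (Or.inl rfl)) ih⟩
  induction p generalizing m with
  | nil => exact hself m _
  | @cons u v w huv p ih =>
    obtain ⟨m, rfl⟩ : ∃ m', m = m' + 1 := ⟨m - 1, by simp at hm; omega⟩
    rw [pow_succ', Matrix.mul_apply]
    exact Finset.sum_pos' (fun l _ => mul_nonneg (avgMatrix_nonneg ha_pos u l)
      (avgMatrix_pow_nonneg ha_pos m l w))
      ⟨v, Finset.mem_univ v, mul_pos (avgMatrix_pos ha_pos (Or.inr huv))
        (ih m (by simpa using hm))⟩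

/-- After `n - 1` steps the weights of all sensors have reached every sensor, and they stay bounded
away from zero because averaging does not decrease the least entry of a column. -/
theorem exists_le_avgMatrix_pow [NeZero n] (hG : G.Connected)
    (ha_pos : ∀ i j, (j = i ∨ G.Adj i j) → 0 < a i j)
    (ha_sum : ∀ i, ∑ j ∈ insert i (G.neighborFinset i), a i j = 1) :
    ∃ c > 0, ∀ m, n ≤ m + 1 → ∀ i j, c ≤ (avgMatrix G a ^ m) i j := by
  have hpos : ∀ p : Fin n × Fin n, 0 < (avgMatrix G a ^ (n - 1)) p.1 p.2 := by
    rintro ⟨i, j⟩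
    obtain ⟨p, hp⟩ := hG.exists_isPath i j
    refine avgMatrix_pow_pos_of_walk ha_pos p _ ?_
    have := hp.length_lt
    simp only [Fintype.card_fin] at this
    omega
  obtain ⟨p, -, hmin⟩ := Finset.exists_min_image Finset.univ
    (fun p : Fin n × Fin n => (avgMatrix G a ^ (n - 1)) p.1 p.2) ⟨(0, 0), Finset.mem_univ _⟩
  refine ⟨_, hpos p, fun m hm => ?_⟩
  obtain ⟨r, rfl⟩ : ∃ r, m = n - 1 + r := ⟨m - (n - 1), by omega⟩
  clear hm
  induction r with
  | zero => exact fun i j => hmin (i, j) (Finset.mem_univ _)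
  | succ r ih =>
    intro i j
    rw [← add_assoc, pow_succ', Matrix.mul_apply]
    calc _ = ∑ l, avgMatrix G a i l * (avgMatrix G a ^ (n - 1)) p.1 p.2 := by
          rw [← Finset.sum_mul, sum_avgMatrix ha_sum, one_mul]
      _ ≤ _ := Finset.sum_le_sum fun l _ =>
          mul_le_mul_of_nonneg_left (ih l j) (avgMatrix_nonneg ha_pos i l)

end Averaging

section Observations

variable {n d : ℕ} (G : SimpleGraph (Fin n))

theorem noiseCov_posDef [DecidableRel G.Adj] {E : Fin n → Fin n → Matrix (Fin d) (Fin d) ℝ}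
    (hE : ∀ i j, G.Adj i j → (E i j).PosDef) (i : Fin n) : (noiseCov G E i).PosDef := by
  have hE' : ∀ l : G.neighborSet i, (E i l).PosDef := fun l => hE i l l.2
  refine PosDef.of_dotProduct_mulVec_pos ?_ fun w hw => ?_
  · rw [IsHermitian, noiseCov, blockDiagonal_conjTranspose]
    congr 1
    funext l
    exact (hE' l).isHermitian
  · have e : star w ⬝ᵥ noiseCov G E i *ᵥ w
        = ∑ l : G.neighborSet i, (fun c => w (c, l)) ⬝ᵥ E i l *ᵥ fun c => w (c, l) := by
      simp only [dotProduct, mulVec, noiseCov, blockDiagonal_apply, Pi.star_apply, star_trivial,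
        Fintype.sum_prod_type_right]
      simp
    rw [e]
    obtain ⟨⟨c, l⟩, hcl⟩ := Function.ne_iff.1 hw
    refine Finset.sum_pos' (fun l _ => ?_) ⟨l, Finset.mem_univ l, ?_⟩
    · simpa using (hE' l).posSemidef.dotProduct_mulVec_nonneg fun c => w (c, l)
    · have : (fun c => w (c, l)) ≠ 0 := Function.ne_iff.2 ⟨c, hcl⟩
      simpa using (hE' l).dotProduct_mulVec_pos this

variable [NeZero n]

/-- The information `Hᵢᵀ Eᵢ⁻¹ Hᵢ` that the measurements of sensor `i` at one time carry. -/
noncomputable def obsInfo [DecidableRel G.Adj] (E : Fin n → Fin n → Matrix (Fin d) (Fin d) ℝ)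
    (i : Fin n) : Matrix (ParamIdx n d) (ParamIdx n d) ℝ :=
  (obsMatrix G d i).transpose * (noiseCov G E i)⁻¹ * obsMatrix G d i

theorem obsMatrix_mulVec [DecidableRel G.Adj] (i : Fin n) (θ : ParamIdx n d → ℝ)
    (p : MeasIdx G d i) :
    (obsMatrix G d i *ᵥ θ) p = formation θ p.2 p.1 - formation θ i p.1 := by
  have key : ∀ j : Fin n, formation θ j p.1 = ∑ l : {l : Fin n // l ≠ 0},
      (if j = (l : Fin n) then 1 else 0) * θ (p.1, l) := by
    intro j
    by_cases hj : j = 0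
    · rw [Finset.sum_eq_zero]
      · simp [formation, hj]
      · intro l _
        rw [if_neg (by rw [hj]; exact l.2.symm), zero_mul]
    · rw [Finset.sum_eq_single ⟨j, hj⟩]
      · simp [formation, hj]
      · intro l _ hl
        rw [if_neg (fun h => hl (Subtype.ext h.symm)), zero_mul]
      · simp
  rw [key, key, ← Finset.sum_sub_distrib]
  simp only [mulVec, dotProduct, obsMatrix, of_apply, Fintype.sum_prod_type_right]
  refine Finset.sum_congr rfl fun l _ => ?_
  simp [sub_mul]

theorem obsInfo_posSemidef [DecidableRel G.Adj] {E : Fin n → Fin n → Matrix (Fin d) (Fin d) ℝ}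
    (hE : ∀ i j, G.Adj i j → (E i j).PosDef) (i : Fin n) : (obsInfo G E i).PosSemidef := by
  have := (noiseCov_posDef G hE i).inv.posSemidef.conjTranspose_mul_mul_same (obsMatrix G d i)
  simpa [obsInfo] using this

/-- The formation is observable from the relative measurements of all sensors, because the graph is
connected and sensor `0` is the origin. -/
theorem sum_obsInfo_posDef [DecidableRel G.Adj] (hG : G.Connected)
    {E : Fin n → Fin n → Matrix (Fin d) (Fin d) ℝ}
    (hE : ∀ i j, G.Adj i j → (E i j).PosDef) : (∑ i, obsInfo G E i).PosDef := by
  have hS : (∑ i, obsInfo G E i).PosSemidef :=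
    posSemidef_sum _ fun i _ => obsInfo_posSemidef G hE i
  refine PosDef.of_dotProduct_mulVec_pos hS.isHermitian fun w hw => ?_
  have hq : ∀ i, w ⬝ᵥ obsInfo G E i *ᵥ w
      = (obsMatrix G d i *ᵥ w) ⬝ᵥ (noiseCov G E i)⁻¹ *ᵥ (obsMatrix G d i *ᵥ w) := by
    intro i
    rw [obsInfo, Matrix.mul_assoc, ← mulVec_mulVec, ← mulVec_mulVec, dotProduct_mulVec,
      vecMul_transpose]
  rw [star_trivial, sum_mulVec, dotProduct_sum]
  have hnn : ∀ i ∈ Finset.univ, 0 ≤ w ⬝ᵥ obsInfo G E i *ᵥ w := fun i _ => by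
    simpa using (obsInfo_posSemidef G hE i).dotProduct_mulVec_nonneg w
  refine lt_of_le_of_ne (Finset.sum_nonneg hnn) fun h0 => hw ?_
  have hz := (Finset.sum_eq_zero_iff_of_nonneg hnn).1 h0.symm
  have hH : ∀ i, obsMatrix G d i *ᵥ w = 0 := by
    intro i
    by_contra hne
    have := (noiseCov_posDef G hE i).inv.dotProduct_mulVec_pos hne
    rw [star_trivial, ← hq i, hz i (Finset.mem_univ i)] at this
    exact lt_irrefl _ this
  have hadj : ∀ i j, G.Adj i j → formation w i = formation w j := by
    intro i j hij
    ext c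
    have := congrFun (hH i) (c, ⟨j, hij⟩)
    rw [obsMatrix_mulVec] at this
    simp only [Pi.zero_apply] at this
    linarith
  have hall : ∀ j, formation w j = 0 := by
    intro j
    obtain ⟨p⟩ := hG.preconnected j 0
    have : ∀ u v, G.Walk u v → formation w u = formation w v := by
      intro u v p
      induction p with
      | nil => rfl
      | cons h _ ih => exact (hadj _ _ h).trans ih
    rw [this _ _ p]
    simp [formation]
  funext ⟨c, j, hj⟩
  have := congrArg (fun u : EuclideanSpace ℝ (Fin d) => u c) (hall j)
  simpa [formation, hj] using this

end Observations

/-! ### Law of the estimation error -/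

section GaussianLaws

variable {ι κ : Type*} [Fintype ι] [DecidableEq ι] [Fintype κ] [DecidableEq κ]

theorem map_affine_multivariateGaussian (m : EuclideanSpace ℝ ι) {T : Matrix ι ι ℝ}
    (hT : T.PosSemidef) (B : Matrix κ ι ℝ) (v : EuclideanSpace ℝ κ) :
    (multivariateGaussian m T).map (fun x => v + WithLp.toLp 2 (B *ᵥ x.ofLp)) =
      multivariateGaussian (v + WithLp.toLp 2 (B *ᵥ m.ofLp)) (B * T * B.transpose) := by
  have hmeas : Measurable fun x : EuclideanSpace ℝ ι => v + WithLp.toLp 2 (B *ᵥ x.ofLp) := by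
    refine Continuous.measurable (continuous_const.add ((PiLp.continuous_toLp 2 _).comp ?_))
    exact Continuous.matrix_mulVec continuous_const (PiLp.continuous_ofLp 2 _)
  have hBT : (B * T * B.transpose).PosSemidef := by
    simpa using hT.mul_mul_conjTranspose_same B
  have : IsProbabilityMeasure ((multivariateGaussian m T).map
      (fun x => v + WithLp.toLp 2 (B *ᵥ x.ofLp))) :=
    Measure.isProbabilityMeasure_map hmeas.aemeasurable
  apply Measure.ext_of_charFun
  ext t
  have hinner : ∀ x : EuclideanSpace ℝ ι,
      ⟪(WithLp.toLp 2 (B *ᵥ x.ofLp) : EuclideanSpace ℝ κ), t⟫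
        = ⟪x, (WithLp.toLp 2 (B.transpose *ᵥ t.ofLp) : EuclideanSpace ℝ ι)⟫ := by
    intro x
    simp only [EuclideanSpace.inner_eq_star_dotProduct, star_trivial]
    rw [dotProduct_mulVec, mulVec_transpose]
  rw [charFun_apply, integral_map hmeas.aemeasurable (by fun_prop)]
  have e : ∀ x : EuclideanSpace ℝ ι,
      Complex.exp (⟪v + WithLp.toLp 2 (B *ᵥ x.ofLp), t⟫ * Complex.I) =
      Complex.exp (⟪v, t⟫ * Complex.I) * Complex.exp
        (⟪x, (WithLp.toLp 2 (B.transpose *ᵥ t.ofLp) : EuclideanSpace ℝ ι)⟫ * Complex.I) := by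
    intro x
    rw [inner_add_left, hinner, ← Complex.exp_add]
    push_cast
    congr 1
    ring
  simp_rw [e]
  rw [integral_const_mul, ← charFun_apply, charFun_multivariateGaussian hT,
    charFun_multivariateGaussian hBT, ← Complex.exp_add]
  congr 1
  rw [real_inner_comm m, ← hinner m, inner_add_right, real_inner_comm v t,
    real_inner_comm (WithLp.toLp 2 (B *ᵥ m.ofLp)) t]
  have hq : t.ofLp ⬝ᵥ (B * T * B.transpose) *ᵥ t.ofLp
      = (B.transpose *ᵥ t.ofLp) ⬝ᵥ T *ᵥ (B.transpose *ᵥ t.ofLp) := by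
    rw [Matrix.mul_assoc, ← mulVec_mulVec, ← mulVec_mulVec, dotProduct_mulVec, mulVec_transpose]
  rw [hq]
  push_cast
  ring

theorem map_sum_multivariateGaussian {α S : Type*} [Fintype α] [MeasurableSpace S] {P : Measure S}
    [IsProbabilityMeasure P] {X : α → S → EuclideanSpace ℝ ι} {T : α → Matrix ι ι ℝ}
    (hT : ∀ e, (T e).PosSemidef) (hX : ∀ e, HasLaw (X e) (multivariateGaussian 0 (T e)) P)
    (hind : iIndepFun X P) :
    P.map (fun s => ∑ e, X e s) = multivariateGaussian 0 (∑ e, T e) := by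
  have hm : ∀ e, AEMeasurable (X e) P := fun e => (hX e).aemeasurable
  have hm' : AEMeasurable (fun s => ∑ e, X e s) P := by
    exact Finset.aemeasurable_fun_sum _ fun e _ => hm e
  have : IsProbabilityMeasure (P.map fun s => ∑ e, X e s) := Measure.isProbabilityMeasure_map hm'
  apply Measure.ext_of_charFun
  rw [iIndepFun.charFun_map_fun_sum_eq_prod hm hind]
  ext t
  rw [charFun_multivariateGaussian (posSemidef_sum _ fun e _ => hT e), Finset.prod_apply]
  simp_rw [fun e => (hX e).map_eq, fun e => charFun_multivariateGaussian (μ := 0) (hT e) t]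
  rw [← Complex.exp_sum]
  congr 1
  simp only [inner_zero_right, sum_mulVec, dotProduct_sum]
  push_cast
  simp [Finset.sum_div]

end GaussianLaws

section EstimationError

/-- The estimator is linear in the measurements: its information vector is the information matrix
applied to the true parameter, up to a forgotten initialization and a weighted sum of the noises. -/
theorem infoVector_eq {n : ℕ} (G : SimpleGraph (Fin n)) [DecidableRel G.Adj] (a : Fin n → Fin n → ℝ)
    {ρ : Fin n → Type} [∀ i, Fintype (ρ i)] [∀ i, DecidableEq (ρ i)] {π : Type} [Fintype π]
    (H : ∀ i, Matrix (ρ i) π ℝ) (E : ∀ i, Matrix (ρ i) (ρ i) ℝ) (Ω₀ : Fin n → Matrix π π ℝ)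
    (ω₀ : Fin n → π → ℝ) (s ν : ℕ → ∀ i, ρ i → ℝ) (θ : π → ℝ)
    (hs : ∀ k i, s k i = H i *ᵥ θ + ν k i) (k : ℕ) (i : Fin n) :
    infoVector G a H E s ω₀ k i = infoMatrix G a H E Ω₀ k i *ᵥ θ
      + (∑ j, (avgMatrix G a ^ k) i j • (ω₀ j - Ω₀ j *ᵥ θ)
        + ∑ τ ∈ Finset.range k, ∑ j, (avgMatrix G a ^ (k - 1 - τ)) i j •
          (((H j).transpose * (E j)⁻¹) *ᵥ ν τ j)) := by
  have := averaging_recursion (avgMatrix G a)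
    (fun k i => infoVector G a H E s ω₀ k i - infoMatrix G a H E Ω₀ k i *ᵥ θ)
    (fun k i => ((H i).transpose * (E i)⁻¹) *ᵥ ν k i) (fun k i => by
      rw [sum_avgMatrix_smul]
      simp only [infoVector, infoMatrix, hs, smul_sub, Finset.sum_sub_distrib, add_mulVec,
        sum_mulVec, smul_mulVec, mulVec_add, mulVec_mulVec]
      abel) k i
  simp only [infoVector, infoMatrix] at this
  rw [← this]
  abel

variable {n d : ℕ} [NeZero n] (G : SimpleGraph (Fin n)) [DecidableRel G.Adj]

theorem infoMatrix_eq (a : Fin n → Fin n → ℝ) (E : Fin n → Fin n → Matrix (Fin d) (Fin d) ℝ)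
    (Ω₀ : Fin n → Matrix (ParamIdx n d) (ParamIdx n d) ℝ) (k : ℕ) (i : Fin n) :
    infoMatrix G a (obsMatrix G d) (noiseCov G E) Ω₀ k i =
      ∑ j, (avgMatrix G a ^ k) i j • Ω₀ j
        + ∑ τ ∈ Finset.range k, ∑ j, (avgMatrix G a ^ (k - 1 - τ)) i j • obsInfo G E j :=
  averaging_recursion (avgMatrix G a) (infoMatrix G a (obsMatrix G d) (noiseCov G E) Ω₀)
    (fun _ i => obsInfo G E i) (fun k i => by rw [sum_avgMatrix_smul]; rfl) k i

/-- The true parameter: the states of the other sensors in the frame of sensor `0`. -/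
def trueParam (x : Fin n → EuclideanSpace ℝ (Fin d)) : ParamIdx n d → ℝ :=
  fun p => (x p.2 - x 0) p.1

theorem formation_trueParam (x : Fin n → EuclideanSpace ℝ (Fin d)) :
    formation (trueParam x) = localFrame x := by
  funext j
  by_cases hj : j = 0
  · simp [formation, localFrame, hj]
  · ext c
    simp [formation, localFrame, hj, trueParam]

theorem relMeas_eq (x : Fin n → EuclideanSpace ℝ (Fin d))
    (ε : Fin n → Fin n → ℕ → EuclideanSpace ℝ (Fin d)) (k : ℕ) (i : Fin n) :
    relMeas G x ε k i = obsMatrix G d i *ᵥ trueParam x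
      + fun p : MeasIdx G d i => ε i p.2 k p.1 := by
  funext p
  rw [Pi.add_apply, obsMatrix_mulVec, formation_trueParam]
  simp [relMeas, localFrame]

/-- The gain that the noise of the measurement of sensor `l` by sensor `j` gets in the estimator. -/
noncomputable def noiseGain (E : Fin n → Fin n → Matrix (Fin d) (Fin d) ℝ) (j : Fin n)
    (l : G.neighborSet j) : Matrix (ParamIdx n d) (Fin d) ℝ :=
  Matrix.of fun p c => ((obsMatrix G d j).transpose * (noiseCov G E j)⁻¹) p (c, l)

theorem sum_noiseGain_mulVec (E : Fin n → Fin n → Matrix (Fin d) (Fin d) ℝ) (j : Fin n)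
    (w : MeasIdx G d j → ℝ) :
    ((obsMatrix G d j).transpose * (noiseCov G E j)⁻¹) *ᵥ w
      = ∑ l, noiseGain G E j l *ᵥ fun c => w (c, l) := by
  funext p
  rw [Finset.sum_apply]
  simp only [mulVec, dotProduct, noiseGain, of_apply, Fintype.sum_prod_type_right]

/-- `(Hᵀ E⁻¹) E (Hᵀ E⁻¹)ᵀ = Hᵀ E⁻¹ H`, split into the contributions of the neighbors. -/
theorem sum_noiseGain_mul (E : Fin n → Fin n → Matrix (Fin d) (Fin d) ℝ)
    (hE : ∀ i j, G.Adj i j → (E i j).PosDef) (j : Fin n) :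
    ∑ l : G.neighborSet j, noiseGain G E j l * E j l * (noiseGain G E j l).transpose
      = obsInfo G E j := by
  have hN := noiseCov_posDef G hE j
  have hsymm : ((noiseCov G E j)⁻¹).transpose = (noiseCov G E j)⁻¹ := by
    have := hN.inv.isHermitian.eq
    rwa [conjTranspose_eq_transpose_of_trivial] at this
  set B := (obsMatrix G d j).transpose * (noiseCov G E j)⁻¹ with hB
  have h1 : obsInfo G E j = B * noiseCov G E j * B.transpose := by
    rw [obsInfo, ← hB, hB, transpose_mul, transpose_transpose, hsymm, ← Matrix.mul_assoc,
      nonsing_inv_mul_cancel_right]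
    exact (isUnit_iff_isUnit_det _).1 hN.isUnit
  rw [h1]
  have hgain : ∀ l p c, noiseGain G E j l p c = B p (c, l) := fun _ _ _ => rfl
  clear_value B
  ext p q
  rw [Matrix.sum_apply]
  simp only [Matrix.mul_apply, transpose_apply, hgain, noiseCov,
    blockDiagonal_apply, Fintype.sum_prod_type_right]
  simp

/-- The covariance of the noise in the information vector: a measurement at time `τ` has been
averaged `k - 1 - τ` times. -/
noncomputable def infoNoiseCov (a : Fin n → Fin n → ℝ)
    (E : Fin n → Fin n → Matrix (Fin d) (Fin d) ℝ) (k : ℕ) (i : Fin n) :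
    Matrix (ParamIdx n d) (ParamIdx n d) ℝ :=
  ∑ τ ∈ Finset.range k, ∑ j, ((avgMatrix G a ^ (k - 1 - τ)) i j) ^ 2 • obsInfo G E j

variable {S : Type*} [MeasurableSpace S] {P : Measure S} [IsProbabilityMeasure P]

/-- The noise in the information vector is Gaussian, as a sum of independent Gaussian contributions
of the times and the ordered pairs of neighbors. -/
theorem map_infoNoise (a : Fin n → Fin n → ℝ) (E : Fin n → Fin n → Matrix (Fin d) (Fin d) ℝ)
    (hE : ∀ i j, G.Adj i j → (E i j).PosDef)
    (ε : Fin n → Fin n → ℕ → S → EuclideanSpace ℝ (Fin d))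
    (hε_law : ∀ i j k, G.Adj i j → HasLaw (ε i j k) (multivariateGaussian 0 (E i j)) P)
    (hε_indep : iIndepFun (fun (e : G.Dart × ℕ) => ε e.1.fst e.1.snd e.2) P) (k : ℕ) (i : Fin n) :
    AEMeasurable (fun s => (WithLp.toLp 2 (∑ τ ∈ Finset.range k, ∑ j,
        (avgMatrix G a ^ (k - 1 - τ)) i j •
          (((obsMatrix G d j).transpose * (noiseCov G E j)⁻¹) *ᵥ
            fun p : MeasIdx G d j => ε j p.2 τ s p.1)) : EuclideanSpace ℝ (ParamIdx n d))) P ∧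
    P.map (fun s => (WithLp.toLp 2 (∑ τ ∈ Finset.range k, ∑ j, (avgMatrix G a ^ (k - 1 - τ)) i j •
          (((obsMatrix G d j).transpose * (noiseCov G E j)⁻¹) *ᵥ
            fun p : MeasIdx G d j => ε j p.2 τ s p.1)) : EuclideanSpace ℝ (ParamIdx n d)))
      = multivariateGaussian 0 (infoNoiseCov G a E k i) := by
  let α := Fin k × (Σ j : Fin n, G.neighborSet j)
  let B : α → Matrix (ParamIdx n d) (Fin d) ℝ := fun e =>
    (avgMatrix G a ^ (k - 1 - (e.1 : ℕ))) i e.2.1 • noiseGain G E e.2.1 e.2.2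
  let φ : α → EuclideanSpace ℝ (Fin d) → EuclideanSpace ℝ (ParamIdx n d) := fun e u =>
    0 + WithLp.toLp 2 (B e *ᵥ u.ofLp)
  let X : α → S → EuclideanSpace ℝ (ParamIdx n d) := fun e => φ e ∘ ε e.2.1 e.2.2 e.1
  let T : α → Matrix (ParamIdx n d) (ParamIdx n d) ℝ := fun e =>
    B e * E e.2.1 e.2.2 * (B e).transpose
  have hφ : ∀ e, Measurable (φ e) := fun e => by
    refine Continuous.measurable (continuous_const.add ((PiLp.continuous_toLp 2 _).comp ?_))
    exact Continuous.matrix_mulVec continuous_const (PiLp.continuous_ofLp 2 _)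
  have hEe : ∀ e : α, (E e.2.1 e.2.2).PosSemidef := fun e => (hE _ _ e.2.2.2).posSemidef
  have hT : ∀ e, (T e).PosSemidef := fun e => by
    simpa using (hEe e).mul_mul_conjTranspose_same (B e)
  have hX : ∀ e, HasLaw (X e) (multivariateGaussian 0 (T e)) P := by
    intro e
    have h := hε_law _ _ (e.1 : ℕ) e.2.2.2
    refine ⟨(hφ e).comp_aemeasurable h.aemeasurable, ?_⟩
    rw [← AEMeasurable.map_map_of_aemeasurable (hφ e).aemeasurable h.aemeasurable, h.map_eq,
      map_affine_multivariateGaussian _ (hEe e)]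
    simp [T]
  have hind : iIndepFun X P := by
    let ψ : α → G.Dart × ℕ := fun e => (⟨(e.2.1, (e.2.2 : Fin n)), e.2.2.2⟩, e.1)
    have hψ : Function.Injective ψ := by
      rintro ⟨τ, j, l, hl⟩ ⟨τ', j', l', hl'⟩ h
      obtain rfl : j = j' := congrArg (fun e : G.Dart × ℕ => e.1.fst) h
      obtain rfl : l = l' := congrArg (fun e : G.Dart × ℕ => e.1.snd) h
      obtain rfl : τ = τ' := Fin.ext (congrArg Prod.snd h)
      rfl
    exact (hε_indep.precomp hψ).comp φ hφ
  have hfun : (fun s => (WithLp.toLp 2 (∑ τ ∈ Finset.range k, ∑ j,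
        (avgMatrix G a ^ (k - 1 - τ)) i j •
          (((obsMatrix G d j).transpose * (noiseCov G E j)⁻¹) *ᵥ
            fun p : MeasIdx G d j => ε j p.2 τ s p.1)) : EuclideanSpace ℝ (ParamIdx n d)))
      = fun s => ∑ e, X e s := by
    funext s
    rw [Finset.sum_range, Fintype.sum_prod_type, WithLp.toLp_sum]
    refine Finset.sum_congr rfl fun τ _ => ?_
    rw [Fintype.sum_sigma, WithLp.toLp_sum]
    refine Finset.sum_congr rfl fun j _ => ?_
    rw [sum_noiseGain_mulVec, Finset.smul_sum, WithLp.toLp_sum]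
    refine Finset.sum_congr rfl fun l _ => ?_
    simp [X, φ, B, smul_mulVec]
  have hcov : ∑ e, T e = infoNoiseCov G a E k i := by
    rw [infoNoiseCov, Finset.sum_range, Fintype.sum_prod_type]
    refine Finset.sum_congr rfl fun τ _ => ?_
    rw [Fintype.sum_sigma]
    refine Finset.sum_congr rfl fun j _ => ?_
    rw [← sum_noiseGain_mul G E hE j, Finset.smul_sum]
    refine Finset.sum_congr rfl fun l _ => ?_
    simp [T, B, smul_smul, sq]
  rw [hfun]
  refine ⟨Finset.aemeasurable_fun_sum _ fun e _ => (hX e).aemeasurable, ?_⟩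
  rw [map_sum_multivariateGaussian hT hX hind, hcov]

end EstimationError

/-! ### Growth of the information -/

section Bounds

theorem exists_dotProduct_mulVec_le {ι : Type*} [Fintype ι] (M : Matrix ι ι ℝ) :
    ∃ K > 0, ∀ w : ι → ℝ, w ⬝ᵥ M *ᵥ w ≤ K * (w ⬝ᵥ w) := by
  set L : ℝ := ∑ p, ∑ q, |M p q| with hL
  have hM : ∀ p q, |M p q| ≤ L := fun p q =>
    (Finset.single_le_sum (f := fun q => |M p q|) (fun _ _ => abs_nonneg _)
      (Finset.mem_univ q)).trans (Finset.single_le_sum (f := fun p => ∑ q, |M p q|)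
        (fun _ _ => Finset.sum_nonneg fun _ _ => abs_nonneg _) (Finset.mem_univ p))
  refine ⟨1 + Fintype.card ι * (Fintype.card ι * L ^ 2), by positivity, fun w => ?_⟩
  have h1 := dotProduct_self_mulVec_le hM w
  have h2 : 0 ≤ (w - M *ᵥ w) ⬝ᵥ (w - M *ᵥ w) := dotProduct_self_nonneg_real _
  have h3 := dotProduct_self_nonneg_real w
  simp only [sub_dotProduct, dotProduct_sub, dotProduct_comm (M *ᵥ w) w] at h2
  set X : ℝ := Fintype.card ι * (Fintype.card ι * L ^ 2)
  have h4 : 0 ≤ X * (w ⬝ᵥ w) := mul_nonneg (by positivity) h3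
  linarith

variable {n d : ℕ} [NeZero n] (G : SimpleGraph (Fin n)) [DecidableRel G.Adj]
  {a : Fin n → Fin n → ℝ} {E : Fin n → Fin n → Matrix (Fin d) (Fin d) ℝ}
  {Ω₀ : Fin n → Matrix (ParamIdx n d) (ParamIdx n d) ℝ}

theorem dotProduct_sum_sum_smul {m n : ℕ} {ι : Type*} [Fintype ι] (b : ℕ → Fin n → ℝ)
    (M : Fin n → Matrix ι ι ℝ) (w : ι → ℝ) :
    w ⬝ᵥ (∑ τ ∈ Finset.range m, ∑ j, b τ j • M j) *ᵥ w
      = ∑ τ ∈ Finset.range m, ∑ j, b τ j * (w ⬝ᵥ M j *ᵥ w) := by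
  simp only [sum_mulVec, dotProduct_sum, smul_mulVec, dotProduct_smul, smul_eq_mul]

theorem infoMatrix_posSemidef (ha_pos : ∀ i j, (j = i ∨ G.Adj i j) → 0 < a i j)
    (hE : ∀ i j, G.Adj i j → (E i j).PosDef) (hΩ₀ : ∀ i, (Ω₀ i).PosSemidef) (k : ℕ) (i : Fin n) :
    (infoMatrix G a (obsMatrix G d) (noiseCov G E) Ω₀ k i).PosSemidef := by
  rw [infoMatrix_eq]
  refine (posSemidef_sum _ fun j _ => (hΩ₀ j).smul (avgMatrix_pow_nonneg ha_pos k i j)).add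
    (posSemidef_sum _ fun τ _ => posSemidef_sum _ fun j _ =>
      (obsInfo_posSemidef G hE j).smul (avgMatrix_pow_nonneg ha_pos _ i j))

/-- The information of every sensor grows linearly once all measurements can have reached it. -/
theorem exists_le_infoMatrix (hG : G.Connected)
    (ha_pos : ∀ i j, (j = i ∨ G.Adj i j) → 0 < a i j)
    (ha_sum : ∀ i, ∑ j ∈ insert i (G.neighborFinset i), a i j = 1)
    (hE : ∀ i j, G.Adj i j → (E i j).PosDef) (hΩ₀ : ∀ i, (Ω₀ i).PosSemidef) :
    ∃ c > 0, ∀ k, n ≤ k → ∀ i w, c * (k + 1) * (w ⬝ᵥ w) ≤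
      w ⬝ᵥ infoMatrix G a (obsMatrix G d) (noiseCov G E) Ω₀ k i *ᵥ w := by
  obtain ⟨c, hc, hA⟩ := exists_le_avgMatrix_pow hG ha_pos ha_sum
  obtain ⟨c', hc', hM⟩ := exists_pos_mul_dotProduct_le (sum_obsInfo_posDef G hG hE)
  refine ⟨c * c' / (n + 1), by positivity, fun k hk i w => ?_⟩
  have hq : ∀ j, 0 ≤ w ⬝ᵥ obsInfo G E j *ᵥ w := fun j => by
    simpa using (obsInfo_posSemidef G hE j).dotProduct_mulVec_nonneg w
  have h0 : 0 ≤ w ⬝ᵥ (∑ j, (avgMatrix G a ^ k) i j • Ω₀ j) *ᵥ w := by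
    simpa using (posSemidef_sum Finset.univ fun j _ =>
      (hΩ₀ j).smul (avgMatrix_pow_nonneg ha_pos k i j)).dotProduct_mulVec_nonneg w
  have hww := dotProduct_self_nonneg_real w
  rw [infoMatrix_eq, add_mulVec, dotProduct_add, dotProduct_sum_sum_smul]
  -- only the measurements up to time `k - n` are counted
  have h1 : ∑ _τ ∈ Finset.range (k + 1 - n), c * (c' * (w ⬝ᵥ w)) ≤ ∑ τ ∈ Finset.range k, ∑ j,
      (avgMatrix G a ^ (k - 1 - τ)) i j * (w ⬝ᵥ obsInfo G E j *ᵥ w) := by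
    calc _ ≤ ∑ τ ∈ Finset.range (k + 1 - n), ∑ j,
        (avgMatrix G a ^ (k - 1 - τ)) i j * (w ⬝ᵥ obsInfo G E j *ᵥ w) := by
          refine Finset.sum_le_sum fun τ hτ => ?_
          have hτ' := Finset.mem_range.1 hτ
          calc c * (c' * (w ⬝ᵥ w)) ≤ c * ∑ j, w ⬝ᵥ obsInfo G E j *ᵥ w := by
                refine mul_le_mul_of_nonneg_left ?_ hc.le
                have := hM w
                rwa [sum_mulVec, dotProduct_sum] at this
            _ ≤ _ := by
                rw [Finset.mul_sum]
                exact Finset.sum_le_sum fun j _ =>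
                  mul_le_mul_of_nonneg_right (hA _ (by omega) i j) (hq j)
      _ ≤ _ := by
          refine Finset.sum_le_sum_of_subset_of_nonneg (Finset.range_mono ?_) fun τ _ _ =>
            Finset.sum_nonneg fun j _ => mul_nonneg (avgMatrix_pow_nonneg ha_pos _ i j) (hq j)
          have := NeZero.pos n
          omega
  rw [Finset.sum_const, Finset.card_range, nsmul_eq_mul] at h1
  have h2 : ((k : ℝ) + 1) / (n + 1) ≤ ((k + 1 - n : ℕ) : ℝ) := by
    rw [Nat.cast_sub (by omega), div_le_iff₀ (by positivity)]
    push_cast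
    have hk' : (n : ℝ) ≤ k := by exact_mod_cast hk
    have hn0 : (0 : ℝ) ≤ n := by positivity
    nlinarith
  calc c * c' / (n + 1) * (k + 1) * (w ⬝ᵥ w) = ((k : ℝ) + 1) / (n + 1) * (c * (c' * (w ⬝ᵥ w))) := by
        ring
    _ ≤ ((k + 1 - n : ℕ) : ℝ) * (c * (c' * (w ⬝ᵥ w))) :=
        mul_le_mul_of_nonneg_right h2 (by positivity)
    _ ≤ _ := by linarith

theorem exists_abs_infoMatrix_le (ha_pos : ∀ i j, (j = i ∨ G.Adj i j) → 0 < a i j)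
    (ha_sum : ∀ i, ∑ j ∈ insert i (G.neighborFinset i), a i j = 1) :
    ∃ K > 0, ∀ k i p q,
      |infoMatrix G a (obsMatrix G d) (noiseCov G E) Ω₀ k i p q| ≤ K * (k + 1) := by
  set L : ℝ := ∑ j, ∑ p, ∑ q, (|Ω₀ j p q| + |obsInfo G E j p q|) with hL
  have hent : ∀ p q, ∑ j, (|Ω₀ j p q| + |obsInfo G E j p q|) ≤ L := by
    intro p q
    refine Finset.sum_le_sum fun j _ => ?_
    refine (Finset.single_le_sum (f := fun q => |Ω₀ j p q| + |obsInfo G E j p q|)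
      (fun _ _ => by positivity) (Finset.mem_univ q)).trans ?_
    exact Finset.single_le_sum (f := fun p => ∑ q, (|Ω₀ j p q| + |obsInfo G E j p q|))
      (fun _ _ => Finset.sum_nonneg fun _ _ => by positivity) (Finset.mem_univ p)
  have hL0 : 0 ≤ L := Finset.sum_nonneg fun _ _ => Finset.sum_nonneg fun _ _ =>
    Finset.sum_nonneg fun _ _ => by positivity
  refine ⟨L + 1, by positivity, fun k i p q => ?_⟩
  have hterm : ∀ (m : ℕ) (M : Fin n → Matrix (ParamIdx n d) (ParamIdx n d) ℝ),
      (∀ j, |M j p q| ≤ |Ω₀ j p q| + |obsInfo G E j p q|) →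
      |(∑ j, (avgMatrix G a ^ m) i j • M j) p q| ≤ L := by
    intro m M hM
    rw [Matrix.sum_apply]
    refine (Finset.abs_sum_le_sum_abs _ _).trans
      (le_trans (Finset.sum_le_sum fun j _ => ?_) (hent p q))
    rw [Matrix.smul_apply, smul_eq_mul, abs_mul, abs_of_nonneg (avgMatrix_pow_nonneg ha_pos m i j)]
    exact (mul_le_of_le_one_left (abs_nonneg _) (avgMatrix_pow_le_one ha_pos ha_sum m i j)).trans
      (hM j)
  rw [infoMatrix_eq, Matrix.add_apply, Matrix.sum_apply p q (Finset.range k)]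
  calc _ ≤ L + ∑ τ ∈ Finset.range k, L := by
        refine (abs_add_le _ _).trans (add_le_add (hterm k Ω₀ fun j => by simp) ?_)
        exact (Finset.abs_sum_le_sum_abs _ _).trans (Finset.sum_le_sum fun τ _ =>
          hterm _ _ fun j => by simp)
    _ = L * (k + 1) := by simp; ring
    _ ≤ _ := by gcongr; linarith

theorem infoNoiseCov_posSemidef (hE : ∀ i j, G.Adj i j → (E i j).PosDef) (k : ℕ) (i : Fin n) :
    (infoNoiseCov G a E k i).PosSemidef :=
  posSemidef_sum _ fun _ _ => posSemidef_sum _ fun j _ =>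
    (obsInfo_posSemidef G hE j).smul (sq_nonneg _)

/-- The noise in the information vector is nondegenerate once all measurements can have reached the
sensor: the noise of time `0` alone suffices. -/
theorem exists_le_infoNoiseCov (hG : G.Connected)
    (ha_pos : ∀ i j, (j = i ∨ G.Adj i j) → 0 < a i j)
    (ha_sum : ∀ i, ∑ j ∈ insert i (G.neighborFinset i), a i j = 1)
    (hE : ∀ i j, G.Adj i j → (E i j).PosDef) :
    ∃ c > 0, ∀ k, n ≤ k → ∀ i w, c * (w ⬝ᵥ w) ≤ w ⬝ᵥ infoNoiseCov G a E k i *ᵥ w := by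
  obtain ⟨c, hc, hA⟩ := exists_le_avgMatrix_pow hG ha_pos ha_sum
  obtain ⟨c', hc', hM⟩ := exists_pos_mul_dotProduct_le (sum_obsInfo_posDef G hG hE)
  refine ⟨c ^ 2 * c', by positivity, fun k hk i w => ?_⟩
  have hq : ∀ j, 0 ≤ w ⬝ᵥ obsInfo G E j *ᵥ w := fun j => by
    simpa using (obsInfo_posSemidef G hE j).dotProduct_mulVec_nonneg w
  have hk0 : 0 < k := (NeZero.pos n).trans_le hk
  rw [infoNoiseCov, dotProduct_sum_sum_smul]
  calc c ^ 2 * c' * (w ⬝ᵥ w) ≤ c ^ 2 * ∑ j, w ⬝ᵥ obsInfo G E j *ᵥ w := by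
        rw [mul_assoc]
        refine mul_le_mul_of_nonneg_left ?_ (by positivity)
        have := hM w
        rwa [sum_mulVec, dotProduct_sum] at this
    _ ≤ ∑ j, ((avgMatrix G a ^ (k - 1 - 0)) i j) ^ 2 * (w ⬝ᵥ obsInfo G E j *ᵥ w) := by
        rw [Finset.mul_sum]
        exact Finset.sum_le_sum fun j _ => mul_le_mul_of_nonneg_right
          (pow_le_pow_left₀ hc.le (hA _ (by omega) i j) 2) (hq j)
    _ ≤ _ := Finset.single_le_sum (f := fun τ => ∑ j, ((avgMatrix G a ^ (k - 1 - τ)) i j) ^ 2 *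
          (w ⬝ᵥ obsInfo G E j *ᵥ w)) (fun τ _ => Finset.sum_nonneg fun j _ =>
            mul_nonneg (sq_nonneg _) (hq j)) (Finset.mem_range.2 hk0)

theorem exists_infoNoiseCov_le (ha_pos : ∀ i j, (j = i ∨ G.Adj i j) → 0 < a i j)
    (ha_sum : ∀ i, ∑ j ∈ insert i (G.neighborFinset i), a i j = 1)
    (hE : ∀ i j, G.Adj i j → (E i j).PosDef) :
    ∃ K > 0, ∀ (k : ℕ) i w, w ⬝ᵥ infoNoiseCov G a E k i *ᵥ w ≤ K * (k + 1) * (w ⬝ᵥ w) := by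
  obtain ⟨K, hK, hM⟩ := exists_dotProduct_mulVec_le (∑ j, obsInfo G E j)
  refine ⟨K, hK, fun k i w => ?_⟩
  have hq : ∀ j, 0 ≤ w ⬝ᵥ obsInfo G E j *ᵥ w := fun j => by
    simpa using (obsInfo_posSemidef G hE j).dotProduct_mulVec_nonneg w
  have hww := dotProduct_self_nonneg_real w
  rw [infoNoiseCov, dotProduct_sum_sum_smul]
  calc _ ≤ ∑ τ ∈ Finset.range k, K * (w ⬝ᵥ w) := by
        refine Finset.sum_le_sum fun τ _ => ?_
        refine le_trans (Finset.sum_le_sum fun j _ => ?_)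
          ((show ∑ j, w ⬝ᵥ obsInfo G E j *ᵥ w ≤ _ by simpa [sum_mulVec, dotProduct_sum] using hM w))
        exact mul_le_of_le_one_left (hq j) (pow_le_one₀ (avgMatrix_pow_nonneg ha_pos _ i j)
          (avgMatrix_pow_le_one ha_pos ha_sum _ i j))
    _ = K * k * (w ⬝ᵥ w) := by simp; ring
    _ ≤ _ := by gcongr; linarith

end Bounds

section EstimateLaw

variable {n d : ℕ} [NeZero n] (G : SimpleGraph (Fin n)) [DecidableRel G.Adj]
  (a : Fin n → Fin n → ℝ) (E : Fin n → Fin n → Matrix (Fin d) (Fin d) ℝ)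
  (Ω₀ : Fin n → Matrix (ParamIdx n d) (ParamIdx n d) ℝ) (ω₀ : Fin n → ParamIdx n d → ℝ)
  (x : Fin n → EuclideanSpace ℝ (Fin d))

/-- The mean of the parameter estimate: the true parameter plus the bias of the initialization. -/
noncomputable def estimateMean (k : ℕ) (i : Fin n) : EuclideanSpace ℝ (ParamIdx n d) :=
  WithLp.toLp 2 (trueParam x + (infoMatrix G a (obsMatrix G d) (noiseCov G E) Ω₀ k i)⁻¹ *ᵥ
    ∑ j, (avgMatrix G a ^ k) i j • (ω₀ j - Ω₀ j *ᵥ trueParam x))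

/-- The covariance of the parameter estimate. -/
noncomputable def estimateCov (k : ℕ) (i : Fin n) : Matrix (ParamIdx n d) (ParamIdx n d) ℝ :=
  (infoMatrix G a (obsMatrix G d) (noiseCov G E) Ω₀ k i)⁻¹ * infoNoiseCov G a E k i *
    ((infoMatrix G a (obsMatrix G d) (noiseCov G E) Ω₀ k i)⁻¹).transpose

variable {a E Ω₀}

theorem isUnit_det_infoMatrix (hG : G.Connected)
    (ha_pos : ∀ i j, (j = i ∨ G.Adj i j) → 0 < a i j)
    (ha_sum : ∀ i, ∑ j ∈ insert i (G.neighborFinset i), a i j = 1)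
    (hE : ∀ i j, G.Adj i j → (E i j).PosDef) (hΩ₀ : ∀ i, (Ω₀ i).PosSemidef) {k : ℕ} (hk : n ≤ k)
    (i : Fin n) : IsUnit (infoMatrix G a (obsMatrix G d) (noiseCov G E) Ω₀ k i).det := by
  obtain ⟨c, hc, h⟩ := exists_le_infoMatrix (d := d) (Ω₀ := Ω₀) G hG ha_pos ha_sum hE hΩ₀
  rw [isUnit_iff_ne_zero]
  intro h0
  obtain ⟨w, hw, hw0⟩ := exists_mulVec_eq_zero_iff.2 h0
  have h1 := h k hk i w
  rw [hw0, dotProduct_zero] at h1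
  have h2 : 0 < w ⬝ᵥ w := lt_of_le_of_ne (dotProduct_self_nonneg_real w)
    fun h => hw (dotProduct_self_eq_zero.1 h.symm)
  have h3 : 0 < c * (k + 1) * (w ⬝ᵥ w) := by positivity
  linarith

/-- The parameter estimate is Gaussian, as an affine function of the noise in the information
vector. -/
theorem map_gaussEstimate {S : Type*} [MeasurableSpace S] {P : Measure S} [IsProbabilityMeasure P]
    (hE : ∀ i j, G.Adj i j → (E i j).PosDef)
    (ε : Fin n → Fin n → ℕ → S → EuclideanSpace ℝ (Fin d))
    (hε_law : ∀ i j k, G.Adj i j → HasLaw (ε i j k) (multivariateGaussian 0 (E i j)) P)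
    (hε_indep : iIndepFun (fun (e : G.Dart × ℕ) => ε e.1.fst e.1.snd e.2) P) {k : ℕ} {i : Fin n}
    (hu : IsUnit (infoMatrix G a (obsMatrix G d) (noiseCov G E) Ω₀ k i).det) :
    HasLaw (fun s => (WithLp.toLp 2 (gaussEstimate G a (obsMatrix G d) (noiseCov G E) Ω₀ ω₀
      (relMeas G x fun p q t => ε p q t s) k i) : EuclideanSpace ℝ (ParamIdx n d)))
      (multivariateGaussian (estimateMean G a E Ω₀ ω₀ x k i) (estimateCov G a E Ω₀ k i)) P := by
  obtain ⟨hm, hlaw⟩ := map_infoNoise G a E hE ε hε_law hε_indep k i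
  set Ω := infoMatrix G a (obsMatrix G d) (noiseCov G E) Ω₀ k i with hΩ
  let φ : EuclideanSpace ℝ (ParamIdx n d) → EuclideanSpace ℝ (ParamIdx n d) := fun u =>
    estimateMean G a E Ω₀ ω₀ x k i + WithLp.toLp 2 (Ω⁻¹ *ᵥ u.ofLp)
  have hφ : Measurable φ := by
    refine Continuous.measurable (continuous_const.add ((PiLp.continuous_toLp 2 _).comp ?_))
    exact Continuous.matrix_mulVec continuous_const (PiLp.continuous_ofLp 2 _)
  have hfun : (fun s => (WithLp.toLp 2 (gaussEstimate G a (obsMatrix G d) (noiseCov G E) Ω₀ ω₀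
      (relMeas G x fun p q t => ε p q t s) k i) : EuclideanSpace ℝ (ParamIdx n d))) =
      φ ∘ fun s => (WithLp.toLp 2 (∑ τ ∈ Finset.range k, ∑ j, (avgMatrix G a ^ (k - 1 - τ)) i j •
          (((obsMatrix G d j).transpose * (noiseCov G E j)⁻¹) *ᵥ
            fun p : MeasIdx G d j => ε j p.2 τ s p.1)) : EuclideanSpace ℝ (ParamIdx n d)) := by
    funext s
    simp only [φ, Function.comp, estimateMean, gaussEstimate]
    rw [infoVector_eq G a (obsMatrix G d) (noiseCov G E) Ω₀ ω₀ _
      (fun k i (p : MeasIdx G d i) => ε i p.2 k s p.1) (trueParam x)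
      (fun k i => relMeas_eq G x (fun p q t => ε p q t s) k i), ← hΩ, mulVec_add, mulVec_add,
      mulVec_mulVec, nonsing_inv_mul _ hu, one_mulVec, ← WithLp.toLp_add, add_assoc]
  rw [hfun]
  refine ⟨hφ.comp_aemeasurable hm, ?_⟩
  rw [← AEMeasurable.map_map_of_aemeasurable hφ.aemeasurable hm, hlaw,
    map_affine_multivariateGaussian _ (infoNoiseCov_posSemidef G hE k i)]
  congr 1
  simp

end EstimateLaw

/-! ### Expectation of the weights -/

section EstimateBounds

variable {n d : ℕ} [NeZero n] (G : SimpleGraph (Fin n)) [DecidableRel G.Adj]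
  {a : Fin n → Fin n → ℝ} {E : Fin n → Fin n → Matrix (Fin d) (Fin d) ℝ}
  {Ω₀ : Fin n → Matrix (ParamIdx n d) (ParamIdx n d) ℝ} (ω₀ : Fin n → ParamIdx n d → ℝ)
  (x : Fin n → EuclideanSpace ℝ (Fin d))

theorem estimateCov_posSemidef (hE : ∀ i j, G.Adj i j → (E i j).PosDef) (k : ℕ) (i : Fin n) :
    (estimateCov G a E Ω₀ k i).PosSemidef := by
  simpa [estimateCov] using (infoNoiseCov_posSemidef (a := a) G hE k i).mul_mul_conjTranspose_same
    (infoMatrix G a (obsMatrix G d) (noiseCov G E) Ω₀ k i)⁻¹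

theorem dotProduct_estimateCov (ha_pos : ∀ i j, (j = i ∨ G.Adj i j) → 0 < a i j)
    (hE : ∀ i j, G.Adj i j → (E i j).PosDef) (hΩ₀ : ∀ i, (Ω₀ i).PosSemidef) (k : ℕ) (i : Fin n)
    (w : ParamIdx n d → ℝ) :
    w ⬝ᵥ estimateCov G a E Ω₀ k i *ᵥ w =
      ((infoMatrix G a (obsMatrix G d) (noiseCov G E) Ω₀ k i)⁻¹ *ᵥ w) ⬝ᵥ
        infoNoiseCov G a E k i *ᵥ
          ((infoMatrix G a (obsMatrix G d) (noiseCov G E) Ω₀ k i)⁻¹ *ᵥ w) := by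
  have hsymm : ((infoMatrix G a (obsMatrix G d) (noiseCov G E) Ω₀ k i)⁻¹).transpose
      = (infoMatrix G a (obsMatrix G d) (noiseCov G E) Ω₀ k i)⁻¹ := by
    have := (infoMatrix_posSemidef G ha_pos hE hΩ₀ k i).inv.isHermitian.eq
    rwa [conjTranspose_eq_transpose_of_trivial] at this
  rw [estimateCov, hsymm, Matrix.mul_assoc, ← mulVec_mulVec, ← mulVec_mulVec, dotProduct_mulVec]
  nth_rewrite 1 [← hsymm]
  rw [vecMul_transpose]

/-- The covariance of the estimate degenerates at most quadratically in time. This is not sharp, but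
it follows from crude bounds, and each polynomial bound serves. -/
theorem exists_le_estimateCov (hG : G.Connected)
    (ha_pos : ∀ i j, (j = i ∨ G.Adj i j) → 0 < a i j)
    (ha_sum : ∀ i, ∑ j ∈ insert i (G.neighborFinset i), a i j = 1)
    (hE : ∀ i j, G.Adj i j → (E i j).PosDef) (hΩ₀ : ∀ i, (Ω₀ i).PosSemidef) :
    ∃ c > 0, ∀ k : ℕ, n ≤ k → ∀ i w, c * ((k + 1 : ℝ) ^ 2)⁻¹ * (w ⬝ᵥ w) ≤
      w ⬝ᵥ estimateCov G a E Ω₀ k i *ᵥ w := by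
  obtain ⟨c, hc, hC⟩ := exists_le_infoNoiseCov (d := d) G hG ha_pos ha_sum hE
  obtain ⟨K, hK, hΩ⟩ := exists_abs_infoMatrix_le (d := d) (E := E) (Ω₀ := Ω₀) G ha_pos ha_sum
  set N : ℝ := ((Fintype.card (ParamIdx n d) : ℕ) : ℝ) with hN
  have hN0 : 0 ≤ N := by positivity
  refine ⟨c / (N * N * K ^ 2 + 1), by positivity, fun k hk i w => ?_⟩
  rw [dotProduct_estimateCov G ha_pos hE hΩ₀]
  have hu := isUnit_det_infoMatrix (d := d) (Ω₀ := Ω₀) G hG ha_pos ha_sum hE hΩ₀ hk i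
  set Ω := infoMatrix G a (obsMatrix G d) (noiseCov G E) Ω₀ k i with hΩd
  set z := Ω⁻¹ *ᵥ w with hz
  have hMz : Ω *ᵥ z = w := by rw [hz, mulVec_mulVec, mul_nonsing_inv _ hu, one_mulVec]
  have h1 := dotProduct_self_mulVec_le (hΩ k i) z
  rw [← hΩd, hMz, ← hN] at h1
  have hzz := dotProduct_self_nonneg_real z
  have hk1 : (0 : ℝ) < (k + 1) ^ 2 := by positivity
  have h2 : w ⬝ᵥ w ≤ (N * N * K ^ 2 + 1) * (k + 1) ^ 2 * (z ⬝ᵥ z) := by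
    refine h1.trans (mul_le_mul_of_nonneg_right ?_ hzz)
    have : N * (N * (K * (k + 1)) ^ 2) = N * N * K ^ 2 * (k + 1 : ℝ) ^ 2 := by ring
    rw [this]
    gcongr
    linarith
  refine le_trans ?_ (hC k hk i z)
  calc _ ≤ c / (N * N * K ^ 2 + 1) * ((k + 1 : ℝ) ^ 2)⁻¹ *
        ((N * N * K ^ 2 + 1) * (k + 1) ^ 2 * (z ⬝ᵥ z)) :=
        mul_le_mul_of_nonneg_left h2 (by positivity)
    _ = c * (z ⬝ᵥ z) := by field_simp

theorem exists_estimateCov_le (hG : G.Connected)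
    (ha_pos : ∀ i j, (j = i ∨ G.Adj i j) → 0 < a i j)
    (ha_sum : ∀ i, ∑ j ∈ insert i (G.neighborFinset i), a i j = 1)
    (hE : ∀ i j, G.Adj i j → (E i j).PosDef) (hΩ₀ : ∀ i, (Ω₀ i).PosSemidef) :
    ∃ C, ∀ k : ℕ, n ≤ k → ∀ i p, estimateCov G a E Ω₀ k i p p * (k + 1) ≤ C := by
  obtain ⟨K, hK, hC⟩ := exists_infoNoiseCov_le (d := d) G ha_pos ha_sum hE
  obtain ⟨c, hc, hΩ⟩ := exists_le_infoMatrix (d := d) (Ω₀ := Ω₀) G hG ha_pos ha_sum hE hΩ₀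
  refine ⟨K / c ^ 2, fun k hk i p => ?_⟩
  have hu := isUnit_det_infoMatrix (d := d) (Ω₀ := Ω₀) G hG ha_pos ha_sum hE hΩ₀ hk i
  set w : ParamIdx n d → ℝ := Pi.single p 1 with hw
  have hww : w ⬝ᵥ w = 1 := by simp [hw]
  have h1 : estimateCov G a E Ω₀ k i p p = w ⬝ᵥ estimateCov G a E Ω₀ k i *ᵥ w := by
    simp [hw]
  have h2 := sq_mul_dotProduct_self_inv_le (c := c * (k + 1)) (by positivity)
    (fun w => hΩ k hk i w) hu w
  rw [hww] at h2
  rw [h1, dotProduct_estimateCov G ha_pos hE hΩ₀]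
  set z := (infoMatrix G a (obsMatrix G d) (noiseCov G E) Ω₀ k i)⁻¹ *ᵥ w
  have h3 := hC k i z
  rw [le_div_iff₀ (by positivity)]
  have hk1 : (0 : ℝ) < k + 1 := by positivity
  calc _ ≤ K * (k + 1) * (z ⬝ᵥ z) * (k + 1) * c ^ 2 := by gcongr
    _ = K * ((c * (k + 1)) ^ 2 * (z ⬝ᵥ z)) := by ring
    _ ≤ K * 1 := by gcongr
    _ = K := mul_one K

theorem tendsto_estimateMean (hG : G.Connected)
    (ha_pos : ∀ i j, (j = i ∨ G.Adj i j) → 0 < a i j)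
    (ha_sum : ∀ i, ∑ j ∈ insert i (G.neighborFinset i), a i j = 1)
    (hE : ∀ i j, G.Adj i j → (E i j).PosDef) (hΩ₀ : ∀ i, (Ω₀ i).PosSemidef) (i : Fin n) :
    Tendsto (fun k => estimateMean G a E Ω₀ ω₀ x k i) atTop (𝓝 (WithLp.toLp 2 (trueParam x))) := by
  obtain ⟨c, hc, hΩ⟩ := exists_le_infoMatrix (d := d) (Ω₀ := Ω₀) G hG ha_pos ha_sum hE hΩ₀
  let f : Fin n → ParamIdx n d → ℝ := fun j => ω₀ j - Ω₀ j *ᵥ trueParam x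
  let b : ℕ → ParamIdx n d → ℝ := fun k => ∑ j, (avgMatrix G a ^ k) i j • f j
  set L : ℝ := ∑ p, (∑ j, |f j p|) ^ 2 with hL
  have hb : ∀ k, b k ⬝ᵥ b k ≤ L := by
    intro k
    refine Finset.sum_le_sum fun p _ => ?_
    rw [← sq, ← sq_abs]
    refine pow_le_pow_left₀ (abs_nonneg _) ?_ 2
    simp only [b, Finset.sum_apply]
    refine (Finset.abs_sum_le_sum_abs _ _).trans (Finset.sum_le_sum fun j _ => ?_)
    rw [Pi.smul_apply, smul_eq_mul, abs_mul, abs_of_nonneg (avgMatrix_pow_nonneg ha_pos k i j)]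
    exact mul_le_of_le_one_left (abs_nonneg _) (avgMatrix_pow_le_one ha_pos ha_sum k i j)
  have hL0 : 0 ≤ L := Finset.sum_nonneg fun _ _ => sq_nonneg _
  rw [tendsto_iff_norm_sub_tendsto_zero]
  have hbound : ∀ k, n ≤ k → ‖estimateMean G a E Ω₀ ω₀ x k i - WithLp.toLp 2 (trueParam x)‖ ≤
      Real.sqrt L / c * (1 / ((k : ℝ) + 1)) := by
    intro k hk
    have hu := isUnit_det_infoMatrix (d := d) (Ω₀ := Ω₀) G hG ha_pos ha_sum hE hΩ₀ hk i
    have h2 := sq_mul_dotProduct_self_inv_le (c := c * (k + 1)) (by positivity)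
      (fun w => hΩ k hk i w) hu (b k)
    set z := (infoMatrix G a (obsMatrix G d) (noiseCov G E) Ω₀ k i)⁻¹ *ᵥ b k with hz
    have e : estimateMean G a E Ω₀ ω₀ x k i - WithLp.toLp 2 (trueParam x) = WithLp.toLp 2 z := by
      rw [estimateMean, WithLp.toLp_add, add_sub_cancel_left]
    have hnz : ‖(WithLp.toLp 2 z : EuclideanSpace ℝ (ParamIdx n d))‖ ^ 2 = z ⬝ᵥ z := by
      rw [EuclideanSpace.real_norm_sq_eq]
      exact Finset.sum_congr rfl fun p _ => sq _
    rw [e]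
    have hk1 : (0 : ℝ) < k + 1 := by positivity
    rw [div_mul_div_comm, mul_one, le_div_iff₀ (by positivity)]
    refine Real.le_sqrt_of_sq_le ?_
    rw [mul_pow, hnz, mul_comm]
    exact h2.trans (hb k)
  refine squeeze_zero' (Eventually.of_forall fun k => norm_nonneg _)
    ((eventually_ge_atTop n).mono hbound) ?_
  simpa using tendsto_one_div_add_atTop_nhds_zero_nat.const_mul (Real.sqrt L / c)

/-- The linear map from the parameter to the differences `x l - x j`, `l ≠ j`, of the formation. -/
noncomputable def diffMatrix (d : ℕ) (j : Fin n) :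
    Matrix (Fin d × {l : Fin n // l ≠ j}) (ParamIdx n d) ℝ :=
  Matrix.of fun p q => if p.1 = q.1 then
    (if (p.2 : Fin n) = (q.2 : Fin n) then 1 else 0) - (if j = (q.2 : Fin n) then 1 else 0) else 0

theorem diffMatrix_mulVec (j : Fin n) (θ : ParamIdx n d → ℝ) (p : Fin d × {l : Fin n // l ≠ j}) :
    (diffMatrix d j *ᵥ θ) p = formation θ p.2 p.1 - formation θ j p.1 := by
  -- for the complete graph the differences are the noiseless measurements of sensor `j`
  exact obsMatrix_mulVec (⊤ : SimpleGraph (Fin n)) j θ (p.1, ⟨p.2, by simpa using p.2.2⟩)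

theorem diffMatrix_mulVec_surjective (j : Fin n) :
    Function.Surjective fun θ : ParamIdx n d → ℝ => diffMatrix d j *ᵥ θ := by
  intro u
  let u' : Fin n → Fin d → ℝ := fun l c => if h : l = j then 0 else u (c, ⟨l, h⟩)
  refine ⟨fun q => u' q.2 q.1 - u' 0 q.1, ?_⟩
  have hf : ∀ l c, formation (fun q : ParamIdx n d => u' q.2 q.1 - u' 0 q.1) l c
      = u' l c - u' 0 c := by
    intro l c
    by_cases hl : l = 0
    · simp [formation, hl]
    · simp [formation, hl]
  funext ⟨c, l, hl⟩
  change (diffMatrix d j *ᵥ _) _ = _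
  rw [diffMatrix_mulVec, hf, hf]
  simp [u', hl]

theorem exists_le_diffMatrix (j : Fin n) :
    ∃ c > 0, ∀ w : Fin d × {l : Fin n // l ≠ j} → ℝ,
      c * (w ⬝ᵥ w) ≤ ((diffMatrix d j).transpose *ᵥ w) ⬝ᵥ ((diffMatrix d j).transpose *ᵥ w) := by
  have hPD : (diffMatrix d j * (diffMatrix d j).transpose).PosDef := by
    have := PosDef.mul_conjTranspose_self (diffMatrix d j) (by
      intro v w hvw
      rw [← sub_eq_zero, ← dotProduct_self_eq_zero]
      obtain ⟨θ, hθ⟩ := diffMatrix_mulVec_surjective j (v - w)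
      rw [← hθ, dotProduct_mulVec, hθ, sub_vecMul, sub_eq_zero.2 hvw, zero_dotProduct])
    simpa using this
  obtain ⟨c, hc, h⟩ := exists_pos_mul_dotProduct_le hPD
  refine ⟨c, hc, fun w => (h w).trans_eq ?_⟩
  rw [← mulVec_mulVec, dotProduct_mulVec, mulVec_transpose]

/-- Moments of the singularity of the weights grow at most polynomially in time: the law of the
differences has an isotropic component of standard deviation at least a multiple of `1 / k`. -/
theorem exists_lintegral_singularFactor_le (hG : G.Connected)
    (ha_pos : ∀ i j, (j = i ∨ G.Adj i j) → 0 < a i j)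
    (ha_sum : ∀ i, ∑ j ∈ insert i (G.neighborFinset i), a i j = 1)
    (hE : ∀ i j, G.Adj i j → (E i j).PosDef) (hΩ₀ : ∀ i, (Ω₀ i).PosSemidef) (i j : Fin n) :
    ∃ K : ENNReal, K ≠ ⊤ ∧ ∃ M : ℕ, ∀ k : ℕ, n ≤ k →
      ∫⁻ θ, ∏ p : Fin d × {l : Fin n // l ≠ j}, singularFactor p.1
        (formation θ.ofLp p.2 p.1 - formation θ.ofLp j p.1) ^ (3 / 4 : ℝ)
        ∂(multivariateGaussian (estimateMean G a E Ω₀ ω₀ x k i) (estimateCov G a E Ω₀ k i)) ≤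
      K * (k + 1) ^ M := by
  obtain ⟨c₁, hc₁, hS⟩ := exists_le_estimateCov (d := d) (Ω₀ := Ω₀) G hG ha_pos ha_sum hE hΩ₀
  obtain ⟨c₂, hc₂, hD⟩ := exists_le_diffMatrix (d := d) j
  obtain ⟨C, hC, hg⟩ := exists_lintegral_gaussianReal_le
  set B := diffMatrix d j with hB
  set N := Fintype.card (Fin d × {l : Fin n // l ≠ j}) with hN
  set s : ℝ := Real.sqrt (c₁ * c₂) with hs
  have hs0 : 0 < s := by positivity
  refine ⟨((1 + C) * (1 + ENNReal.ofReal s⁻¹)) ^ N, ?_, N, fun k hk => ?_⟩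
  · exact ENNReal.pow_ne_top (ENNReal.mul_ne_top (by simp [hC]) (by simp))
  set m := estimateMean G a E Ω₀ ω₀ x k i
  set Sk := estimateCov G a E Ω₀ k i with hSk
  have hSk0 : Sk.PosSemidef := estimateCov_posSemidef G hE k i
  let g : Fin d × {l : Fin n // l ≠ j} → ℝ → ENNReal := fun p r =>
    singularFactor p.1 r ^ (3 / 4 : ℝ)
  have hgm : ∀ p, Measurable (g p) := fun p => (measurable_singularFactor p.1).pow_const _
  have hprodm : Measurable fun u : EuclideanSpace ℝ (Fin d × {l : Fin n // l ≠ j}) =>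
      ∏ p, g p (u p) := Finset.measurable_prod _ fun p _ => (hgm p).comp (by fun_prop)
  let φ : EuclideanSpace ℝ (ParamIdx n d) → EuclideanSpace ℝ (Fin d × {l : Fin n // l ≠ j}) :=
    fun θ => 0 + WithLp.toLp 2 (B *ᵥ θ.ofLp)
  have hφ : Measurable φ := by
    refine Continuous.measurable (continuous_const.add ((PiLp.continuous_toLp 2 _).comp ?_))
    exact Continuous.matrix_mulVec continuous_const (PiLp.continuous_ofLp 2 _)
  have e1 : ∀ θ : EuclideanSpace ℝ (ParamIdx n d), ∏ p : Fin d × {l : Fin n // l ≠ j},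
      singularFactor p.1 (formation θ.ofLp p.2 p.1 - formation θ.ofLp j p.1) ^ (3 / 4 : ℝ)
      = ∏ p, g p (φ θ p) := by
    intro θ
    refine Finset.prod_congr rfl fun p _ => ?_
    have : φ θ p = formation θ.ofLp p.2 p.1 - formation θ.ofLp j p.1 := by
      rw [← diffMatrix_mulVec]; simp [φ, hB]
    rw [this]
  simp_rw [e1]
  rw [← lintegral_map (f := fun u : EuclideanSpace ℝ (Fin d × {l : Fin n // l ≠ j}) =>
    ∏ p, g p (u p)) hprodm hφ, map_affine_multivariateGaussian _ hSk0]
  -- variance of an isotropic Gaussian component of the law of the differences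
  let v : NNReal := ⟨c₁ * ((k + 1 : ℝ) ^ 2)⁻¹ * c₂, by positivity⟩
  have hv0 : v ≠ 0 := by
    have : (0 : ℝ) < c₁ * ((k + 1 : ℝ) ^ 2)⁻¹ * c₂ := by positivity
    exact fun h => this.ne' (congrArg NNReal.toReal h)
  have hsqrt : Real.sqrt v = s * ((k : ℝ) + 1)⁻¹ := by
    have : (v : ℝ) = (s * ((k : ℝ) + 1)⁻¹) ^ 2 := by
      rw [mul_pow, hs, Real.sq_sqrt (by positivity), inv_pow]
      change c₁ * ((k + 1 : ℝ) ^ 2)⁻¹ * c₂ = _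
      ring
    rw [this, Real.sqrt_sq (by positivity)]
  have hPSD : (B * Sk * B.transpose - (v : ℝ) • (1 : Matrix (Fin d × {l : Fin n // l ≠ j})
      (Fin d × {l : Fin n // l ≠ j}) ℝ)).PosSemidef := by
    have hBS : (B * Sk * B.transpose).PosSemidef := by
      simpa using hSk0.mul_mul_conjTranspose_same B
    refine posSemidef_iff_real.2 ⟨?_, fun w => ?_⟩
    · rw [transpose_sub, (posSemidef_iff_real.1 hBS).1, transpose_smul, transpose_one]
    · rw [sub_mulVec, dotProduct_sub, smul_mulVec, one_mulVec, dotProduct_smul, smul_eq_mul]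
      have e2 : w ⬝ᵥ (B * Sk * B.transpose) *ᵥ w
          = (B.transpose *ᵥ w) ⬝ᵥ Sk *ᵥ (B.transpose *ᵥ w) := by
        rw [Matrix.mul_assoc, ← mulVec_mulVec, ← mulVec_mulVec, dotProduct_mulVec, mulVec_transpose]
      rw [e2]
      have h1 := hS k hk i (B.transpose *ᵥ w)
      have h2 := mul_le_mul_of_nonneg_left (hD w)
        (show (0 : ℝ) ≤ c₁ * ((k + 1 : ℝ) ^ 2)⁻¹ by positivity)
      have h3 : (v : ℝ) * (w ⬝ᵥ w) = c₁ * ((k + 1 : ℝ) ^ 2)⁻¹ * (c₂ * (w ⬝ᵥ w)) := by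
        change c₁ * ((k + 1 : ℝ) ^ 2)⁻¹ * c₂ * (w ⬝ᵥ w) = _
        ring
      linarith
  set b : ENNReal := (1 + C) * (1 + ENNReal.ofReal (Real.sqrt v)⁻¹) with hb
  have hbound : ∀ p y, ∫⁻ z, g p (y + z) ∂(gaussianReal 0 v) ≤ b := by
    intro p y
    by_cases hp : (p.1 : ℕ) < 2
    · simp only [g, singularFactor, if_pos hp]
      refine (hg v hv0 y).trans ?_
      exact mul_le_mul_left le_add_self _
    · simp only [g, singularFactor, if_neg hp, ENNReal.one_rpow, lintegral_one, measure_univ]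
      exact one_le_mul_of_one_le_of_one_le le_self_add le_self_add
  refine (lintegral_prod_multivariateGaussian_le _ v hPSD g hgm b hbound).trans ?_
  rw [← hN, ← mul_pow]
  refine pow_le_pow_left₀ zero_le ?_ N
  rw [hb, mul_assoc]
  gcongr
  rw [hsqrt, mul_inv, inv_inv, ENNReal.ofReal_mul (by positivity),
    ENNReal.ofReal_add (by positivity) zero_le_one, ENNReal.ofReal_natCast, ENNReal.ofReal_one,
    add_mul, one_mul]
  gcongr
  exact le_add_self

end EstimateBounds

section WeightLimit

variable {n d : ℕ} [NeZero n] (G : SimpleGraph (Fin n)) [DecidableRel G.Adj]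
  {a : Fin n → Fin n → ℝ} {E : Fin n → Fin n → Matrix (Fin d) (Fin d) ℝ}
  {Ω₀ : Fin n → Matrix (ParamIdx n d) (ParamIdx n d) ℝ} (ω₀ : Fin n → ParamIdx n d → ℝ)
  (x : Fin n → EuclideanSpace ℝ (Fin d))

theorem continuous_formation :
    Continuous fun θ : EuclideanSpace ℝ (ParamIdx n d) => formation θ.ofLp := by
  refine continuous_pi fun j => ?_
  by_cases hj : j = 0
  · simp only [formation, hj, dite_true]
    exact continuous_const
  · simp only [formation, hj, dite_false]
    refine (PiLp.continuous_toLp 2 _).comp (continuous_pi fun c => ?_)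
    fun_prop

/-- After `n` steps the weights have an expectation, and it converges to the weights of the true
formation. -/
theorem integrable_and_tendsto_fdColumn (hd : 2 ≤ d) (hG : G.Connected)
    (ha_pos : ∀ i j, (j = i ∨ G.Adj i j) → 0 < a i j)
    (ha_sum : ∀ i, ∑ j ∈ insert i (G.neighborFinset i), a i j = 1)
    (hx : Function.Injective x)
    (hE : ∀ i j, G.Adj i j → (E i j).PosDef) (hΩ₀ : ∀ i, (Ω₀ i).PosSemidef)
    {S : Type*} [MeasurableSpace S] {P : Measure S} [IsProbabilityMeasure P]
    (ε : Fin n → Fin n → ℕ → S → EuclideanSpace ℝ (Fin d))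
    (hε_law : ∀ i j k, G.Adj i j → HasLaw (ε i j k) (multivariateGaussian 0 (E i j)) P)
    (hε_indep : iIndepFun (fun (e : G.Dart × ℕ) => ε e.1.fst e.1.snd e.2) P)
    {δ : ℝ} (hδ : 0 < δ) (i : Fin n) :
    (∀ k, n ≤ k → Integrable (fun s =>
      fdColumn δ (stateEstimate G a E Ω₀ ω₀ x (fun p q t => ε p q t s) i k) i) P) ∧
    Tendsto (fun k => ∫ s, fdColumn δ
      (stateEstimate G a E Ω₀ ω₀ x (fun p q t => ε p q t s) i k) i ∂P) atTop
      (𝓝 (fdColumn δ (localFrame x) i)) := by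
  let f : EuclideanSpace ℝ (ParamIdx n d) → EuclideanSpace ℝ (Fin d) := fun θ =>
    fdColumn δ (formation θ.ofLp) i
  have hfm : Measurable f := (measurable_fdColumn δ i).comp continuous_formation.measurable
  obtain ⟨K₁, hK₁, hdom⟩ := enorm_fdColumn_rpow_le (n := n) hd hδ i
  obtain ⟨K₂, hK₂, M, hmom⟩ := exists_lintegral_singularFactor_le (d := d) (Ω₀ := Ω₀) G ω₀ x hG
    ha_pos ha_sum hE hΩ₀ i i
  let g : EuclideanSpace ℝ (ParamIdx n d) → ENNReal := fun θ => K₁ *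
    ∏ p : Fin d × {l : Fin n // l ≠ i}, singularFactor p.1
      (formation θ.ofLp p.2 p.1 - formation θ.ofLp i p.1) ^ (3 / 4 : ℝ)
  have hfg : ∀ θ, ‖f θ‖ₑ ^ (3 / 2 : ℝ) ≤ g θ := fun θ => hdom _
  have hg : ∀ k : ℕ, n ≤ k → ∫⁻ θ, g θ ∂(multivariateGaussian (estimateMean G a E Ω₀ ω₀ x k i)
      (estimateCov G a E Ω₀ k i)) ≤ K₁ * K₂ * (k + 1) ^ M := by
    intro k hk
    simp only [g]
    rw [lintegral_const_mul' _ _ hK₁, mul_assoc]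
    gcongr
    exact hmom k hk
  have hlaw : ∀ k : ℕ, n ≤ k → _ := fun k hk => map_gaussEstimate G ω₀ x hE ε hε_law hε_indep
    (isUnit_det_infoMatrix (d := d) (Ω₀ := Ω₀) G hG ha_pos ha_sum hE hΩ₀ hk i)
  refine ⟨fun k hk => ?_, ?_⟩
  · have hint : Integrable f (multivariateGaussian (estimateMean G a E Ω₀ ω₀ x k i)
        (estimateCov G a E Ω₀ k i)) :=
      integrable_of_enorm_rpow_le hfm.aestronglyMeasurable hfg
        (ne_top_of_le_ne_top (ENNReal.mul_ne_top (ENNReal.mul_ne_top hK₁ hK₂) (by simp)) (hg k hk))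
    rw [← (hlaw k hk).map_eq] at hint
    exact hint.comp_aemeasurable (hlaw k hk).aemeasurable
  · have hcont : ContinuousAt f (WithLp.toLp 2 (trueParam x)) := by
      refine ContinuousAt.comp (g := fun y => fdColumn δ y i) ?_ continuous_formation.continuousAt
      simp only [formation_trueParam]
      exact continuousAt_fdColumn hδ i fun p q hpq => hx (by simpa [localFrame] using hpq)
    obtain ⟨C, hC⟩ := exists_estimateCov_le (d := d) (Ω₀ := Ω₀) G hG ha_pos ha_sum hE hΩ₀
    have hlim := tendsto_integral_multivariateGaussian hfm.stronglyMeasurable hfg hcont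
      (tendsto_estimateMean G ω₀ x hG ha_pos ha_sum hE hΩ₀ i)
      (fun k => estimateCov_posSemidef G hE k i)
      ((eventually_ge_atTop n).mono fun k hk p => hC k hk i p)
      (ENNReal.mul_ne_top hK₁ hK₂) M ((eventually_ge_atTop n).mono hg)
    have hval : f (WithLp.toLp 2 (trueParam x)) = fdColumn δ (localFrame x) i := by
      simp only [f, formation_trueParam]
    rw [hval] at hlim
    refine hlim.congr' ((eventually_ge_atTop n).mono fun k hk => ?_)
    rw [← (hlaw k hk).map_eq, integral_map (hlaw k hk).aemeasurable hfm.aestronglyMeasurable]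
    rfl

end WeightLimit

/-! ### The consensus filter -/

theorem tendsto_zero_of_le_mul_add {x b : ℕ → ℝ} {ρ : ℝ} (hρ0 : 0 ≤ ρ) (hρ : ρ < 1)
    (hx : ∀ k, 0 ≤ x k) (hb : Tendsto b atTop (𝓝 0)) (h : ∀ k, x (k + 1) ≤ ρ * x k + b k) :
    Tendsto x atTop (𝓝 0) := by
  rw [Metric.tendsto_atTop]
  intro ε hε
  have hε' : 0 < (1 - ρ) * (ε / 2) := mul_pos (by linarith) (by linarith)
  obtain ⟨N, hN⟩ := eventually_atTop.1 (hb.eventually_lt_const hε')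
  -- `x - ε / 2` contracts from time `N` on
  have hgeo : ∀ m, x (N + m) - ε / 2 ≤ ρ ^ m * (x N + ε / 2) := by
    intro m
    induction m with
    | zero => simp; linarith
    | succ m ih =>
      have h1 := h (N + m)
      have h2 := hN (N + m) (by omega)
      have h3 := mul_le_mul_of_nonneg_left ih hρ0
      rw [← add_assoc, pow_succ']
      nlinarith
  have hlim : Tendsto (fun m => ρ ^ m * (x N + ε / 2)) atTop (𝓝 0) := by
    simpa using (tendsto_pow_atTop_nhds_zero_of_lt_one hρ0 hρ).mul_const (x N + ε / 2)
  obtain ⟨M, hM⟩ := eventually_atTop.1 (hlim.eventually_lt_const (show (0 : ℝ) < ε / 2 by linarith))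
  refine ⟨N + M, fun k hk => ?_⟩
  obtain ⟨m, rfl⟩ : ∃ m, k = N + m := ⟨k - N, by omega⟩
  rw [Real.dist_eq, sub_zero, abs_of_nonneg (hx _)]
  linarith [hgeo m, hM m (by omega)]

section Filter

variable {n : ℕ} (G : SimpleGraph (Fin n)) [DecidableRel G.Adj]

/-- One step of the consensus iteration contracts the vectors of zero sum, the orthogonal complement
of the kernel of the Laplacian, by the condition on the step-size. -/
theorem exists_contraction_lapMatrix [NeZero n] (hG : G.Connected) {β : ℝ} (hβ : 0 < β)
    (hβ_stable : ∀ lam : ℝ,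
      Module.End.HasEigenvalue (Matrix.toLin' (G.lapMatrix ℝ)) lam → β * lam < 2) :
    ∃ ρ : ℝ, 0 ≤ ρ ∧ ρ < 1 ∧ ∀ w : Fin n → ℝ, ∑ i, w i = 0 →
      ‖(WithLp.toLp 2 (w - β • (G.lapMatrix ℝ *ᵥ w)) : EuclideanSpace ℝ (Fin n))‖ ≤
        ρ * ‖(WithLp.toLp 2 w : EuclideanSpace ℝ (Fin n))‖ := by
  have hL : (G.lapMatrix ℝ).IsHermitian := G.isHermitian_lapMatrix ℝ
  set u := hL.eigenvectorBasis with hu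
  set lam := hL.eigenvalues with hlam
  have hLu : ∀ i, G.lapMatrix ℝ *ᵥ (u i).ofLp = lam i • (u i).ofLp := hL.mulVec_eigenvectorBasis
  have hnn : ∀ i, 0 ≤ lam i := (G.posSemidef_lapMatrix ℝ).eigenvalues_nonneg
  have hlt : ∀ i, β * lam i < 2 := by
    intro i
    refine hβ_stable _ (Module.End.hasEigenvalue_of_hasEigenvector (x := (u i).ofLp)
      ⟨Module.End.mem_eigenspace_iff.2 (by simpa using hLu i), ?_⟩)
    intro h0
    have h1 := u.orthonormal.ne_zero i
    exact h1 (by ext j; exact congrFun h0 j)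
  obtain ⟨i₀, -, hmax⟩ := Finset.exists_max_image Finset.univ
    (fun i => if lam i = 0 then 0 else |1 - β * lam i|) ⟨(0 : Fin n), Finset.mem_univ _⟩
  set ρ : ℝ := if lam i₀ = 0 then 0 else |1 - β * lam i₀| with hρ
  have hρ0 : 0 ≤ ρ := by rw [hρ]; split_ifs <;> positivity
  refine ⟨ρ, hρ0, ?_, fun w hw => ?_⟩
  · rw [hρ]
    split_ifs with h0
    · exact one_pos
    · have h1 : 0 < lam i₀ := lt_of_le_of_ne (hnn i₀) (Ne.symm h0)
      rw [abs_lt]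
      constructor <;> nlinarith [hlt i₀, mul_pos hβ h1]
  · set W : EuclideanSpace ℝ (Fin n) := WithLp.toLp 2 w with hW
    set W' : EuclideanSpace ℝ (Fin n) := WithLp.toLp 2 (w - β • (G.lapMatrix ℝ *ᵥ w)) with hW'
    have hcoord : ∀ i, ⟪u i, W'⟫ = (1 - β * lam i) * ⟪u i, W⟫ := by
      intro i
      simp only [EuclideanSpace.inner_eq_star_dotProduct, star_trivial, hW, hW']
      have h1 : (G.lapMatrix ℝ *ᵥ w) ⬝ᵥ (u i).ofLp = lam i * (w ⬝ᵥ (u i).ofLp) := by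
        have hs : (G.lapMatrix ℝ).transpose = G.lapMatrix ℝ := G.isSymm_lapMatrix (R := ℝ)
        rw [← hs, mulVec_transpose, ← dotProduct_mulVec, hLu i, dotProduct_smul, smul_eq_mul]
      rw [sub_dotProduct, smul_dotProduct, h1, smul_eq_mul]
      ring
    have hsq : ‖W'‖ ^ 2 ≤ (ρ * ‖W‖) ^ 2 := by
      rw [mul_pow, ← u.sum_sq_inner_right W', ← u.sum_sq_inner_right W, Finset.mul_sum]
      refine Finset.sum_le_sum fun i _ => ?_
      rw [hcoord, mul_pow]
      by_cases h0 : lam i = 0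
      · -- an eigenvector for the eigenvalue `0` is constant, hence orthogonal to `w`
        have hconst : ∀ p q, (u i).ofLp p = (u i).ofLp q := fun p q =>
          (G.lapMatrix_mulVec_eq_zero_iff_forall_reachable).1
            (by rw [hLu i, h0, zero_smul]) p q (hG.preconnected p q)
        have : ⟪u i, W⟫ = 0 := by
          simp only [EuclideanSpace.inner_eq_star_dotProduct, star_trivial, hW, dotProduct]
          rw [Finset.sum_congr rfl fun q _ => by rw [hconst q 0], ← Finset.sum_mul, hw, zero_mul]
        rw [this]
        simp
      · refine mul_le_mul_of_nonneg_right ?_ (sq_nonneg _)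
        have h1 := hmax i (Finset.mem_univ i)
        simp only [if_neg h0] at h1
        rw [← sq_abs]
        exact pow_le_pow_left₀ (abs_nonneg _) h1 2
    exact le_of_sq_le_sq hsq (mul_nonneg hρ0 (norm_nonneg _))

/-- The sum of the states `q` is conserved, so that the outputs have the average of the inputs, and
the disagreement of the outputs is contracted up to the increments of the inputs. -/
theorem tendsto_consensus [NeZero n] (hG : G.Connected) {β : ℝ} (hβ : 0 < β)
    (hβ_stable : ∀ lam : ℝ,
      Module.End.HasEigenvalue (Matrix.toLin' (G.lapMatrix ℝ)) lam → β * lam < 2)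
    {q μ : ℕ → Fin n → ℝ} (hq₀ : ∑ i, q 0 i = 0)
    (hq : ∀ k, q (k + 1) = q k - β • (G.lapMatrix ℝ *ᵥ (q k + μ k)))
    {μ' : Fin n → ℝ} (hμ : ∀ i, Tendsto (fun k => μ k i) atTop (𝓝 (μ' i))) (i : Fin n) :
    Tendsto (fun k => q k i + μ k i) atTop (𝓝 ((n : ℝ)⁻¹ * ∑ j, μ' j)) := by
  obtain ⟨ρ, hρ0, hρ1, hcontr⟩ := exists_contraction_lapMatrix G hG hβ hβ_stable
  have hn : (n : ℝ) ≠ 0 := NeZero.ne _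
  have hsumL : ∀ w : Fin n → ℝ, ∑ i, (G.lapMatrix ℝ *ᵥ w) i = 0 := by
    intro w
    have h1 : (fun _ => (1 : ℝ)) ⬝ᵥ G.lapMatrix ℝ *ᵥ w = 0 := by
      have hs : (G.lapMatrix ℝ).transpose = G.lapMatrix ℝ := G.isSymm_lapMatrix (R := ℝ)
      rw [dotProduct_mulVec, ← mulVec_transpose, hs, G.lapMatrix_mulVec_const_eq_zero,
        zero_dotProduct]
    simpa [dotProduct] using h1
  have hsum : ∀ k, ∑ i, q k i = 0 := by
    intro k
    induction k with
    | zero => exact hq₀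
    | succ k ih =>
      rw [hq]
      simp only [Pi.sub_apply, Pi.smul_apply, smul_eq_mul, Finset.sum_sub_distrib,
        ← Finset.mul_sum, hsumL, ih]
      simp
  -- the disagreement, and the increments of the centered input that drive it
  let avg : ℕ → ℝ := fun k => (n : ℝ)⁻¹ * ∑ j, μ k j
  let e : ℕ → Fin n → ℝ := fun k => q k + μ k - fun _ => avg k
  let D : ℕ → Fin n → ℝ := fun k => (μ (k + 1) - μ k) - fun _ => avg (k + 1) - avg k
  have he0 : ∀ k, ∑ i, e k i = 0 := by
    intro k
    simp only [e, Pi.sub_apply, Pi.add_apply, Finset.sum_sub_distrib, Finset.sum_add_distrib, hsum,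
      Finset.sum_const, Finset.card_univ, Fintype.card_fin, nsmul_eq_mul, avg]
    field_simp
    ring
  have hLe : ∀ k, G.lapMatrix ℝ *ᵥ e k = G.lapMatrix ℝ *ᵥ (q k + μ k) := by
    intro k
    have : (fun _ : Fin n => avg k) = avg k • fun _ => (1 : ℝ) := by ext; simp
    simp only [e]
    rw [mulVec_sub, this, mulVec_smul, G.lapMatrix_mulVec_const_eq_zero, smul_zero, sub_zero]
  have hrec : ∀ k, e (k + 1) = (e k - β • (G.lapMatrix ℝ *ᵥ e k)) + D k := by
    intro k
    rw [hLe]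
    funext i
    simp only [e, D, hq, Pi.sub_apply, Pi.add_apply, Pi.smul_apply]
    ring
  have havg : Tendsto avg atTop (𝓝 ((n : ℝ)⁻¹ * ∑ j, μ' j)) :=
    (tendsto_finsetSum _ fun j _ => hμ j).const_mul _
  have hD : Tendsto (fun k => (WithLp.toLp 2 (D k) : EuclideanSpace ℝ (Fin n))) atTop (𝓝 0) := by
    have h1 : Tendsto D atTop (𝓝 0) := by
      rw [tendsto_pi_nhds]
      intro i
      have h2 := (((tendsto_add_atTop_iff_nat 1).2 (hμ i)).sub (hμ i)).sub
        (((tendsto_add_atTop_iff_nat 1).2 havg).sub havg)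
      simpa [D] using h2
    exact ((PiLp.continuous_toLp 2 (fun _ : Fin n => ℝ)).tendsto 0).comp h1
  have he : Tendsto (fun k => ‖(WithLp.toLp 2 (e k) : EuclideanSpace ℝ (Fin n))‖) atTop (𝓝 0) := by
    refine tendsto_zero_of_le_mul_add hρ0 hρ1 (fun k => norm_nonneg _) (tendsto_norm_zero.comp hD)
      fun k => ?_
    rw [hrec, WithLp.toLp_add]
    exact (norm_add_le _ _).trans (add_le_add (hcontr _ (he0 k)) le_rfl)
  have hei : Tendsto (fun k => e k i) atTop (𝓝 0) :=
    squeeze_zero_norm (fun k => PiLp.norm_apply_le (WithLp.toLp 2 (e k)) i) he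
  have := hei.add havg
  rw [zero_add] at this
  refine this.congr fun k => ?_
  simp [e]

variable {d : ℕ}

theorem tendsto_filterOutput [NeZero n] (hG : G.Connected) {β : ℝ} (hβ : 0 < β)
    (hβ_stable : ∀ lam : ℝ,
      Module.End.HasEigenvalue (Matrix.toLin' (G.lapMatrix ℝ)) lam → β * lam < 2)
    {q₀ : Fin n → EuclideanSpace ℝ (Fin d)} (hq₀ : ∑ i, q₀ i = 0)
    {μ : Fin n → ℕ → EuclideanSpace ℝ (Fin d)} {μ' : Fin n → EuclideanSpace ℝ (Fin d)}
    (hμ : ∀ i, Tendsto (μ i) atTop (𝓝 (μ' i))) (i : Fin n) :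
    Tendsto (filterOutput G β q₀ μ i) atTop (𝓝 ((n : ℝ)⁻¹ • ∑ j, μ' j)) := by
  have hc : ∀ c, Tendsto (fun k => filterOutput G β q₀ μ i k c) atTop
      (𝓝 (((n : ℝ)⁻¹ • ∑ j, μ' j) c)) := by
    intro c
    have h := tendsto_consensus G hG hβ hβ_stable (q := fun k i => filterState G β q₀ μ k i c)
      (μ := fun k i => μ i k c) (by
        have := congrArg (fun w : EuclideanSpace ℝ (Fin d) => w c) hq₀
        simpa [filterState] using this) (fun k => by
        funext i
        simp only [filterState, PiLp.add_apply, PiLp.smul_apply, WithLp.ofLp_sum, Finset.sum_apply,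
          PiLp.sub_apply, Pi.sub_apply, Pi.smul_apply, smul_eq_mul, G.lapMatrix_mulVec_apply,
          Pi.add_apply, Finset.sum_sub_distrib, Finset.sum_const,
          SimpleGraph.card_neighborFinset_eq_degree,
          nsmul_eq_mul, Finset.sum_add_distrib]
        ring) (μ' := fun j => μ' j c) (fun j =>
          ((EuclideanSpace.proj c : EuclideanSpace ℝ (Fin d) →L[ℝ] ℝ).continuous.tendsto _).comp
            (hμ j)) i
    simpa [filterOutput] using h
  have h1 : Tendsto (fun k => WithLp.ofLp (filterOutput G β q₀ μ i k)) atTop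
      (𝓝 (WithLp.ofLp ((n : ℝ)⁻¹ • ∑ j, μ' j))) := tendsto_pi_nhds.2 hc
  exact ((PiLp.continuous_toLp 2 (fun _ : Fin d => ℝ)).tendsto _).comp h1

variable {S : Type*} [MeasurableSpace S] {P : Measure S}

/-- The filter is linear, so that it commutes with expectations. -/
theorem integrable_filterState [IsFiniteMeasure P] (β : ℝ) (q₀ : Fin n → EuclideanSpace ℝ (Fin d))
    {μ : Fin n → ℕ → S → EuclideanSpace ℝ (Fin d)} (hμ : ∀ i k, Integrable (μ i k) P) (k : ℕ)
    (i : Fin n) :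
    Integrable (fun s => filterState G β q₀ (fun j l => μ j l s) k i) P := by
  induction k generalizing i with
  | zero => exact integrable_const _
  | succ k ih =>
    simp only [filterState]
    exact ((ih i).add ((integrable_finsetSum _ fun j _ => (ih j).sub (ih i)).smul β)).add
      ((integrable_finsetSum _ fun j _ => (hμ j k).sub (hμ i k)).smul β)

theorem integral_filterState [IsProbabilityMeasure P] (β : ℝ)
    (q₀ : Fin n → EuclideanSpace ℝ (Fin d))
    {μ : Fin n → ℕ → S → EuclideanSpace ℝ (Fin d)} (hμ : ∀ i k, Integrable (μ i k) P) (k : ℕ)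
    (i : Fin n) :
    ∫ s, filterState G β q₀ (fun j l => μ j l s) k i ∂P =
      filterState G β q₀ (fun j l => ∫ s, μ j l s ∂P) k i := by
  induction k generalizing i with
  | zero => simp [filterState]
  | succ k ih =>
    have hI := integrable_filterState G β q₀ hμ k
    have h1 : Integrable (fun s => β • ∑ j ∈ G.neighborFinset i,
        (filterState G β q₀ (fun j l => μ j l s) k j - filterState G β q₀ (fun j l => μ j l s) k i))
        P := (integrable_finsetSum _ fun j _ => (hI j).sub (hI i)).smul β
    have h2 : Integrable (fun s => β • ∑ j ∈ G.neighborFinset i, (μ j k s - μ i k s)) P :=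
      (integrable_finsetSum _ fun j _ => (hμ j k).sub (hμ i k)).smul β
    simp only [filterState]
    refine (integral_add ((hI i).add h1) h2).trans (congrArg₂ (· + ·)
      ((integral_add (hI i) h1).trans (congrArg₂ (· + ·) (ih i) ?_)) ?_)
    · rw [integral_smul]
      refine congrArg (β • ·) ((integral_finsetSum _ fun j _ => (hI j).sub (hI i)).trans
        (Finset.sum_congr rfl fun j _ => (integral_sub (hI j) (hI i)).trans ?_))
      rw [ih, ih]
    · rw [integral_smul]
      exact congrArg (β • ·) ((integral_finsetSum _ fun j _ => (hμ j k).sub (hμ i k)).trans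
        (Finset.sum_congr rfl fun j _ => integral_sub (hμ j k) (hμ i k)))

end Filter

/-! ### Expectation of the local gradients -/

section Expectation

variable {n d : ℕ} [NeZero n] (G : SimpleGraph (Fin n)) [DecidableRel G.Adj]
  (a : Fin n → Fin n → ℝ) (E : Fin n → Fin n → Matrix (Fin d) (Fin d) ℝ)
  (Ω₀ : Fin n → Matrix (ParamIdx n d) (ParamIdx n d) ℝ) (ω₀ : Fin n → ParamIdx n d → ℝ)
  (x : Fin n → EuclideanSpace ℝ (Fin d))

theorem measurable_mulVec {T : Type*} [MeasurableSpace T] {ι κ : Type*} [Fintype ι]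
    (M : Matrix κ ι ℝ) {f : T → ι → ℝ} (hf : Measurable f) : Measurable fun t => M *ᵥ f t := by
  refine measurable_pi_iff.2 fun p => ?_
  simp only [mulVec, dotProduct]
  exact Finset.measurable_fun_sum _ fun q _ => (measurable_pi_iff.1 hf q).const_mul _

theorem measurable_stateEstimate {T : Type*} [MeasurableSpace T]
    {ε : T → Fin n → Fin n → ℕ → EuclideanSpace ℝ (Fin d)}
    (hε : ∀ i j k, Measurable fun t => ε t i j k) (i : Fin n) (k : ℕ) :
    Measurable fun t => stateEstimate G a E Ω₀ ω₀ x (ε t) i k := by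
  have hs : ∀ k i, Measurable fun t => relMeas G x (ε t) k i := by
    intro k i
    refine measurable_pi_iff.2 fun p => ?_
    have h1 := (EuclideanSpace.proj p.1 :
      EuclideanSpace ℝ (Fin d) →L[ℝ] ℝ).continuous.measurable.comp (hε i p.2 k)
    exact h1.const_add _
  have hω : ∀ k i, Measurable fun t =>
      infoVector G a (obsMatrix G d) (noiseCov G E) (relMeas G x (ε t)) ω₀ k i := by
    intro k
    induction k with
    | zero => exact fun i => measurable_const
    | succ k ih =>
      intro i
      refine Measurable.add (Finset.measurable_fun_sum _ fun j _ => (ih j).const_smul (a i j)) ?_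
      exact measurable_mulVec _ (hs k i)
  have hθ := measurable_mulVec (infoMatrix G a (obsMatrix G d) (noiseCov G E) Ω₀ k i)⁻¹ (hω k i)
  exact continuous_formation.measurable.comp
    ((PiLp.continuous_toLp 2 (fun _ : ParamIdx n d => ℝ)).measurable.comp hθ)

theorem stateEstimate_congr {ε ε' : Fin n → Fin n → ℕ → EuclideanSpace ℝ (Fin d)}
    (h : ∀ i j k, G.Adj i j → ε i j k = ε' i j k) (i : Fin n) (k : ℕ) :
    stateEstimate G a E Ω₀ ω₀ x ε i k = stateEstimate G a E Ω₀ ω₀ x ε' i k := by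
  have : relMeas G x ε = relMeas G x ε' := by
    funext k i p
    simp only [relMeas, h i p.2 k p.2.2]
  rw [stateEstimate, stateEstimate, this]

/-- The weights are a function of the noises of the relative measurements, and as such they are
independent of the signal noise. -/
theorem indepFun_fdColumn {S : Type*} [MeasurableSpace S] {P : Measure S}
    (ε : Fin n → Fin n → ℕ → S → EuclideanSpace ℝ (Fin d)) {v : S → ℝ}
    (hv : IndepFun v (fun s (e : G.Dart × ℕ) => ε e.1.fst e.1.snd e.2 s) P) (δ : ℝ) (i : Fin n)
    (k : ℕ) :
    IndepFun v (fun s =>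
      fdColumn δ (stateEstimate G a E Ω₀ ω₀ x (fun p q t => ε p q t s) i k) i) P := by
  classical
  -- the noises of pairs that are not neighbors are not used by the estimate
  let ε' : (G.Dart × ℕ → EuclideanSpace ℝ (Fin d)) → Fin n → Fin n → ℕ →
      EuclideanSpace ℝ (Fin d) := fun η p q t => if h : G.Adj p q then η (⟨(p, q), h⟩, t) else 0
  have hε' : ∀ p q t, Measurable fun η => ε' η p q t := by
    intro p q t
    by_cases h : G.Adj p q
    · simp only [ε', h, dite_true]
      exact measurable_pi_apply _
    · simp only [ε', h, dite_false]
      exact measurable_const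
  have h1 := hv.comp measurable_id
    ((measurable_fdColumn δ i).comp (measurable_stateEstimate G a E Ω₀ ω₀ x hε' i k))
  have h2 : (fun s => fdColumn δ (stateEstimate G a E Ω₀ ω₀ x (fun p q t => ε p q t s) i k) i)
      = (((fun y => fdColumn δ y i) ∘ fun η => stateEstimate G a E Ω₀ ω₀ x (ε' η) i k) ∘
        fun s (e : G.Dart × ℕ) => ε e.1.fst e.1.snd e.2 s) := by
    funext s
    simp only [Function.comp]
    rw [stateEstimate_congr G a E Ω₀ ω₀ x (ε' := ε' fun e => ε e.1.fst e.1.snd e.2 s)]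
    intro p q t hpq
    simp [ε', hpq]
  rw [h2]
  exact h1

end Expectation

/-- The average of the signal measurements is unbiased and independent of the weights. -/
theorem integrable_and_integral_localGradient {S : Type*} [MeasurableSpace S] {P : Measure S}
    [IsProbabilityMeasure P] {n d : ℕ} (δ : ℝ) (i : Fin n) (k : ℕ)
    {xhat : S → Fin n → EuclideanSpace ℝ (Fin d)}
    (hY : Integrable (fun s => fdColumn δ (xhat s) i) P) (z : ℝ) {v : ℕ → S → ℝ}
    (hv : ∀ τ, Integrable (v τ) P) (hv_mean : ∀ τ, ∫ s, v τ s ∂P = 0)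
    (hind : ∀ τ, IndepFun (v τ) (fun s => fdColumn δ (xhat s) i) P) :
    Integrable (fun s => localGradient δ (xhat s) i (fun τ => z + v τ s) k) P ∧
    ∫ s, localGradient δ (xhat s) i (fun τ => z + v τ s) k ∂P
      = z • ∫ s, fdColumn δ (xhat s) i ∂P := by
  have hterm : ∀ τ, Integrable (fun s => v τ s • fdColumn δ (xhat s) i) P :=
    fun τ => (hind τ).integrable_smul (hv τ) hY
  have hterm0 : ∀ τ, ∫ s, v τ s • fdColumn δ (xhat s) i ∂P = 0 := by
    intro τ
    rw [(hind τ).integral_fun_smul_eq_smul_integral (hv τ).aestronglyMeasurable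
      hY.aestronglyMeasurable, hv_mean, zero_smul]
  have e : (fun s => localGradient δ (xhat s) i (fun τ => z + v τ s) k) = fun s =>
      z • fdColumn δ (xhat s) i + ((k : ℝ) + 1)⁻¹ • ∑ τ ∈ Finset.range (k + 1),
        v τ s • fdColumn δ (xhat s) i := by
    funext s
    rw [localGradient, ← Finset.sum_smul, smul_smul, ← add_smul, Finset.sum_add_distrib]
    congr 1
    have hk : (k : ℝ) + 1 ≠ 0 := by positivity
    simp only [Finset.sum_const, Finset.card_range, nsmul_eq_mul]
    push_cast
    field_simp
  have hsum : Integrable (fun s => ((k : ℝ) + 1)⁻¹ • ∑ τ ∈ Finset.range (k + 1),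
      v τ s • fdColumn δ (xhat s) i) P :=
    (integrable_finsetSum (Finset.range (k + 1)) fun τ _ => hterm τ).fun_smul _
  rw [e]
  refine ⟨(hY.smul z).add hsum, ?_⟩
  refine (integral_add (hY.smul z) hsum).trans ?_
  rw [integral_smul, integral_finsetSum _ fun τ _ => hterm τ,
    Finset.sum_eq_zero fun τ _ => hterm0 τ, smul_zero, add_zero]
  exact integral_smul z _

theorem sum_smul_fdColumn {n d : ℕ} (δ : ℝ) (x : Fin n → EuclideanSpace ℝ (Fin d)) (f : Fin n → ℝ) :
    ∑ i, f i • fdColumn δ x i = WithLp.toLp 2 (fdWeights δ x *ᵥ f) := by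
  ext c
  simp [fdColumn, mulVec, dotProduct, mul_comm]

end SourceSeeking

open SourceSeeking in
theorem theorem4
    {n d dy : ℕ} [NeZero n] (hd : 2 ≤ d)
    -- communication graph and averaging weights
    (G : SimpleGraph (Fin n)) [DecidableRel G.Adj] (hG : G.Connected)
    (a : Fin n → Fin n → ℝ)
    (ha_pos : ∀ i j, (j = i ∨ G.Adj i j) → 0 < a i j)
    (ha_sum : ∀ i, ∑ j ∈ insert i (G.neighborFinset i), a i j = 1)
    -- sensor states
    (x : Fin n → EuclideanSpace ℝ (Fin d)) (hx : Function.Injective x)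
    -- signal field, in the frame of sensor `0`, and source state
    (h : EuclideanSpace ℝ (Fin d) → EuclideanSpace ℝ (Fin dy) → ℝ)
    (y : EuclideanSpace ℝ (Fin dy))
    (hh : DifferentiableAt ℝ (fun ξ => h ξ y) (centroid (localFrame x)))
    -- relative measurement noise: Gaussian, independent over times and over pairs of sensors
    {S : Type*} [MeasurableSpace S] (P : Measure S) [IsProbabilityMeasure P]
    (E : Fin n → Fin n → Matrix (Fin d) (Fin d) ℝ)
    (hE : ∀ i j, G.Adj i j → (E i j).PosDef)
    (ε : Fin n → Fin n → ℕ → S → EuclideanSpace ℝ (Fin d))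
    (hε_law : ∀ i j k, G.Adj i j → HasLaw (ε i j k) (multivariateGaussian 0 (E i j)) P)
    (hε_indep : iIndepFun (fun (e : G.Dart × ℕ) => ε e.1.fst e.1.snd e.2) P)
    -- signal noise: zero mean, finite second moment, independent of the relative measurements
    (v : Fin n → ℕ → S → ℝ)
    (hv_mem : ∀ i τ, MemLp (v i τ) 2 P)
    (hv_mean : ∀ i τ, ∫ s, v i τ s ∂P = 0)
    (hv_indep : ∀ i τ,
      IndepFun (v i τ) (fun s (e : G.Dart × ℕ) => ε e.1.fst e.1.snd e.2 s) P)
    -- initialization of the estimator: Gaussian densities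
    (Ω₀ : Fin n → Matrix (ParamIdx n d) (ParamIdx n d) ℝ) (hΩ₀ : ∀ i, (Ω₀ i).PosDef)
    (ω₀ : Fin n → ParamIdx n d → ℝ)
    -- shape parameter, step-size and initialization of the consensus filter
    (δ : ℝ) (hδ : 0 < δ)
    (β : ℝ) (hβ : 0 < β)
    (hβ_stable : ∀ lam : ℝ,
      Module.End.HasEigenvalue (Matrix.toLin' (G.lapMatrix ℝ)) lam → β * lam < 2)
    (q₀ : Fin n → EuclideanSpace ℝ (Fin d)) (hq₀ : ∑ i, q₀ i = 0)
    -- in the first `n` steps the weights used by the sensors have an expectation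
    (hstart : ∀ i k, k < n → Integrable (fun s =>
      fdColumn δ (stateEstimate G a E Ω₀ ω₀ x (fun p q t => ε p q t s) i k) i) P) :
    let r : Fin n → ℕ → S → EuclideanSpace ℝ (Fin d) := fun i k s =>
      gradientOutput G a E Ω₀ ω₀ δ β q₀ x (fun p q t => ε p q t s)
        (fun j τ => h (localFrame x j) y + v j τ s) i k
    (∀ i k, Integrable (r i k) P) ∧
    ∀ i, ∃ L : EuclideanSpace ℝ (Fin d),
      Tendsto (fun k => ∫ s, r i k s ∂P) atTop (𝓝 L) ∧
      (n : ℝ) • L =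
        gradient (fun ξ => h ξ y) (centroid (localFrame x))
          + fdError δ (fun ξ => h ξ y) (localFrame x) := by
  intro r
  have hΩ : ∀ i, (Ω₀ i).PosSemidef := fun i => (hΩ₀ i).posSemidef
  let z : Fin n → ℝ := fun i => h (localFrame x i) y
  let Y : Fin n → ℕ → S → EuclideanSpace ℝ (Fin d) := fun i k s =>
    fdColumn δ (stateEstimate G a E Ω₀ ω₀ x (fun p q t => ε p q t s) i k) i
  let μ : Fin n → ℕ → S → EuclideanSpace ℝ (Fin d) := fun j l s =>
    localGradient δ (stateEstimate G a E Ω₀ ω₀ x (fun p q t => ε p q t s) j l) j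
      (fun τ => z j + v j τ s) l
  have hW := fun i => integrable_and_tendsto_fdColumn G ω₀ x hd hG ha_pos ha_sum hx hE hΩ ε hε_law
    hε_indep hδ i
  have hY : ∀ i k, Integrable (Y i k) P := fun i k => by
    rcases lt_or_ge k n with hk | hk
    · exact hstart i k hk
    · exact (hW i).1 k hk
  have hμ := fun i k => integrable_and_integral_localGradient δ i k (hY i k) (z i)
    (fun τ => (hv_mem i τ).integrable one_le_two) (hv_mean i)
    (fun τ => indepFun_fdColumn G a E Ω₀ ω₀ x ε (hv_indep i τ) δ i k)
  have hμ_int : ∀ i k, Integrable (μ i k) P := fun i k => (hμ i k).1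
  have hq_int := integrable_filterState G β q₀ hμ_int
  have hr : ∀ i k, ∫ s, r i k s ∂P = filterOutput G β q₀ (fun j l => ∫ s, μ j l s ∂P) i k := by
    intro i k
    refine (integral_add (hq_int k i) (hμ_int i k)).trans ?_
    rw [integral_filterState G β q₀ hμ_int k i]
    rfl
  refine ⟨fun i k => (hq_int k i).add (hμ_int i k), fun i =>
    ⟨(n : ℝ)⁻¹ • ∑ j, z j • fdColumn δ (localFrame x) j, ?_, ?_⟩⟩
  · simp_rw [hr]
    refine tendsto_filterOutput G hG hβ hβ_stable hq₀
      (μ' := fun j => z j • fdColumn δ (localFrame x) j) (fun j => ?_) i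
    exact ((hW j).2.const_smul (z j)).congr fun k => (hμ j k).2.symm
  · rw [smul_smul, mul_inv_cancel₀ (NeZero.ne _), one_smul, sum_smul_fdColumn, fdError,
      add_sub_cancel]
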